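/- Let $\Omega\subseteq\mathbb{R}^N$ be open, $0<m\le1$, $a\in\mathbb{C}$, $f\in L^1_{\rm loc}([0,\infty);L^2(\Omega))$ and $u_0\in L^2(\Omega)$; all functions are complex-valued. Consider $$\mathrm{i}\,\partial_tu+\Delta u+a|u|^{-(1-m)}u=f\ \text{ in }(0,\infty)\times\Omega,\qquad u(t)_{|\partial\Omega}=0,\qquad u(0)=u_0,\tag{1}$$ where $|z|^{-(1-m)}z:=0$ at $z=0$. For a Banach space $E$, $L^p_{\rm loc}([0,\infty);E)$ and $W^{1,p}_{\rm loc}([0,\infty);E)$ mean $L^p$, respectively $W^{1,p}$, on $(0,T)$ for every $T>0$, elements of the latter being identified with their absolutely continuous representatives on $[0,\infty)$. *Solutions.* Let $H=L^2(\Omega)$ (respectively $H=H^1_0(\Omega)$). An $H^2$-solution (respectively an $H^1_0$-solution) is a function $$u\in L^{m+1}_{\rm loc}\big([0,\infty);H^1_0(\Omega)\cap L^{m+1}(\Omega)\big)\cap W^{1,\frac{m+1}m}_{\rm loc}\big([0,\infty);H^\star+L^{\frac{m+1}m}(\Omega)\big),\qquad H^\star+L^{\frac{m+1}m}(\Omega)=\big(H\cap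 L^{m+1}(\Omega)\big)^\star,$$ with $\Delta u(t)\in H^\star$ for almost every $t>0$, which satisfies the equation in $\mathscr{D}'((0,\infty)\times\Omega)$. A strong solution of (1) is an $H^2$- or $H^1_0$-solution with $u(0)=u_0$. A weak solution of (1) is a function $u$ with $u(0)=u_0$ for which there are $f_n\in L^1_{\rm loc}([0,\infty);L^2(\Omega))$ and $u_n\in C([0,\infty);L^2(\Omega))$, $n\in\mathbb{N}$, such that $u_n$ is an $H^2$-solution of the equation with $f_n$ in place of $f$ (without prescribed initial datum), and, for every $T>0$, $f_n\to f$ in $L^1((0,T);L^2(\Omega))$ and $u_n\to u$ in $C([0,T];L^2(\Omega))$. **Proposition.** Let $u$ be a weak solution, or a strong solution, of (1). Consider the conditions: a) $u$ is a strong solution; b) $|\Omega|<\infty$; c) $m=1$; d) $\operatorname{Im}(a)=0$. 1. If $\operatorname{Im}(a)\ne0$, or if one of a), b), c) holds, then $u\in L^{m+1}_{\rm loc}([0,\infty);L^{m+1}(\Omega))$. 2. The function $\sigma\mapsto\int_\Omega f(\sigma,x)\overline{u(\sigma,x)}\,dx$ is integrable on bounded subintervals of $[0,\infty)$ and, for all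 $t\ge s\ge0$, $$\tfrac12\|u(t)\|_{L^2(\Omega)}^2+\operatorname{Im}(a)\int_s^t\|u(\sigma)\|_{L^{m+1}(\Omega)}^{m+1}\,d\sigma\ \ge\ \tfrac12\|u(s)\|_{L^2(\Omega)}^2+\operatorname{Im}\int_s^t\!\!\int_\Omega f(\sigma,x)\overline{u(\sigma,x)}\,dx\,d\sigma\quad\text{if }\operatorname{Im}(a)\le0,$$ and the same holds with $\le$ in place of $\ge$ if $\operatorname{Im}(a)\ge0$. If $\operatorname{Im}(a)=0$, the term $\operatorname{Im}(a)\int_s^t\|u(\sigma)\|_{L^{m+1}(\Omega)}^{m+1}d\sigma$ is understood to be $0$. 3. If one of a), b), c), d) holds, then $t\mapsto\|u(t)\|_{L^2(\Omega)}^2$ belongs to $W^{1,1}_{\rm loc}([0,\infty);\mathbb{R})$, and equality holds in 2 for all $t\ge s\ge0$. -/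

import Mathlib

open MeasureTheory Set Filter Topology
open scoped ENNReal ContDiff ComplexConjugate Laplacian

noncomputable section

namespace DampedNLS

/-- The Lebesgue space `L^p(Ω)` of complex-valued functions on `Ω ⊆ ℝ^N`. -/
abbrev LpSp {N : ℕ} (Ω : Set (EuclideanSpace ℝ (Fin N))) (p : ℝ≥0∞) : Type :=
  Lp ℂ p (volume.restrict Ω)

/-- The exponent `m + 1` (used for `m ≥ 0`). -/
def expo (m : ℝ) : ℝ≥0∞ := ENNReal.ofReal m + 1

instance fact_one_le_expo (m : ℝ) : Fact (1 ≤ expo m) := ⟨le_add_self⟩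

theorem expo_eq {m : ℝ} (hm : 0 ≤ m) : expo m = ENNReal.ofReal (m + 1) := by
  rw [ENNReal.ofReal_add hm zero_le_one, ENNReal.ofReal_one, expo]

/-- Complex-valued smooth functions with compact support contained in `U`. -/
def IsTest {V : Type*} [NormedAddCommGroup V] [NormedSpace ℝ V] (U : Set V) (φ : V → ℂ) : Prop :=
  ContDiff ℝ ∞ φ ∧ HasCompactSupport φ ∧ tsupport φ ⊆ U

/-! ### Time-dependent functions with values in a normed space -/

/-- `w ∈ L^p_loc([0,∞); E)`: `w ∈ L^p((0,T); E)` for every `T > 0`. -/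
def MemLpLoc {E : Type*} [NormedAddCommGroup E] (w : ℝ → E) (p : ℝ≥0∞) : Prop :=
  ∀ T : ℝ, 0 < T → MemLp w p (volume.restrict (Ioo 0 T))

/-- `w ∈ W^{1,p}_loc([0,∞); E)`: `w ∈ L^p_loc([0,∞); E)` and `w` is a primitive on `[0,∞)` of
some `v ∈ L^p_loc([0,∞); E)`, which is then its (weak and almost everywhere) derivative. -/
def MemW1Loc {E : Type*} [NormedAddCommGroup E] [NormedSpace ℝ E] (w : ℝ → E) (p : ℝ≥0∞) : Prop :=
  MemLpLoc w p ∧ ∃ v : ℝ → E, MemLpLoc v p ∧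
    ∀ s t : ℝ, 0 ≤ s → s ≤ t → w t = w s + ∫ σ in s..t, v σ

/-! ### Function spaces on `Ω` -/

section Spaces

variable {N : ℕ} (Ω : Set (EuclideanSpace ℝ (Fin N)))

/-- The closure in `L²(Ω) × L²(Ω)^N` of the linear space of all `(φ, ∇φ)` with `φ` a test function
on `Ω`. -/
def H10Sub : Submodule ℝ (LpSp Ω 2 × (Fin N → LpSp Ω 2)) :=
  (Submodule.span ℝ {h | ∃ φ : EuclideanSpace ℝ (Fin N) → ℂ, IsTest Ω φ ∧
    (h.1 =ᵐ[volume.restrict Ω] φ) ∧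
    ∀ i, h.2 i =ᵐ[volume.restrict Ω]
      fun x => fderiv ℝ φ x (EuclideanSpace.single i (1 : ℝ))}).topologicalClosure

/-- The Sobolev space `H¹₀(Ω)`, as a space of pairs `(u, ∇u)`. The norm, induced by the product
`L²(Ω) × L²(Ω)^N`, is equivalent to the usual one. -/
def H10 : Type := H10Sub Ω

instance : NormedAddCommGroup (H10 Ω) := inferInstanceAs (NormedAddCommGroup (H10Sub Ω))

instance : NormedSpace ℝ (H10 Ω) := inferInstanceAs (NormedSpace ℝ (H10Sub Ω))

/-- The inclusion `H¹₀(Ω) → L²(Ω)`. -/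
def H10.toL2 : H10 Ω →L[ℝ] LpSp Ω 2 :=
  (ContinuousLinearMap.fst ℝ (LpSp Ω 2) (Fin N → LpSp Ω 2)).comp (H10Sub Ω).subtypeL

variable {Ω}
variable {H : Type*} [NormedAddCommGroup H] [NormedSpace ℝ H]

/-- For a space `H` included in `L²(Ω)` through `j`, the pairs of an element of `H` and an element
of `L^p(Ω)` which are the same function on `Ω`. -/
def interSub (j : H →L[ℝ] LpSp Ω 2) (p : ℝ≥0∞) [Fact (1 ≤ p)] : Submodule ℝ (H × LpSp Ω p) where
  carrier := {x | j x.1 =ᵐ[volume.restrict Ω] x.2}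
  zero_mem' := by
    simp only [mem_ofPred_eq, Prod.fst_zero, Prod.snd_zero, map_zero]
    exact (Lp.coeFn_zero ℂ 2 _).trans (Lp.coeFn_zero ℂ p _).symm
  add_mem' := by
    intro x y hx hy
    simp only [mem_ofPred_eq, Prod.fst_add, Prod.snd_add, map_add] at *
    exact (Lp.coeFn_add _ _).trans ((hx.add hy).trans (Lp.coeFn_add _ _).symm)
  smul_mem' := by
    intro c x hx
    simp only [mem_ofPred_eq, Prod.smul_fst, Prod.smul_snd, map_smul] at *
    exact (Lp.coeFn_smul _ _).trans ((hx.const_smul c).trans (Lp.coeFn_smul _ _).symm)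

/-- The space `H ∩ L^p(Ω)`, with the norm `max (‖v‖_H) (‖v‖_{L^p})`. -/
def Inter (j : H →L[ℝ] LpSp Ω 2) (p : ℝ≥0∞) [Fact (1 ≤ p)] : Type _ := interSub j p

instance (j : H →L[ℝ] LpSp Ω 2) (p : ℝ≥0∞) [Fact (1 ≤ p)] : NormedAddCommGroup (Inter j p) :=
  inferInstanceAs (NormedAddCommGroup (interSub j p))

instance (j : H →L[ℝ] LpSp Ω 2) (p : ℝ≥0∞) [Fact (1 ≤ p)] : NormedSpace ℝ (Inter j p) :=
  inferInstanceAs (NormedSpace ℝ (interSub j p))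

/-- The inclusion `H ∩ L^p(Ω) → L²(Ω)`. -/
def Inter.toL2 (j : H →L[ℝ] LpSp Ω 2) (p : ℝ≥0∞) [Fact (1 ≤ p)] : Inter j p →L[ℝ] LpSp Ω 2 :=
  j.comp ((ContinuousLinearMap.fst ℝ H (LpSp Ω p)).comp (interSub j p).subtypeL)

/-- For a space `X` included in `L²(Ω)` through `j`, the map `L²(Ω) → X⋆` which sends `v` to the
functional `x ↦ Re ∫_Ω v(y) conj(x(y)) dy`. -/
def toDual {X : Type*} [NormedAddCommGroup X] [NormedSpace ℝ X] (j : X →L[ℝ] LpSp Ω 2)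
    (v : LpSp Ω 2) : StrongDual ℝ X :=
  (innerSL ℝ v).comp j

/-- `Δv ∈ H⋆` in the sense of distributions on `Ω`: some continuous (real) linear functional on `H`
has the value `Re ∫_Ω v conj(Δφ)` at every test function `φ`. -/
def LaplacianMemDual (j : H →L[ℝ] LpSp Ω 2) (v : LpSp Ω 2) : Prop :=
  ∃ T : StrongDual ℝ H, ∀ φ : EuclideanSpace ℝ (Fin N) → ℂ, IsTest Ω φ →
    ∀ h : H, (j h =ᵐ[volume.restrict Ω] φ) →
      T h = (∫ x, v x * conj (Δ φ x) ∂(volume.restrict Ω)).re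

end Spaces

/-! ### The equation and its solutions -/

/-- The nonlinearity `|z|^{-(1-m)} z`, equal to `0` at `z = 0`. -/
def nonlin (m : ℝ) (z : ℂ) : ℂ := ((‖z‖ ^ (-(1 - m)) : ℝ) : ℂ) * z

section Solutions

variable {N : ℕ} {Ω : Set (EuclideanSpace ℝ (Fin N))}

/-- `i ∂ₜu + Δu + a |u|^{-(1-m)} u = f` in the sense of distributions on `(0,∞) × Ω`. -/
def SolvesDistrib (m : ℝ) (a : ℂ) (f u : ℝ → LpSp Ω 2) : Prop :=
  ∀ ψ : ℝ × EuclideanSpace ℝ (Fin N) → ℂ, IsTest (Ioi (0 : ℝ) ×ˢ Ω) ψ →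
    ∫ t in Ioi (0 : ℝ), ∫ x in Ω,
        (-(Complex.I * u t x * deriv (fun τ => ψ (τ, x)) t) + u t x * Δ (fun y => ψ (t, y)) x
          + a * nonlin m (u t x) * ψ (t, x))
      = ∫ t in Ioi (0 : ℝ), ∫ x in Ω, f t x * ψ (t, x)

/-- `u` is a solution of the equation with the Dirichlet boundary condition (no initial datum being
prescribed), relative to a space `H` included in `L²(Ω)` through `j`:
`u ∈ L^{m+1}_loc([0,∞); H¹₀(Ω) ∩ L^{m+1}(Ω)) ∩ W^{1,(m+1)/m}_loc([0,∞); (H ∩ L^{m+1}(Ω))⋆)`,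
`Δu(t) ∈ H⋆` for almost every `t > 0`, and the equation holds in the sense of distributions. Here
`(H ∩ L^{m+1}(Ω))⋆ = H⋆ + L^{(m+1)/m}(Ω)`. -/
structure IsSolution {H : Type*} [NormedAddCommGroup H] [NormedSpace ℝ H] (j : H →L[ℝ] LpSp Ω 2)
    (m : ℝ) (a : ℂ) (f u : ℝ → LpSp Ω 2) : Prop where
  memLp : ∃ U : ℝ → Inter (H10.toL2 Ω) (expo m), MemLpLoc U (expo m) ∧
    ∀ᵐ t ∂(volume.restrict (Ioi (0 : ℝ))), Inter.toL2 (H10.toL2 Ω) (expo m) (U t) = u t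
  memW1 : MemW1Loc (fun t => toDual (Inter.toL2 j (expo m)) (u t)) (ENNReal.ofReal ((m + 1) / m))
  laplacian : ∀ᵐ t ∂(volume.restrict (Ioi (0 : ℝ))), LaplacianMemDual j (u t)
  eqn : SolvesDistrib m a f u

/-- `H²`-solutions: the case `H = L²(Ω)`. -/
def IsH2Solution (m : ℝ) (a : ℂ) (f u : ℝ → LpSp Ω 2) : Prop :=
  IsSolution (ContinuousLinearMap.id ℝ (LpSp Ω 2)) m a f u

/-- `H¹₀`-solutions: the case `H = H¹₀(Ω)`. -/
def IsH10Solution (m : ℝ) (a : ℂ) (f u : ℝ → LpSp Ω 2) : Prop :=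
  IsSolution (H10.toL2 Ω) m a f u

/-- Strong solutions with initial datum `u₀`. -/
def IsStrongSolution (m : ℝ) (a : ℂ) (f : ℝ → LpSp Ω 2) (u₀ : LpSp Ω 2) (u : ℝ → LpSp Ω 2) :
    Prop :=
  (IsH2Solution m a f u ∨ IsH10Solution m a f u) ∧ u 0 = u₀

/-- Weak (or `L²`-) solutions with initial datum `u₀`: limits of continuous `H²`-solutions `uₙ`
with right-hand sides `fₙ`, where `uₙ → u` in `C([0,T]; L²(Ω))` and `fₙ → f` in
`L¹((0,T); L²(Ω))` for every `T > 0`. -/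
def IsWeakSolution (m : ℝ) (a : ℂ) (f : ℝ → LpSp Ω 2) (u₀ : LpSp Ω 2) (u : ℝ → LpSp Ω 2) : Prop :=
  (∃ (fn : ℕ → ℝ → LpSp Ω 2) (un : ℕ → ℝ → LpSp Ω 2),
    (∀ n, MemLpLoc (fn n) 1 ∧ ContinuousOn (un n) (Ici 0) ∧ IsH2Solution m a (fn n) (un n)) ∧
    ∀ T : ℝ, 0 < T →
      Tendsto (fun n => eLpNorm (fun t => fn n t - f t) 1 (volume.restrict (Ioo 0 T))) atTop
        (𝓝 0) ∧
      TendstoUniformlyOn un u atTop (Icc 0 T)) ∧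
  u 0 = u₀

/-- `u ∈ L^p_loc([0,∞); L^p(Ω))` for an `L²(Ω)`-valued function `u`. -/
def MemLpLocLp (u : ℝ → LpSp Ω 2) (p : ℝ≥0∞) [Fact (1 ≤ p)] : Prop :=
  ∃ U : ℝ → LpSp Ω p, MemLpLoc U p ∧
    ∀ᵐ t ∂(volume.restrict (Ioi (0 : ℝ))), U t =ᵐ[volume.restrict Ω] u t

/-- `∫_s^t ‖u(σ)‖_{L^{m+1}(Ω)}^{m+1} dσ`. -/
def damping (m : ℝ) (u : ℝ → LpSp Ω 2) (s t : ℝ) : ℝ :=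
  ∫ σ in s..t, (eLpNorm (u σ) (expo m) (volume.restrict Ω)).toReal ^ (m + 1)

/-- `∫_Ω f(σ,x) conj(u(σ,x)) dx`. -/
def forcing (f u : ℝ → LpSp Ω 2) (σ : ℝ) : ℂ :=
  ∫ x in Ω, f σ x * conj (u σ x)

end Solutions

end DampedNLS

end

noncomputable section

namespace DampedNLS

section

/-! ### Energy identity for evolutions in duality -/

/-! The mass law comes from pairing the equation with `u` and taking the imaginary part: the
Dirichlet form is real and drops out, and the nonlinearity contributes `a` times the `(m+1)`-th
power of the `L^{m+1}` norm.

For strong solutions the pairing takes place in `X = H¹₀ ∩ L^{m+1}`. An `H²`-solution is an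
`H¹₀`-solution by restriction of functionals, and then `u` is in `L^{m+1}(X)` while its derivative
is in `L^{(m+1)/m}(X⋆)`. These exponents are conjugate, so the Lions–Magenes identity
`continuousOn_and_norm_sq_sub_eq` applies: `u` is continuous into `L²`, and `‖u‖²` is a primitive of
twice the pairing. It is obtained from the continuity of translations in `L^p(X)`: the defect `‖u‖²
- 2 ∫ V(W)` changes by `o(h)` in `L¹` under a shift by `h`, hence is constant almost everywhere
(`Evolution.defect_ae_const`). Comparison with a time where `‖W‖` is at most its average then gives
continuity (`Evolution.exists_close`). The pairing is computed in `pairing_eq`. Separated test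
functions identify the derivative at almost every time on a countable family of test functions; this
family is dense in `X` (`Inter.exists_isTest_norm_sub_lt`), so the identity extends to `u(t)`
itself. `IsH10Solution.energy` combines the two.

For weak solutions the equality holds for the approximations `uₙ`, and every term except the damping
passes to the limit; hence `Im a` times the damping of `uₙ` converges (`IsWeakSolution.energy`). If
`Im a = 0` this is already the equality. If `Im a ≠ 0`, lower semicontinuity of the `L^{m+1}` norm
on `L²` and Fatou (`memLpLocLp_of_tendsto`) bound the damping of `u` by the limit, which gives the
integrability and an inequality whose direction is the sign of `Im a`. If `|Ω| < ∞` or `m = 1`, `L²`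
embeds in `L^{m+1}`, the damping terms themselves converge (`tendsto_damping`), and equality
survives. -/

theorem tendsto_eLpNorm_translate_sub {E : Type*} [NormedAddCommGroup E] {p : ℝ≥0∞}
    [Fact (1 ≤ p)] (hp : p ≠ ⊤) {w : ℝ → E} (hw : MemLp w p volume) :
    Tendsto (fun r : ℝ => eLpNorm (fun x => w (x + r) - w x) p volume) (𝓝 0) (𝓝 0) := by
  let g : ℝ → C(ℝ, ℝ) := fun r => ⟨fun x => x + r, by fun_prop⟩
  have hg : Continuous g := by
    refine ContinuousMap.continuous_of_continuous_uncurry _ ?_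
    change Continuous fun z : ℝ × ℝ => z.2 + z.1
    fun_prop
  have hgm : ∀ r, MeasurePreserving (g r) volume volume :=
    fun r => measurePreserving_add_right volume r
  have h1 : Continuous fun r : ℝ => Lp.compMeasurePreserving (g r) (hgm r) (hw.toLp w) :=
    (continuous_const (y := hw.toLp w)).compMeasurePreservingLp hg hgm hp
  have h2 := (h1.tendsto 0)
  rw [Lp.tendsto_Lp_iff_tendsto_eLpNorm'] at h2
  refine h2.congr fun r => eLpNorm_congr_ae ?_
  have e1 := Lp.coeFn_compMeasurePreserving (hw.toLp w) (hgm r)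
  have e2 := Lp.coeFn_compMeasurePreserving (hw.toLp w) (hgm 0)
  have e3 := (hgm r).quasiMeasurePreserving.ae hw.coeFn_toLp
  have e4 := (hgm 0).quasiMeasurePreserving.ae hw.coeFn_toLp
  filter_upwards [e1, e2, e3, e4] with x h1 h2 h3 h4
  simp only [Pi.sub_apply, h1, h2, Function.comp, h3, h4]
  simp [g]

variable {X K : Type*} [NormedAddCommGroup X] [NormedSpace ℝ X] [NormedAddCommGroup K]
  [InnerProductSpace ℝ K]

/-- A trajectory `u` in `K` which is almost everywhere the image of `W ∈ L^p(X)`, and whose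
derivative in the dual of `X` is `V ∈ L^q`, on the time interval `[0,T]`. -/
structure Evolution (j : X →L[ℝ] K) (p q T : ℝ) (u : ℝ → K) (W : ℝ → X)
    (V : ℝ → StrongDual ℝ X) : Prop where
  smW : StronglyMeasurable W
  smV : StronglyMeasurable V
  memW : MemLp W (ENNReal.ofReal p) volume
  memV : MemLp V (ENNReal.ofReal q) volume
  traj : ∀ᵐ t, t ∈ Ioo 0 T → j (W t) = u t
  evol : ∀ s t, 0 ≤ s → s ≤ t → t ≤ T →
    (innerSL ℝ (u t)).comp j = (innerSL ℝ (u s)).comp j + ∫ σ in s..t, V σ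

namespace Evolution

variable {j : X →L[ℝ] K} {p q T : ℝ} {u : ℝ → K} {W : ℝ → X} {V : ℝ → StrongDual ℝ X}

theorem integrable_pairing (H : Evolution j p q T u W V) (hpq : p.HolderConjugate q) :
    Integrable (fun σ => V σ (W σ)) volume := by
  have : Fact (1 ≤ ENNReal.ofReal p) := ⟨by simpa using hpq.lt.le⟩
  have hc : ENNReal.HolderConjugate (ENNReal.ofReal q) (ENNReal.ofReal p) :=
    hpq.symm.ennrealOfReal
  refine (MemLp.integrable_mul H.memV.norm H.memW.norm).mono' ?_ (ae_of_all _ fun σ => ?_)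
  · exact (isBoundedBilinearMap_apply.continuous.comp_stronglyMeasurable
      (H.smV.prodMk H.smW)).aestronglyMeasurable
  · exact (V σ).le_opNorm _

theorem intervalIntegrable_V (H : Evolution j p q T u W V) (hpq : p.HolderConjugate q) (s t : ℝ) :
    IntervalIntegrable V volume s t :=
  ((H.memV.locallyIntegrable (by simpa using hpq.symm.lt.le)).integrableOn_isCompact
    isCompact_uIcc).intervalIntegrable

theorem inner_sub_eq (H : Evolution j p q T u W V) (hpq : p.HolderConjugate q) {s t : ℝ}
    (hs : 0 ≤ s) (hst : s ≤ t) (ht : t ≤ T) (x : X) :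
    inner ℝ (u t - u s) (j x) = ∫ σ in s..t, V σ x := by
  have h := congrArg (fun L : StrongDual ℝ X => L x) (H.evol s t hs hst ht)
  simp only [ContinuousLinearMap.comp_apply, innerSL_apply_apply, add_apply] at h
  rw [inner_sub_left, h, ContinuousLinearMap.intervalIntegral_apply (H.intervalIntegrable_V hpq s t)]
  ring

/-- The defect `‖u‖² - 2 ∫ V(W)`. -/
def defect (u : ℝ → K) (W : ℝ → X) (V : ℝ → StrongDual ℝ X) (t : ℝ) : ℝ :=
  ‖u t‖ ^ 2 - 2 * ∫ σ in (0 : ℝ)..t, V σ (W σ)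

/-- Polarization: `‖u t‖² - ‖u s‖²` is the inner product of `u t - u s` with `u t + u s = j (W t + W
s)`, to which the evolution law applies. Subtracting `2 V(W)` leaves only increments of `W`. -/
theorem enorm_defect_sub_le (H : Evolution j p q T u W V) (hpq : p.HolderConjugate q) {s t : ℝ}
    (hs : 0 ≤ s) (hst : s ≤ t) (ht : t ≤ T) (hs' : j (W s) = u s) (ht' : j (W t) = u t) :
    ‖defect u W V t - defect u W V s‖ₑ ≤
      ∫⁻ σ in Ioc s t, ‖V σ‖ₑ * (‖W t - W σ‖ₑ + ‖W s - W σ‖ₑ) := by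
  have hI := H.integrable_pairing hpq
  have hx : ∀ x : X, IntervalIntegrable (fun σ => V σ x) volume s t := fun x =>
    ⟨(H.intervalIntegrable_V hpq s t).1.apply_continuousLinearMap x,
      (H.intervalIntegrable_V hpq s t).2.apply_continuousLinearMap x⟩
  have e1 : ‖u t‖ ^ 2 - ‖u s‖ ^ 2 = ∫ σ in s..t, V σ (W t + W s) := by
    rw [← H.inner_sub_eq hpq hs hst ht, map_add, hs', ht', inner_add_right, inner_sub_left,
      inner_sub_left, real_inner_self_eq_norm_sq, real_inner_self_eq_norm_sq, real_inner_comm]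
    ring
  have e2 : defect u W V t - defect u W V s
      = ∫ σ in s..t, (V σ (W t - W σ) + V σ (W s - W σ)) := by
    have : defect u W V t - defect u W V s
        = (‖u t‖ ^ 2 - ‖u s‖ ^ 2) - 2 * ∫ σ in s..t, V σ (W σ) := by
      rw [← intervalIntegral.integral_interval_sub_left (hI.intervalIntegrable (a := 0) (b := t))
        (hI.intervalIntegrable (a := 0) (b := s))]
      simp only [defect]; ring
    rw [this, e1, ← intervalIntegral.integral_const_mul, ← intervalIntegral.integral_sub (hx _)
      (hI.intervalIntegrable.const_mul 2)]
    congr 1 with σ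
    simp only [map_add, map_sub]; ring
  rw [e2, intervalIntegral.integral_of_le hst]
  refine (enorm_integral_le_lintegral_enorm _).trans (lintegral_mono fun σ => ?_)
  refine (enorm_add_le _ _).trans ?_
  rw [mul_add]
  exact add_le_add (ContinuousLinearMap.le_opENorm _ _) (ContinuousLinearMap.le_opENorm _ _)

/-- After Tonelli, Hölder in `σ` bounds each slice by the norm of `V` times the translation modulus
of `W`; the integration over `(0, h]` supplies the factor `h`. Since the modulus tends to `0` with
`h`, the bound is `o(h)`. -/
theorem lintegral_defect_translate_le (H : Evolution j p q T u W V) (hpq : p.HolderConjugate q)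
    {h : ℝ} (hh : 0 ≤ h) {ε : ℝ≥0∞}
    (hε : ∀ r : ℝ, |r| ≤ h → eLpNorm (fun x => W (x + r) - W x) (ENNReal.ofReal p) volume ≤ ε) :
    ∫⁻ σ in Ioo 0 (T - h), ‖defect u W V (σ + h) - defect u W V σ‖ₑ
      ≤ eLpNorm V (ENNReal.ofReal q) volume * (2 * ε) * ENNReal.ofReal h := by
  have hp0 := hpq.pos
  have hq0 := hpq.symm.pos
  have hVm : ∀ r : ℝ, Measurable fun σ => ‖V (σ + r)‖ₑ := fun r =>
    H.smV.enorm.comp (measurable_add_const r)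
  have hWm : ∀ r r' : ℝ, Measurable fun σ => ‖W (σ + r) - W (σ + r')‖ₑ := fun r r' =>
    ((H.smW.comp_measurable (measurable_add_const r)).sub
      (H.smW.comp_measurable (measurable_add_const r'))).enorm
  have key : ∀ r r' : ℝ, |r' - r| ≤ h →
      ∫⁻ σ, ‖V (σ + r)‖ₑ * ‖W (σ + r') - W (σ + r)‖ₑ
        ≤ eLpNorm V (ENNReal.ofReal q) volume * ε := by
    intro r r' hr
    have h1 := ENNReal.lintegral_mul_le_Lp_mul_Lq volume hpq.symm (hVm r).aemeasurable
      (hWm r' r).aemeasurable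
    refine h1.trans ?_
    gcongr
    · rw [lintegral_add_right_eq_self (fun σ => ‖V σ‖ₑ ^ q), eLpNorm_eq_lintegral_rpow_enorm_toReal
        (by simpa using hq0) ENNReal.ofReal_ne_top, ENNReal.toReal_ofReal hq0.le]
    · refine le_trans (le_of_eq ?_) (hε (r' - r) hr)
      rw [eLpNorm_eq_lintegral_rpow_enorm_toReal
        (by simpa using hp0) ENNReal.ofReal_ne_top, ENNReal.toReal_ofReal hp0.le]
      rw [← lintegral_add_right_eq_self (fun σ => ‖W (σ + (r' - r)) - W σ‖ₑ ^ p) r]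
      simp only [add_assoc, add_sub_cancel]
  have hgood : ∀ᵐ σ, σ ∈ Ioo 0 (T - h) → ‖defect u W V (σ + h) - defect u W V σ‖ₑ ≤
      ∫⁻ r in Ioc 0 h, ‖V (σ + r)‖ₑ * (‖W (σ + h) - W (σ + r)‖ₑ + ‖W (σ + 0) - W (σ + r)‖ₑ) := by
    have hg2 := (measurePreserving_add_right volume h).quasiMeasurePreserving.ae H.traj
    filter_upwards [H.traj, hg2] with σ h1 h2 hσ
    have hσ1 := hσ.1
    have hσ2 := hσ.2
    refine (H.enorm_defect_sub_le hpq hσ.1.le (by linarith) (by linarith)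
      (h1 ⟨hσ1, by linarith⟩) (h2 ⟨by linarith, by linarith⟩)).trans (le_of_eq ?_)
    rw [← lintegral_indicator measurableSet_Ioc, ← lintegral_indicator measurableSet_Ioc,
      ← lintegral_add_left_eq_self _ σ]
    congr 1 with r
    simp only [indicator, mem_Ioc, lt_add_iff_pos_right, add_le_add_iff_left, add_zero]
  calc ∫⁻ σ in Ioo 0 (T - h), ‖defect u W V (σ + h) - defect u W V σ‖ₑ
      ≤ ∫⁻ σ, ∫⁻ r in Ioc 0 h,
        ‖V (σ + r)‖ₑ * (‖W (σ + h) - W (σ + r)‖ₑ + ‖W (σ + 0) - W (σ + r)‖ₑ) := by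
        refine (lintegral_mono_ae ((ae_restrict_iff' measurableSet_Ioo).2 hgood)).trans ?_
        exact setLIntegral_le_lintegral _ _
    _ = ∫⁻ r in Ioc 0 h, ∫⁻ σ,
        ‖V (σ + r)‖ₑ * (‖W (σ + h) - W (σ + r)‖ₑ + ‖W (σ + 0) - W (σ + r)‖ₑ) := by
        refine lintegral_lintegral_swap (Measurable.aemeasurable ?_)
        have a1 : StronglyMeasurable fun z : ℝ × ℝ => V (z.1 + z.2) :=
          H.smV.comp_measurable (measurable_fst.add measurable_snd)
        have a2 : StronglyMeasurable fun z : ℝ × ℝ => W (z.1 + z.2) :=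
          H.smW.comp_measurable (measurable_fst.add measurable_snd)
        have a3 : ∀ r : ℝ, StronglyMeasurable fun z : ℝ × ℝ => W (z.1 + r) := fun r =>
          H.smW.comp_measurable (measurable_fst.add_const r)
        exact a1.enorm.mul (((a3 h).sub a2).enorm.add ((a3 0).sub a2).enorm)
    _ ≤ ∫⁻ r in Ioc 0 h, eLpNorm V (ENNReal.ofReal q) volume * (2 * ε) := by
        refine setLIntegral_mono' measurableSet_Ioc fun r hr => ?_
        simp_rw [mul_add]
        refine (lintegral_add_left ((hVm r).mul (hWm h r)) _).le.trans ?_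
        rw [two_mul, mul_add]
        refine add_le_add (key r h ?_) (key r 0 ?_)
        · rw [abs_of_nonneg (by linarith [hr.2])]; linarith [hr.1]
        · rw [zero_sub, abs_neg, abs_of_nonneg hr.1.le]; exact hr.2
    _ = _ := by simp

end Evolution

end

/-! ### The defect is constant almost everywhere -/

section

variable {X K : Type*} [NormedAddCommGroup X] [NormedSpace ℝ X] [NormedAddCommGroup K]
  [InnerProductSpace ℝ K]

namespace Evolution

variable {j : X →L[ℝ] K} {p q T : ℝ} {u : ℝ → K} {W : ℝ → X} {V : ℝ → StrongDual ℝ X}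

/-- At almost every time `‖u‖²` is the functional of `u` evaluated at `W`. The evolution law bounds
that functional by its initial norm plus `∫ ‖V‖`, so `‖u‖²` is at most a constant times `‖W‖`. -/
theorem integrableOn_defect (H : Evolution j p q T u W V) (hpq : p.HolderConjugate q) :
    IntegrableOn (defect u W V) (Ioo 0 T) volume := by
  have hI := H.integrable_pairing hpq
  have hVi : IntegrableOn V (Ioc 0 T) volume :=
    ((H.memV.locallyIntegrable (by simpa using hpq.symm.lt.le)).integrableOn_isCompact
      (isCompact_Icc (a := 0) (b := T))).mono_set Ioc_subset_Icc_self
  have hWi : IntegrableOn W (Ioo 0 T) volume :=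
    ((H.memW.locallyIntegrable (by simpa using hpq.lt.le)).integrableOn_isCompact
      (isCompact_Icc (a := 0) (b := T))).mono_set Ioo_subset_Icc_self
  refine Integrable.sub ?_ ?_
  · have hae : ∀ᵐ t ∂(volume.restrict (Ioo 0 T)), j (W t) = u t :=
      (ae_restrict_iff' measurableSet_Ioo).2 H.traj
    refine (hWi.norm.const_mul
      (‖(innerSL ℝ (u 0)).comp j‖ + ∫ σ in Ioc 0 T, ‖V σ‖)).mono' ?_ ?_
    · refine AEStronglyMeasurable.congr (f := fun t => ‖j (W t)‖ ^ 2) ?_ ?_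
      · exact ((j.continuous.comp_stronglyMeasurable H.smW).norm.pow 2).aestronglyMeasurable
      · filter_upwards [hae] with t ht
        rw [ht]
    · filter_upwards [hae, ae_restrict_mem measurableSet_Ioo] with t ht htT
      rw [Real.norm_of_nonneg (by positivity), ← real_inner_self_eq_norm_sq]
      have h1 : inner ℝ (u t) (u t) = ((innerSL ℝ (u t)).comp j) (W t) := by simp [ht]
      rw [h1]
      refine (Real.le_norm_self _).trans ((ContinuousLinearMap.le_opNorm _ _).trans ?_)
      gcongr
      rw [H.evol 0 t le_rfl htT.1.le htT.2.le]
      refine (norm_add_le _ _).trans ?_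
      gcongr
      rw [intervalIntegral.integral_of_le htT.1.le]
      refine (norm_integral_le_integral_norm _).trans ?_
      exact setIntegral_mono_set hVi.norm (ae_of_all _ fun _ => norm_nonneg _)
        (Ioc_subset_Ioc_right htT.2.le).eventuallyLE
  · refine Integrable.const_mul ?_ 2
    have : Continuous fun t => ∫ σ in (0 : ℝ)..t, V σ (W σ) :=
      intervalIntegral.continuous_primitive (fun _ _ => hI.intervalIntegrable) 0
    exact (this.continuousOn.integrableOn_compact isCompact_Icc).mono_set Ioo_subset_Icc_self

/-- At two differentiability points of the primitive of the defect, the difference of the two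
difference quotients is `h⁻¹` times the integral over `[s, t]` of the increment by `h`. It tends to
the difference of the values, and also to `0` by the `o(h)` bound. -/
theorem defect_ae_const (H : Evolution j p q T u W V) (hpq : p.HolderConjugate q) :
    ∃ N : Set ℝ, volume N = 0 ∧ ∀ s ∈ Ioo 0 T \ N, ∀ t ∈ Ioo 0 T \ N,
      defect u W V s = defect u W V t := by
  have hp1 : Fact (1 ≤ ENNReal.ofReal p) := ⟨by simpa using hpq.lt.le⟩
  set F := defect u W V with hF
  set G : ℝ → ℝ := (Ioo 0 T).indicator F with hG
  have hGi : Integrable G volume :=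
    (integrable_indicator_iff measurableSet_Ioo).2 (H.integrableOn_defect hpq)
  have hLD := LocallyIntegrable.ae_hasDerivAt_integral hGi.locallyIntegrable
  refine ⟨_, ae_iff.1 hLD, ?_⟩
  set P : ℝ → ℝ := fun x => ∫ t in (0 : ℝ)..x, G t with hP
  have aux : ∀ s ∈ Ioo 0 T, ∀ t ∈ Ioo 0 T, s < t → HasDerivAt P (G s) s → HasDerivAt P (G t) t →
      F s = F t := by
    intro s hs t ht hst hds hdt
    have hslope : Tendsto (fun h : ℝ => h⁻¹ * ((P (t + h) - P t) - (P (s + h) - P s)))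
        (𝓝[>] 0) (𝓝 (G t - G s)) := by
      have a1 := (hasDerivAt_iff_tendsto_slope_zero.1 hdt).mono_left
        (nhdsWithin_mono _ (fun x (hx : 0 < x) => hx.ne') : 𝓝[>] (0 : ℝ) ≤ 𝓝[≠] 0)
      have a2 := (hasDerivAt_iff_tendsto_slope_zero.1 hds).mono_left
        (nhdsWithin_mono _ (fun x (hx : 0 < x) => hx.ne') : 𝓝[>] (0 : ℝ) ≤ 𝓝[≠] 0)
      refine (a1.sub a2).congr fun h => ?_
      simp only [smul_eq_mul]; ring
    have hzero : Tendsto (fun h : ℝ => h⁻¹ * ((P (t + h) - P t) - (P (s + h) - P s)))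
        (𝓝[>] 0) (𝓝 0) := by
      set CV := eLpNorm V (ENNReal.ofReal q) volume with hCV
      have hCVt : CV ≠ ⊤ := H.memV.2.ne
      rw [Metric.tendsto_nhds]
      intro δ hδ
      obtain ⟨η, hη, hηδ⟩ : ∃ η : ℝ, 0 < η ∧ CV.toReal * (2 * η) < δ := by
        -- The `+ 1` covers `CV = 0`; the product is then at most `δ / 2`.
        refine ⟨δ / (2 * (CV.toReal + 1)) / 2, by positivity, ?_⟩
        have : (0 : ℝ) ≤ CV.toReal := ENNReal.toReal_nonneg
        rw [div_div, mul_div_assoc', mul_div_assoc', div_lt_iff₀ (by positivity)]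
        nlinarith
      have htr := tendsto_eLpNorm_translate_sub ENNReal.ofReal_ne_top H.memW
      have hev := htr.eventually_le_const (show (0 : ℝ≥0∞) < ENNReal.ofReal η by simpa using hη)
      obtain ⟨h₀, hh₀, hball⟩ := Metric.eventually_nhds_iff.1 hev
      have hTt : 0 < T - t := by linarith [ht.2]
      -- Besides the translation bound, `h < T - t` keeps the shifted interval inside `(0, T)`,
      -- where the truncation `G` equals the defect.
      filter_upwards [Ioo_mem_nhdsGT hh₀, Ioo_mem_nhdsGT hTt] with h h1 h2
      have hb := H.lintegral_defect_translate_le hpq h1.1.le (ε := ENNReal.ofReal η)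
        (fun r hr => hball (by rw [Real.dist_eq, sub_zero]; exact hr.trans_lt h1.2))
      have e1 : (P (t + h) - P t) - (P (s + h) - P s) = ∫ σ in s..t, (G (σ + h) - G σ) := by
        have hii : ∀ a b, IntervalIntegrable G volume a b := fun a b => hGi.intervalIntegrable
        rw [intervalIntegral.integral_sub ((hGi.comp_add_right h).intervalIntegrable)
          (hii _ _), intervalIntegral.integral_comp_add_right]
        simp only [hP]
        rw [← intervalIntegral.integral_interval_sub_left (hii 0 (t + h)) (hii 0 (s + h)),
          ← intervalIntegral.integral_interval_sub_left (hii 0 t) (hii 0 s)]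
        ring
      have e2 : ‖∫ σ in s..t, (G (σ + h) - G σ)‖ₑ ≤ CV * (2 * ENNReal.ofReal η) *
          ENNReal.ofReal h := by
        refine le_trans ?_ hb
        rw [intervalIntegral.integral_of_le hst.le]
        refine (enorm_integral_le_lintegral_enorm _).trans ?_
        refine (setLIntegral_congr_fun measurableSet_Ioc fun σ hσ => ?_).trans_le
          (lintegral_mono_set (t := Ioo 0 (T - h))
            fun σ hσ => ⟨hs.1.trans hσ.1, by linarith [hσ.2, h2.2]⟩)
        have m1 : σ ∈ Ioo 0 T := ⟨hs.1.trans hσ.1, hσ.2.trans_lt ht.2⟩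
        have m2 : σ + h ∈ Ioo 0 T := ⟨by linarith [m1.1, h1.1], by linarith [hσ.2, h2.2]⟩
        simp only [hG, indicator_of_mem m1, indicator_of_mem m2, hF]
      rw [Real.dist_eq, sub_zero, e1, abs_mul, abs_inv, abs_of_pos h1.1]
      have e3 : |∫ σ in s..t, (G (σ + h) - G σ)| ≤ CV.toReal * (2 * η) * h := by
        have := ENNReal.toReal_mono (by finiteness) e2
        simpa [ENNReal.toReal_mul, ENNReal.toReal_ofReal hη.le, ENNReal.toReal_ofReal h1.1.le]
          using this
      calc h⁻¹ * |∫ σ in s..t, (G (σ + h) - G σ)| ≤ h⁻¹ * (CV.toReal * (2 * η) * h) := by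
            have := h1.1; gcongr
        _ = CV.toReal * (2 * η) := by field_simp [h1.1.ne']
        _ < δ := hηδ
    have := tendsto_nhds_unique hslope hzero
    simp only [hG, indicator_of_mem hs, indicator_of_mem ht] at this
    linarith
  intro s hs t ht
  have ds := (not_not.1 hs.2) 0
  have dt := (not_not.1 ht.2) 0
  rcases lt_trichotomy s t with h | h | h
  · exact aux s hs.1 t ht.1 h ds dt
  · rw [h]
  · exact (aux t ht.1 s hs.1 h dt ds).symm

end Evolution

end

/-! ### Continuity of the trajectory and the energy identity at all times -/

section

variable {X K : Type*} [NormedAddCommGroup X] [NormedSpace ℝ X] [NormedAddCommGroup K]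
  [InnerProductSpace ℝ K]

/-- The bound extends to the closure of the range, so it can be tested at `w` itself. -/
theorem norm_le_of_denseRange {X : Type*} {j : X → K} (hj : DenseRange j) {w : K} {C : ℝ}
    (hC : 0 ≤ C) (h : ∀ x, inner ℝ w (j x) ≤ C * ‖j x‖) : ‖w‖ ≤ C := by
  have h1 : inner ℝ w w ≤ C * ‖w‖ :=
    hj.induction_on (p := fun k => inner ℝ w k ≤ C * ‖k‖) w
      (isClosed_le (by fun_prop) (by fun_prop)) h
  rcases (norm_nonneg w).eq_or_lt with h0 | h0
  · rwa [← h0]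
  · rw [real_inner_self_eq_norm_sq] at h1
    nlinarith

theorem Icc_subset_closure_Ioo_diff {N : Set ℝ} (hN : volume N = 0) {α β : ℝ} (h : α < β) :
    Icc α β ⊆ closure (Ioo α β \ N) := by
  have hd : Dense Nᶜ := Measure.dense_of_ae (μ := volume) (p := fun x => x ∈ Nᶜ)
    (measure_eq_zero_iff_ae_notMem.1 hN)
  rw [← closure_Ioo h.ne]
  exact closure_minimal (hd.open_subset_closure_inter isOpen_Ioo) isClosed_closure

namespace Evolution

variable {j : X →L[ℝ] K} {p q T : ℝ} {u : ℝ → K} {W : ℝ → X} {V : ℝ → StrongDual ℝ X}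

/-- The density controlling the modulus of continuity of the trajectory. -/
def density (p q : ℝ) (W : ℝ → X) (V : ℝ → StrongDual ℝ X) (σ : ℝ) : ℝ := ‖V σ‖ ^ q + ‖W σ‖ ^ p

theorem integrable_norm_W (H : Evolution j p q T u W V) (hpq : p.HolderConjugate q) :
    Integrable (fun σ => ‖W σ‖ ^ p) volume := by
  have := H.memW.integrable_norm_rpow (by simpa using hpq.pos) ENNReal.ofReal_ne_top
  simpa [ENNReal.toReal_ofReal hpq.nonneg] using this

theorem integrable_norm_V (H : Evolution j p q T u W V) (hpq : p.HolderConjugate q) :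
    Integrable (fun σ => ‖V σ‖ ^ q) volume := by
  have := H.memV.integrable_norm_rpow (by simpa using hpq.symm.pos) ENNReal.ofReal_ne_top
  simpa [ENNReal.toReal_ofReal hpq.symm.nonneg] using this

theorem integrable_density (H : Evolution j p q T u W V) (hpq : p.HolderConjugate q) :
    Integrable (density p q W V) volume :=
  (H.integrable_norm_V hpq).add (H.integrable_norm_W hpq)

theorem exists_null (H : Evolution j p q T u W V) (hpq : p.HolderConjugate q) :
    ∃ N : Set ℝ, volume N = 0 ∧ (∀ s ∈ Ioo 0 T \ N, j (W s) = u s) ∧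
      ∀ s ∈ Ioo 0 T \ N, ∀ t ∈ Ioo 0 T \ N,
        ‖u t‖ ^ 2 - ‖u s‖ ^ 2 = 2 * ∫ σ in s..t, V σ (W σ) := by
  obtain ⟨N, hN, hc⟩ := H.defect_ae_const hpq
  have hI := H.integrable_pairing hpq
  refine ⟨N ∪ {t | ¬ (t ∈ Ioo 0 T → j (W t) = u t)}, ?_, ?_, ?_⟩
  · rw [measure_union_null_iff]; exact ⟨hN, ae_iff.1 H.traj⟩
  · intro s hs
    by_contra h
    exact hs.2 (Or.inr fun h' => h (h' hs.1))
  · intro s hs t ht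
    have := hc s ⟨hs.1, fun h => hs.2 (Or.inl h)⟩ t ⟨ht.1, fun h => ht.2 (Or.inl h)⟩
    rw [← intervalIntegral.integral_interval_sub_left (hI.intervalIntegrable (a := 0) (b := t))
        (hI.intervalIntegrable (a := 0) (b := s))]
    simp only [defect] at this
    linarith

theorem inner_sub_eq' (H : Evolution j p q T u W V) (hpq : p.HolderConjugate q) {s t : ℝ}
    (hs : s ∈ Icc 0 T) (ht : t ∈ Icc 0 T) (x : X) :
    inner ℝ (u t - u s) (j x) = ∫ σ in s..t, V σ x := by
  rcases le_total s t with h | h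
  · exact H.inner_sub_eq hpq hs.1 h ht.2 x
  · rw [intervalIntegral.integral_symm, ← H.inner_sub_eq hpq ht.1 h hs.2 x, ← inner_neg_left,
      neg_sub]

/-- The centre `k` is the value of `u` at a good time `s` where `‖W s‖ ^ p` is at most its average.
The energy identity writes `‖u t - u s‖²` through `V(W)` and `V(W s)`, and Young's inequality bounds
both by the density. The resulting bound is the integral of an integrable function, hence small on
short intervals. -/
theorem exists_close (H : Evolution j p q T u W V) (hpq : p.HolderConjugate q)
    (hj : DenseRange j) {α β : ℝ} (hα : 0 ≤ α) (hαβ : α < β) (hβ : β ≤ T) :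
    ∃ k : K, ∀ t ∈ Icc α β, ‖u t - k‖ ≤ √(4 * ∫ σ in α..β, density p q W V σ) := by
  obtain ⟨N, hN, hNW, hNE⟩ := H.exists_null hpq
  have hWi := H.integrable_norm_W hpq
  have hVi := H.integrable_norm_V hpq
  have hI := H.integrable_pairing hpq
  -- The set to avoid includes the complement of `(α, β)`, which is null for the restricted measure,
  -- so that `s` lies in the interval as well as outside `N`.
  obtain ⟨s, hs, hsW⟩ := exists_notMem_null_le_average
    (μ := volume.restrict (Ioo α β)) (N := N ∪ (Ioo α β)ᶜ)
    (by simp [hαβ]) hWi.restrict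
    (by rw [measure_union_null_iff]
        exact ⟨le_antisymm ((Measure.restrict_apply_le _ _).trans hN.le) zero_le, by
          rw [Measure.restrict_apply measurableSet_Ioo.compl]; simp⟩)
  have hs1 : s ∈ Ioo α β := by by_contra h; exact hs (Or.inr h)
  have hsT : s ∈ Ioo 0 T := ⟨hα.trans_lt hs1.1, hs1.2.trans_le hβ⟩
  have hsN : s ∈ Ioo 0 T \ N := ⟨hsT, fun h => hs (Or.inl h)⟩
  have hsW' : (β - α) * ‖W s‖ ^ p ≤ ∫ σ in α..β, ‖W σ‖ ^ p := by
    rw [setAverage_eq] at hsW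
    rw [intervalIntegral.integral_of_le hαβ.le, integral_Ioc_eq_integral_Ioo]
    have h0 : 0 < β - α := sub_pos.2 hαβ
    simp only [Measure.real, Real.volume_Ioo, ENNReal.toReal_ofReal h0.le, smul_eq_mul] at hsW
    calc _ ≤ (β - α) * ((β - α)⁻¹ * ∫ x in Ioo α β, ‖W x‖ ^ p) := by gcongr
      _ = _ := by field_simp
  have hgood : ∀ t ∈ Ioo α β \ N, ‖u t - u s‖ ≤ √(4 * ∫ σ in α..β, density p q W V σ) := by
    intro t ht
    have htT : t ∈ Ioo 0 T := ⟨hα.trans_lt ht.1.1, ht.1.2.trans_le hβ⟩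
    refine Real.le_sqrt_of_sq_le ?_
    have hii : ∀ x, IntervalIntegrable (fun σ => V σ x) volume s t := fun x =>
      ⟨(H.intervalIntegrable_V hpq s t).1.apply_continuousLinearMap x,
      (H.intervalIntegrable_V hpq s t).2.apply_continuousLinearMap x⟩
    have e1 : ‖u t - u s‖ ^ 2 = 2 * ∫ σ in s..t, (V σ (W σ) - V σ (W s)) := by
      rw [intervalIntegral.integral_sub hI.intervalIntegrable (hii _), mul_sub,
        ← hNE s hsN t ⟨htT, ht.2⟩, ← H.inner_sub_eq' hpq ⟨hsT.1.le, hsT.2.le⟩ ⟨htT.1.le, htT.2.le⟩,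
        hNW s hsN, inner_sub_left, real_inner_self_eq_norm_sq, norm_sub_sq_real]
      ring
    have e2 : |∫ σ in s..t, (V σ (W σ) - V σ (W s))| ≤
        ∫ σ in α..β, (‖V σ‖ ^ q + ‖W σ‖ ^ p + (‖V σ‖ ^ q + ‖W s‖ ^ p)) := by
      have hint : IntegrableOn (fun σ => ‖V σ‖ ^ q + ‖W σ‖ ^ p + (‖V σ‖ ^ q + ‖W s‖ ^ p))
          (Ioc α β) volume :=
        (hVi.add hWi).integrableOn.add (hVi.integrableOn.add (integrableOn_const (by simp)))
      rw [intervalIntegral.integral_of_le hαβ.le]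
      refine (intervalIntegral.norm_integral_le_integral_norm_uIoc (f := fun σ => (V σ (W σ) - V σ (W s)))).trans ?_
      have hsub : uIoc s t ⊆ Ioc α β := by
        intro x hx
        rw [mem_uIoc] at hx
        constructor <;> rcases hx with hx | hx <;> linarith [hs1.1, hs1.2, ht.1.1, ht.1.2]
      refine (setIntegral_mono_on (g := fun σ => ‖V σ‖ ^ q + ‖W σ‖ ^ p + (‖V σ‖ ^ q + ‖W s‖ ^ p))
        ?_ (hint.mono_set hsub) measurableSet_uIoc ?_).trans
        (setIntegral_mono_set hint (ae_of_all _ fun σ => by simp only [Pi.zero_apply]; positivity)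
          hsub.eventuallyLE)
      · exact (intervalIntegrable_iff.1 (hI.intervalIntegrable.sub (hii _))).norm
      · intro σ _
        have young : ∀ x : X, ‖V σ x‖ ≤ ‖V σ‖ ^ q + ‖x‖ ^ p := by
          intro x
          refine ((V σ).le_opNorm x).trans
            ((Real.young_inequality_of_nonneg (norm_nonneg _) (norm_nonneg _) hpq.symm).trans ?_)
          gcongr
          · exact div_le_self (by positivity) hpq.symm.lt.le
          · exact div_le_self (by positivity) hpq.lt.le
        exact (norm_sub_le _ _).trans (add_le_add (young _) (young _))
    have hii' : ∀ f : ℝ → ℝ, Integrable f volume → IntervalIntegrable f volume α β :=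
      fun f hf => hf.intervalIntegrable
    have e3 : ∫ σ in α..β, (‖V σ‖ ^ q + ‖W σ‖ ^ p + (‖V σ‖ ^ q + ‖W s‖ ^ p))
        = 2 * (∫ σ in α..β, ‖V σ‖ ^ q) + (∫ σ in α..β, ‖W σ‖ ^ p) + (β - α) * ‖W s‖ ^ p := by
      rw [intervalIntegral.integral_add ((hii' _ hVi).add (hii' _ hWi))
        ((hii' _ hVi).add intervalIntegrable_const), intervalIntegral.integral_add (hii' _ hVi)
        (hii' _ hWi), intervalIntegral.integral_add (hii' _ hVi) intervalIntegrable_const,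
        intervalIntegral.integral_const, smul_eq_mul]
      ring
    have e4 : ∫ σ in α..β, density p q W V σ
        = (∫ σ in α..β, ‖V σ‖ ^ q) + (∫ σ in α..β, ‖W σ‖ ^ p) :=
      intervalIntegral.integral_add (hii' _ hVi) (hii' _ hWi)
    -- By the choice of `s`, the term in `‖W s‖ ^ p` is at most the integral of `‖W σ‖ ^ p`. So the
    -- right side of `e3` is at most twice the integral of the density, and the factor `2` in `e1`
    -- makes `4`.
    rw [e1, e4]
    have := le_abs_self (∫ σ in s..t, (V σ (W σ) - V σ (W s)))
    linarith
  -- An arbitrary `t`, endpoints included, is a limit of good times. The evolution law gives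
  -- convergence only against vectors `j x`, which is enough because their range is dense.
  refine ⟨u s, fun t ht => ?_⟩
  have htT : t ∈ Icc 0 T := ⟨hα.trans ht.1, ht.2.trans hβ⟩
  obtain ⟨τ, hτ, hτt⟩ := mem_closure_iff_seq_limit.1 (Icc_subset_closure_Ioo_diff hN hαβ ht)
  refine norm_le_of_denseRange hj (Real.sqrt_nonneg _) fun x => ?_
  have hlim : Tendsto (fun n => inner ℝ (u (τ n) - u s) (j x)) atTop
      (𝓝 (inner ℝ (u t - u s) (j x))) := by
    have hc : Continuous fun r => ∫ σ in s..r, V σ x :=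
      intervalIntegral.continuous_primitive (fun a b =>
        ⟨(H.intervalIntegrable_V hpq a b).1.apply_continuousLinearMap x,
        (H.intervalIntegrable_V hpq a b).2.apply_continuousLinearMap x⟩) s
    have hsI : s ∈ Icc 0 T := ⟨hsT.1.le, hsT.2.le⟩
    rw [H.inner_sub_eq' hpq hsI htT]
    refine ((hc.tendsto t).comp hτt).congr fun n => ?_
    rw [H.inner_sub_eq' hpq hsI ⟨hα.trans (hτ n).1.1.le, (hτ n).1.2.le.trans hβ⟩]
    rfl
  exact le_of_tendsto' hlim fun n => (real_inner_le_norm _ _).trans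
    (mul_le_mul_of_nonneg_right (hgood _ (hτ n)) (norm_nonneg _))

/-- Both endpoints of `[s, t]` are close to the same `k`, whence the factor `2`; the bound is a
continuous function of `t` that vanishes at `t = s`. -/
theorem continuousOn (H : Evolution j p q T u W V) (hpq : p.HolderConjugate q)
    (hj : DenseRange j) : ContinuousOn u (Icc 0 T) := by
  have hD := H.integrable_density hpq
  have hb : ∀ s ∈ Icc 0 T, ∀ t ∈ Icc 0 T, ‖u t - u s‖
      ≤ 2 * √(4 * |∫ σ in s..t, density p q W V σ|) := by
    have aux : ∀ s ∈ Icc 0 T, ∀ t ∈ Icc 0 T, s ≤ t → ‖u t - u s‖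
      ≤ 2 * √(4 * |∫ σ in s..t, density p q W V σ|) := by
      intro s hs t ht hst
      rcases hst.eq_or_lt with rfl | hst'
      · simp
      obtain ⟨k, hk⟩ := H.exists_close hpq hj hs.1 hst' ht.2
      have h1 := hk s ⟨le_rfl, hst⟩
      have h2 := hk t ⟨hst, le_rfl⟩
      have h3 : √(4 * ∫ σ in s..t, density p q W V σ) ≤
          √(4 * |∫ σ in s..t, density p q W V σ|) := by
        gcongr; exact le_abs_self _
      have h4 := norm_sub_le (u t - k) (u s - k)
      rw [sub_sub_sub_cancel_right] at h4
      linarith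
    intro s hs t ht
    rcases le_total s t with h | h
    · exact aux s hs t ht h
    · rw [norm_sub_rev, intervalIntegral.integral_symm, abs_neg]
      exact aux t ht s hs h
  intro s hs
  rw [ContinuousWithinAt, tendsto_iff_norm_sub_tendsto_zero]
  have hc : Continuous fun t => 2 * √(4 * |∫ σ in s..t, density p q W V σ|) := by
    have := intervalIntegral.continuous_primitive
      (fun a b => hD.intervalIntegrable (a := a) (b := b)) s
    fun_prop
  have h0 := (hc.tendsto s).mono_left (nhdsWithin_le_nhds (s := Icc 0 T))
  simp only [intervalIntegral.integral_same, abs_zero, mul_zero, Real.sqrt_zero] at h0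
  exact squeeze_zero' (Eventually.of_forall fun _ => norm_nonneg _)
    (eventually_nhdsWithin_of_forall fun t ht => hb s hs t ht) h0

/-- Now that `u` is continuous, both sides are continuous and agree on a dense set of times. -/
theorem norm_sq_sub_eq (H : Evolution j p q T u W V) (hpq : p.HolderConjugate q)
    (hj : DenseRange j) {s t : ℝ} (hT : 0 < T) (hs : s ∈ Icc 0 T) (ht : t ∈ Icc 0 T) :
    ‖u t‖ ^ 2 - ‖u s‖ ^ 2 = 2 * ∫ σ in s..t, V σ (W σ) := by
  obtain ⟨N, hN, -, hE⟩ := H.exists_null hpq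
  have hI := H.integrable_pairing hpq
  have hcl := Icc_subset_closure_Ioo_diff hN hT
  have hne : (Ioo 0 T \ N).Nonempty := by
    rw [← closure_nonempty_iff]
    exact ⟨s, hcl hs⟩
  obtain ⟨r, hr⟩ := hne
  have hu := H.continuousOn hpq hj
  have hc : Continuous fun t => ∫ σ in r..t, V σ (W σ) :=
    intervalIntegral.continuous_primitive (fun _ _ => hI.intervalIntegrable) r
  have key : EqOn (fun t => ‖u t‖ ^ 2 - ‖u r‖ ^ 2) (fun t => 2 * ∫ σ in r..t, V σ (W σ))
      (Icc 0 T) :=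
    EqOn.of_subset_closure (fun t ht => hE r hr t ht) ((hu.norm.pow 2).sub continuousOn_const)
      (hc.const_mul 2).continuousOn (sdiff_subset.trans Ioo_subset_Icc_self) hcl
  have h1 := key hs
  have h2 := key ht
  simp only at h1 h2
  rw [← intervalIntegral.integral_interval_sub_left (hI.intervalIntegrable (a := r) (b := t))
    (hI.intervalIntegrable (a := r) (b := s))]
  linarith

end Evolution

end

/-! ### The Lions–Magenes identity on the half-line -/

section

section LionsMagenes

variable {X K : Type*} [NormedAddCommGroup X] [NormedSpace ℝ X] [NormedAddCommGroup K]
  [InnerProductSpace ℝ K]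

/-- Extension by zero of strongly measurable representatives puts the data in Lebesgue spaces over
the whole line, where translations act. -/
theorem exists_evolution {j : X →L[ℝ] K} {p q : ℝ} {u : ℝ → K} {U : ℝ → X}
    {v : ℝ → StrongDual ℝ X} (hU : MemLpLoc U (ENNReal.ofReal p))
    (hv : MemLpLoc v (ENNReal.ofReal q))
    (htraj : ∀ᵐ t ∂(volume.restrict (Ioi (0 : ℝ))), j (U t) = u t)
    (hevol : ∀ s t : ℝ, 0 ≤ s → s ≤ t →
      (innerSL ℝ (u t)).comp j = (innerSL ℝ (u s)).comp j + ∫ σ in s..t, v σ)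
    {T : ℝ} (hT : 0 < T) :
    ∃ W V, Evolution j p q T u W V ∧ ∀ᵐ t, t ∈ Ioo 0 T → W t = U t ∧ V t = v t := by
  have key : ∀ {E : Type _} [NormedAddCommGroup E] {r : ℝ≥0∞} {w : ℝ → E}
      (hw : MemLp w r (volume.restrict (Ioo 0 T))),
      ∃ w' : ℝ → E, StronglyMeasurable w' ∧ MemLp w' r volume ∧
        ∀ᵐ t, t ∈ Ioo 0 T → w' t = w t := by
    intro E _ r w hw
    refine ⟨(Ioo 0 T).indicator (hw.1.mk w), hw.1.stronglyMeasurable_mk.indicator measurableSet_Ioo,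
      ?_, ?_⟩
    · rw [memLp_indicator_iff_restrict measurableSet_Ioo]
      exact hw.ae_eq hw.1.ae_eq_mk
    · filter_upwards [(ae_restrict_iff' measurableSet_Ioo).1 hw.1.ae_eq_mk] with t ht htT
      rw [indicator_of_mem htT, ht htT]
  obtain ⟨W, hW1, hW2, hW3⟩ := key (hU T hT)
  obtain ⟨V, hV1, hV2, hV3⟩ := key (hv T hT)
  refine ⟨W, V, ⟨hW1, hV1, hW2, hV2, ?_, ?_⟩, ?_⟩
  · filter_upwards [hW3, (ae_restrict_iff' measurableSet_Ioi).1 htraj] with t h1 h2 ht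
    rw [h1 ht, h2 ht.1]
  · intro s t hs hst ht
    rw [hevol s t hs hst]
    congr 1
    refine intervalIntegral.integral_congr_ae ?_
    -- The representatives agree with the data on the open interval only; the endpoint `T` is
    -- discarded as a null set.
    have hTn : ∀ᵐ x : ℝ, x ≠ T := by simp [ae_iff, measure_singleton]
    filter_upwards [hV3, hTn] with x h1 h2 hx
    rw [uIoc_of_le hst] at hx
    exact (h1 ⟨hs.trans_lt hx.1, lt_of_le_of_ne (hx.2.trans ht) h2⟩).symm
  · filter_upwards [hW3, hV3] with t h1 h2 ht using ⟨h1 ht, h2 ht⟩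

/-- A function of `L^p(X)` with a derivative in `L^q(X⋆)` is continuous with values in the pivot
space, and its squared norm is a primitive of twice the duality pairing. -/
theorem continuousOn_and_norm_sq_sub_eq {j : X →L[ℝ] K} (hj : DenseRange j) {p q : ℝ}
    (hpq : p.HolderConjugate q) {u : ℝ → K} {U : ℝ → X}
    {v : ℝ → StrongDual ℝ X} (hU : MemLpLoc U (ENNReal.ofReal p))
    (hv : MemLpLoc v (ENNReal.ofReal q))
    (htraj : ∀ᵐ t ∂(volume.restrict (Ioi (0 : ℝ))), j (U t) = u t)
    (hevol : ∀ s t : ℝ, 0 ≤ s → s ≤ t →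
      (innerSL ℝ (u t)).comp j = (innerSL ℝ (u s)).comp j + ∫ σ in s..t, v σ) :
    ContinuousOn u (Ici 0) ∧ ∀ s t : ℝ, 0 ≤ s → s ≤ t →
      ‖u t‖ ^ 2 - ‖u s‖ ^ 2 = 2 * ∫ σ in s..t, v σ (U σ) := by
  constructor
  · intro t ht
    -- The horizon `t + 1` leaves room to the right of `t`, so continuity within the compact
    -- interval is continuity within the half-line.
    have hT : 0 < t + 1 := add_pos_of_nonneg_of_pos ht one_pos
    obtain ⟨W, V, H, -⟩ := exists_evolution hU hv htraj hevol hT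
    refine (H.continuousOn hpq hj t ⟨ht, by linarith⟩).mono_of_mem_nhdsWithin ?_
    refine mem_nhdsWithin.2 ⟨Iio (t + 1), isOpen_Iio, by simp, fun x hx => ⟨hx.2, hx.1.le⟩⟩
  · intro s t hs hst
    have hT : 0 < t + 1 := add_pos_of_nonneg_of_pos (hs.trans hst) one_pos
    obtain ⟨W, V, H, hae⟩ := exists_evolution hU hv htraj hevol hT
    rw [H.norm_sq_sub_eq hpq hj hT ⟨hs, by linarith⟩ ⟨hs.trans hst, by linarith⟩]
    congr 1
    refine intervalIntegral.integral_congr_ae ?_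
    filter_upwards [hae] with x hx hxI
    rw [uIoc_of_le hst] at hxI
    obtain ⟨h1, h2⟩ := hx ⟨hs.trans_lt hxI.1, by linarith [hxI.2]⟩
    rw [h1, h2]

end LionsMagenes

/-! ### Test functions -/

section Test

variable {N : ℕ} {Ω : Set (EuclideanSpace ℝ (Fin N))}

/-- The `i`-th partial derivative. -/
def pderiv (i : Fin N) (φ : EuclideanSpace ℝ (Fin N) → ℂ) (x : EuclideanSpace ℝ (Fin N)) : ℂ :=
  fderiv ℝ φ x (EuclideanSpace.single i (1 : ℝ))

namespace IsTest

theorem continuous {V : Type*} [NormedAddCommGroup V] [NormedSpace ℝ V] {U : Set V} {φ : V → ℂ}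
    (hφ : IsTest U φ) : Continuous φ := hφ.1.continuous

theorem memLp {φ : EuclideanSpace ℝ (Fin N) → ℂ} (hφ : IsTest Ω φ) (p : ℝ≥0∞) : MemLp φ p (volume.restrict Ω) :=
  (hφ.continuous.memLp_of_hasCompactSupport hφ.2.1).restrict Ω

theorem pderiv {φ : EuclideanSpace ℝ (Fin N) → ℂ} (hφ : IsTest Ω φ) (i : Fin N) : IsTest Ω (pderiv i φ) := by
  have h : tsupport (DampedNLS.pderiv i φ) ⊆ tsupport φ := tsupport_fderiv_apply_subset ℝ _
  refine ⟨?_, hφ.2.1.mono' (subset_closure.trans h), h.trans hφ.2.2⟩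
  exact (hφ.1.fderiv_right (m := ∞) (by simp)).clm_apply contDiff_const

theorem star {φ : EuclideanSpace ℝ (Fin N) → ℂ} (hφ : IsTest Ω φ) : IsTest Ω (fun x => conj (φ x)) := by
  have h : tsupport (fun x => (starRingEnd ℂ) (φ x)) ⊆ tsupport φ := by
    refine closure_mono fun x hx => ?_
    simpa using hx
  exact ⟨Complex.conjCLE.contDiff.comp hφ.1, hφ.2.1.mono' (subset_closure.trans h), h.trans hφ.2.2⟩

theorem add {φ ψ : EuclideanSpace ℝ (Fin N) → ℂ} (hφ : IsTest Ω φ) (hψ : IsTest Ω ψ) :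
    IsTest Ω (fun x => φ x + ψ x) :=
  ⟨hφ.1.add hψ.1, hφ.2.1.add hψ.2.1, (tsupport_add φ ψ).trans (union_subset hφ.2.2 hψ.2.2)⟩

theorem mul_left {χ φ : EuclideanSpace ℝ (Fin N) → ℂ} (hχ : ContDiff ℝ ∞ χ) (hφ : IsTest Ω φ) :
    IsTest Ω (fun x => χ x * φ x) :=
  ⟨hχ.mul hφ.1, hφ.2.1.mul_left, (tsupport_mul_subset_right).trans hφ.2.2⟩

theorem zero : IsTest Ω (fun _ : EuclideanSpace ℝ (Fin N) => (0 : ℂ)) :=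
  ⟨contDiff_const, HasCompactSupport.zero, by simp [tsupport]⟩

end IsTest

theorem pderiv_conj {φ : EuclideanSpace ℝ (Fin N) → ℂ} (hφ : IsTest Ω φ) (i : Fin N) (x : EuclideanSpace ℝ (Fin N)) :
    pderiv i (fun x => conj (φ x)) x = conj (pderiv i φ x) := by
  have := (Complex.conjCLE.hasFDerivAt.comp x
    ((hφ.1.differentiable (by simp)).differentiableAt (x := x)).hasFDerivAt).fderiv
  simp only [pderiv]
  change fderiv ℝ (Complex.conjCLE ∘ φ) x _ = _
  rw [this]; simp

theorem pderiv_mul {χ φ : EuclideanSpace ℝ (Fin N) → ℂ} (hχ : ContDiff ℝ ∞ χ) (hφ : IsTest Ω φ) (i : Fin N) (x : EuclideanSpace ℝ (Fin N)) :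
    pderiv i (fun x => χ x * φ x) x = χ x * pderiv i φ x + pderiv i χ x * φ x := by
  simp only [pderiv]
  rw [fderiv_fun_mul ((hχ.differentiable (by simp)).differentiableAt)
    ((hφ.1.differentiable (by simp)).differentiableAt)]
  simp [mul_comm]

theorem laplacian_eq_sum_pderiv {φ : EuclideanSpace ℝ (Fin N) → ℂ} (hφ : ContDiff ℝ ∞ φ) (x : EuclideanSpace ℝ (Fin N)) :
    Δ φ x = ∑ i, pderiv i (pderiv i φ) x := by
  rw [InnerProductSpace.laplacian_eq_iteratedFDeriv_orthonormalBasis φ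
    (EuclideanSpace.basisFun (Fin N) ℝ)]
  refine Finset.sum_congr rfl fun i _ => ?_
  rw [iteratedFDeriv_two_apply]
  simp only [pderiv, EuclideanSpace.basisFun_apply, Matrix.cons_val_zero, Matrix.cons_val_one]
  change _ = fderiv ℝ (fun y => fderiv ℝ φ y (EuclideanSpace.single i 1)) x _
  rw [fderiv_clm_apply ((hφ.fderiv_right (m := ∞) (by simp)).differentiable (by simp) x)
    (by fun_prop)]
  simp

theorem IsTest.laplacian {φ : EuclideanSpace ℝ (Fin N) → ℂ} (hφ : IsTest Ω φ) : IsTest Ω (Δ φ) := by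
  have h : Δ φ = fun x => ∑ i, DampedNLS.pderiv i (DampedNLS.pderiv i φ) x :=
    funext (laplacian_eq_sum_pderiv hφ.1)
  rw [h]
  have : ∀ s : Finset (Fin N),
      IsTest Ω (fun x => ∑ i ∈ s, DampedNLS.pderiv i (DampedNLS.pderiv i φ) x) := by
    intro s
    induction s using Finset.induction_on with
    | empty => simpa using IsTest.zero
    | insert i s hi ih =>
      simp only [Finset.sum_insert hi]
      exact ((hφ.pderiv i).pderiv i).add ih
  exact this _

theorem IsTest.setIntegral_mul_eq {φ ψ : EuclideanSpace ℝ (Fin N) → ℂ} (hφ : IsTest Ω φ) :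
    ∫ x in Ω, ψ x * φ x = ∫ x, ψ x * φ x := by
  refine setIntegral_eq_integral_of_forall_compl_eq_zero fun x hx => ?_
  rw [image_eq_zero_of_notMem_tsupport (fun h => hx (hφ.2.2 h)), mul_zero]

/-- The integrands vanish off `Ω`, so the integrals can be taken over the whole space, where compact
support leaves no boundary term; no regularity of `∂Ω` enters. -/
theorem integral_mul_pderiv {φ ψ : EuclideanSpace ℝ (Fin N) → ℂ} (hφ : IsTest Ω φ) (hψ : IsTest Ω ψ) (i : Fin N) :
    ∫ x in Ω, ψ x * pderiv i φ x = - ∫ x in Ω, pderiv i ψ x * φ x := by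
  have hint : ∀ {f g : EuclideanSpace ℝ (Fin N) → ℂ}, IsTest Ω f → IsTest Ω g →
      Integrable (fun x => f x * g x) volume := fun hf hg =>
    (hf.continuous.mul hg.continuous).integrable_of_hasCompactSupport hg.2.1.mul_left
  rw [(hφ.pderiv i).setIntegral_mul_eq, hφ.setIntegral_mul_eq]
  exact integral_mul_fderiv_eq_neg_fderiv_mul_of_integrable (hint (hψ.pderiv i) hφ)
    (hint hψ (hφ.pderiv i)) (hint hψ hφ)
    (fun x _ => (hψ.1.differentiable (by simp)).differentiableAt)
    (fun x _ => (hφ.1.differentiable (by simp)).differentiableAt)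

theorem integral_mul_laplacian {φ ψ : EuclideanSpace ℝ (Fin N) → ℂ} (hφ : IsTest Ω φ) (hψ : IsTest Ω ψ) :
    ∫ x in Ω, ψ x * Δ φ x = - ∑ i, ∫ x in Ω, pderiv i ψ x * pderiv i φ x := by
  simp_rw [laplacian_eq_sum_pderiv hφ.1, Finset.mul_sum]
  rw [integral_finsetSum, ← Finset.sum_neg_distrib]
  · exact Finset.sum_congr rfl fun i _ => integral_mul_pderiv (hφ.pderiv i) hψ i
  · intro i _
    exact (hψ.memLp 2).integrable_mul (((hφ.pderiv i).pderiv i).memLp 2)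

end Test

end

/-! ### Dominated convergence in `L^p`, and test functions in `H¹₀` -/

section

section Truncation

theorem tendsto_eLpNorm_of_dominated {α F : Type*} [MeasurableSpace α] [NormedAddCommGroup F]
    {μ : Measure α} {r : ℝ≥0∞} (hr0 : r ≠ 0) (hr : r ≠ ⊤) {w : ℕ → α → F} {g : α → F}
    (hw : ∀ n, AEStronglyMeasurable (w n) μ) (hg : MemLp g r μ)
    (hle : ∀ n, ∀ᵐ x ∂μ, ‖w n x‖ ≤ ‖g x‖) (hlim : ∀ᵐ x ∂μ, Tendsto (fun n => w n x) atTop (𝓝 0)) :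
    Tendsto (fun n => eLpNorm (w n) r μ) atTop (𝓝 0) := by
  have hr' : 0 < r.toReal := ENNReal.toReal_pos hr0 hr
  simp_rw [eLpNorm_eq_lintegral_rpow_enorm_toReal hr0 hr]
  have h1 : Tendsto (fun n => ∫⁻ x, ‖w n x‖ₑ ^ r.toReal ∂μ) atTop (𝓝 (∫⁻ _, 0 ∂μ)) := by
    refine tendsto_lintegral_of_dominated_convergence' (fun x => ‖g x‖ₑ ^ r.toReal)
      (fun n => (hw n).enorm.pow_const _) (fun n => ?_)
      (lintegral_rpow_enorm_lt_top_of_eLpNorm_lt_top hr0 hr hg.2).ne ?_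
    · filter_upwards [hle n] with x hx
      gcongr
      exact enorm_le_iff_norm_le.2 hx
    · filter_upwards [hlim] with x hx
      have h2 := ((continuous_enorm.tendsto _).comp hx)
      rw [enorm_zero] at h2
      have h3 := (ENNReal.continuous_rpow_const (y := r.toReal)).tendsto 0 |>.comp h2
      rwa [ENNReal.zero_rpow_of_pos hr'] at h3
  rw [lintegral_zero] at h1
  have h3 := (ENNReal.continuous_rpow_const (y := 1 / r.toReal)).tendsto 0 |>.comp h1
  rwa [ENNReal.zero_rpow_of_pos (by positivity)] at h3

theorem norm_sub_toLp {α F : Type*} [MeasurableSpace α] [NormedAddCommGroup F]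
    {μ : Measure α} {r : ℝ≥0∞} (w : Lp F r μ) {φ : α → F} (hφ : MemLp φ r μ) :
    ‖w - hφ.toLp φ‖ = (eLpNorm (fun x => w x - φ x) r μ).toReal := by
  rw [Lp.norm_def]
  congr 1
  refine eLpNorm_congr_ae ?_
  filter_upwards [Lp.coeFn_sub w (hφ.toLp φ), hφ.coeFn_toLp] with x h1 h2
  rw [h1, Pi.sub_apply, h2]

end Truncation

section Spaces

variable {N : ℕ} {Ω : Set (EuclideanSpace ℝ (Fin N))}

/-- The weak gradient of an element of `H¹₀(Ω)`. -/
def H10.grad (Ω : Set (EuclideanSpace ℝ (Fin N))) : H10 Ω →L[ℝ] (Fin N → LpSp Ω 2) :=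
  (ContinuousLinearMap.snd ℝ (LpSp Ω 2) (Fin N → LpSp Ω 2)).comp (H10Sub Ω).subtypeL

theorem H10.norm_eq (h : H10 Ω) : ‖h‖ = max ‖H10.toL2 Ω h‖ ‖H10.grad Ω h‖ := rfl

variable {H : Type*} [NormedAddCommGroup H] [NormedSpace ℝ H]

/-- The projection `H ∩ L^p(Ω) → H`. -/
def Inter.toH (j : H →L[ℝ] LpSp Ω 2) (p : ℝ≥0∞) [Fact (1 ≤ p)] : Inter j p →L[ℝ] H :=
  (ContinuousLinearMap.fst ℝ H (LpSp Ω p)).comp (interSub j p).subtypeL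

/-- The projection `H ∩ L^p(Ω) → L^p(Ω)`. -/
def Inter.toLp (j : H →L[ℝ] LpSp Ω 2) (p : ℝ≥0∞) [Fact (1 ≤ p)] : Inter j p →L[ℝ] LpSp Ω p :=
  (ContinuousLinearMap.snd ℝ H (LpSp Ω p)).comp (interSub j p).subtypeL

theorem Inter.norm_eq {j : H →L[ℝ] LpSp Ω 2} {p : ℝ≥0∞} [Fact (1 ≤ p)] (x : Inter j p) :
    ‖x‖ = max ‖Inter.toH j p x‖ ‖Inter.toLp j p x‖ := rfl

theorem Inter.toL2_ae_eq {j : H →L[ℝ] LpSp Ω 2} {p : ℝ≥0∞} [Fact (1 ≤ p)] (x : Inter j p) :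
    Inter.toL2 j p x =ᵐ[volume.restrict Ω] Inter.toLp j p x := x.2

/-- A test function as an element of `H¹₀(Ω)`. -/
def IsTest.toH10 {φ : EuclideanSpace ℝ (Fin N) → ℂ} (hφ : IsTest Ω φ) : H10 Ω :=
  ⟨((hφ.memLp 2).toLp φ, fun i => ((hφ.pderiv i).memLp 2).toLp _),
    subset_closure (Submodule.subset_span
      ⟨φ, hφ, (hφ.memLp 2).coeFn_toLp, fun i => ((hφ.pderiv i).memLp 2).coeFn_toLp⟩)⟩

theorem IsTest.toL2_toH10 {φ : EuclideanSpace ℝ (Fin N) → ℂ} (hφ : IsTest Ω φ) :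
    H10.toL2 Ω hφ.toH10 = (hφ.memLp 2).toLp φ := rfl

theorem IsTest.grad_toH10 {φ : EuclideanSpace ℝ (Fin N) → ℂ} (hφ : IsTest Ω φ) (i : Fin N) :
    H10.grad Ω hφ.toH10 i = ((hφ.pderiv i).memLp 2).toLp _ := rfl

/-- A test function as an element of `H¹₀(Ω) ∩ L^p(Ω)`. -/
def IsTest.toInter {φ : EuclideanSpace ℝ (Fin N) → ℂ} (hφ : IsTest Ω φ) (p : ℝ≥0∞) [Fact (1 ≤ p)] :
    Inter (H10.toL2 Ω) p :=
  ⟨(hφ.toH10, (hφ.memLp p).toLp φ),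
    (hφ.memLp 2).coeFn_toLp.trans (hφ.memLp p).coeFn_toLp.symm⟩

theorem IsTest.toH_toInter {φ : EuclideanSpace ℝ (Fin N) → ℂ} (hφ : IsTest Ω φ) (p : ℝ≥0∞) [Fact (1 ≤ p)] :
    Inter.toH _ p (hφ.toInter p) = hφ.toH10 := rfl

theorem IsTest.toLp_toInter {φ : EuclideanSpace ℝ (Fin N) → ℂ} (hφ : IsTest Ω φ) (p : ℝ≥0∞) [Fact (1 ≤ p)] :
    Inter.toLp _ p (hφ.toInter p) = (hφ.memLp p).toLp φ := rfl

theorem IsTest.toL2_toInter {φ : EuclideanSpace ℝ (Fin N) → ℂ} (hφ : IsTest Ω φ) (p : ℝ≥0∞) [Fact (1 ≤ p)] :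
    Inter.toL2 _ p (hφ.toInter p) = (hφ.memLp 2).toLp φ := rfl

/-- The pairs `(φ, ∇φ)` already form a real linear space, so taking the span adds nothing and
elements of the closure are limits of such pairs. -/
theorem H10.exists_isTest_norm_sub_lt (h : H10 Ω) {ε : ℝ} (hε : 0 < ε) :
    ∃ (φ : EuclideanSpace ℝ (Fin N) → ℂ) (hφ : IsTest Ω φ), ‖h - hφ.toH10‖ < ε := by
  have hspan : ∀ z : LpSp Ω 2 × (Fin N → LpSp Ω 2),
      z ∈ Submodule.span ℝ {h : LpSp Ω 2 × (Fin N → LpSp Ω 2) | ∃ φ : EuclideanSpace ℝ (Fin N) → ℂ, IsTest Ω φ ∧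
        (h.1 =ᵐ[volume.restrict Ω] φ) ∧ ∀ i, h.2 i =ᵐ[volume.restrict Ω] pderiv i φ} →
      ∃ (φ : EuclideanSpace ℝ (Fin N) → ℂ) (hφ : IsTest Ω φ),
        (z.1 =ᵐ[volume.restrict Ω] φ) ∧ ∀ i, z.2 i =ᵐ[volume.restrict Ω] pderiv i φ := by
    intro z hz
    induction hz using Submodule.span_induction with
    | mem x hx =>
      obtain ⟨φ, hφ, h1, h2⟩ := hx
      exact ⟨φ, hφ, h1, h2⟩
    | zero =>
      refine ⟨_, IsTest.zero, Lp.coeFn_zero _ _ _, fun i => ?_⟩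
      refine (Lp.coeFn_zero _ _ _).trans (ae_of_all _ fun x => ?_)
      simp [pderiv]
    | add x y _ _ hx hy =>
      obtain ⟨φ, hφ, h1, h2⟩ := hx
      obtain ⟨ψ, hψ, h3, h4⟩ := hy
      refine ⟨_, hφ.add hψ, (Lp.coeFn_add _ _).trans (h1.add h3), fun i => ?_⟩
      refine (Lp.coeFn_add _ _).trans (((h2 i).add (h4 i)).trans (ae_of_all _ fun x => ?_))
      simp only [pderiv]
      rw [fderiv_fun_add ((hφ.1.differentiable (by simp)).differentiableAt)
        ((hψ.1.differentiable (by simp)).differentiableAt)]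
      rfl
    | smul c x _ hx =>
      obtain ⟨φ, hφ, h1, h2⟩ := hx
      refine ⟨_, hφ.mul_left (χ := fun _ => (c : ℂ)) contDiff_const,
        (Lp.coeFn_smul _ _).trans ((h1.const_smul c).trans (ae_of_all _ fun x => by simp)),
        fun i => ?_⟩
      refine (Lp.coeFn_smul _ _).trans (((h2 i).const_smul c).trans (ae_of_all _ fun x => ?_))
      rw [pderiv_mul contDiff_const hφ]
      simp [pderiv]
  obtain ⟨z, hz, hzε⟩ := Metric.mem_closure_iff.1 (show h.1 ∈ closure _ from h.2) ε hε
  obtain ⟨φ, hφ, h1, h2⟩ := hspan z hz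
  refine ⟨φ, hφ, ?_⟩
  have : z = (hφ.toH10 : H10Sub Ω).1 := by
    refine Prod.ext ?_ (funext fun i => ?_)
    · exact Lp.ext (h1.trans (hφ.memLp 2).coeFn_toLp.symm)
    · exact Lp.ext ((h2 i).trans ((hφ.pderiv i).memLp 2).coeFn_toLp.symm)
  rw [this, dist_eq_norm] at hzε
  exact hzε

end Spaces

end

/-! ### Density of test functions in `H¹₀ ∩ L^p` -/

section

section Density

variable {N : ℕ} {Ω : Set (EuclideanSpace ℝ (Fin N))}

/-- All cutoffs are dilations of one bump function, so `C` does not depend on `R` and the chain rule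
yields the factor `1 / R`. -/
theorem exists_cutoff (d : ℕ) : ∃ C : ℝ, 0 ≤ C ∧ ∀ R : ℝ, 0 < R →
    ∃ χ : EuclideanSpace ℝ (Fin d) → ℂ, ContDiff ℝ ∞ χ ∧ (∀ x, ‖χ x‖ ≤ 1) ∧ (∀ x, ‖x‖ ≤ R → χ x = 1) ∧
    (∀ x, 2 * R ≤ ‖x‖ → χ x = 0) ∧ ∀ i x, ‖pderiv i χ x‖ ≤ C / R := by
  let b : ContDiffBump (0 : EuclideanSpace ℝ (Fin d)) := ⟨1, 2, one_pos, one_lt_two⟩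
  have hb : ContDiff ℝ ∞ b := b.contDiff
  obtain ⟨C, hC⟩ := (b.hasCompactSupport.fderiv ℝ).exists_bound_of_continuous
    (hb.continuous_fderiv (by simp))
  refine ⟨C, (norm_nonneg _).trans (hC 0), fun R hR => ?_⟩
  have hR' : |R⁻¹| = R⁻¹ := abs_of_pos (by positivity)
  refine ⟨fun x => (b (R⁻¹ • x) : ℂ), ?_, ?_, ?_, ?_, ?_⟩
  · exact Complex.ofRealCLM.contDiff.comp (hb.comp (contDiff_const_smul _))
  · intro x
    rw [Complex.norm_real, Real.norm_of_nonneg b.nonneg]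
    exact b.le_one
  · intro x hx
    change ((b (R⁻¹ • x) : ℝ) : ℂ) = 1
    rw [b.one_of_mem_closedBall, Complex.ofReal_one]
    rw [mem_closedBall_zero_iff, norm_smul, Real.norm_eq_abs, hR']
    change R⁻¹ * ‖x‖ ≤ 1
    rwa [inv_mul_le_iff₀ hR, mul_one]
  · intro x hx
    change ((b (R⁻¹ • x) : ℝ) : ℂ) = 0
    rw [b.zero_of_le_dist, Complex.ofReal_zero]
    rw [dist_zero_right, norm_smul, Real.norm_eq_abs, hR']
    change 2 ≤ R⁻¹ * ‖x‖
    rw [le_inv_mul_iff₀ hR]; linarith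
  · intro i x
    have h1 : HasFDerivAt (fun x : EuclideanSpace ℝ (Fin d) => (b (R⁻¹ • x) : ℂ))
        (Complex.ofRealCLM.comp ((fderiv ℝ b (R⁻¹ • x)).comp
          (R⁻¹ • ContinuousLinearMap.id ℝ (EuclideanSpace ℝ (Fin d))))) x :=
      Complex.ofRealCLM.hasFDerivAt.comp x
        (((hb.differentiable (by simp)).differentiableAt).hasFDerivAt.comp x
          ((hasFDerivAt_id x).const_smul R⁻¹))
    simp only [pderiv]
    rw [h1.fderiv]
    simp only [ContinuousLinearMap.comp_apply, Complex.ofRealCLM_apply,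
      smul_apply, ContinuousLinearMap.id_apply, map_smul]
    rw [norm_smul, Real.norm_eq_abs, hR', div_eq_inv_mul]
    gcongr
    rw [Complex.norm_real]
    refine (ContinuousLinearMap.le_opNorm _ _).trans ?_
    simpa using hC (R⁻¹ • x)

/-- Smooth cutoff functions converging to `1`. -/
structure IsCutoff (C : ℝ) (χ : ℕ → EuclideanSpace ℝ (Fin N) → ℂ) : Prop where
  contDiff : ∀ n, ContDiff ℝ ∞ (χ n)
  norm_le : ∀ n x, ‖χ n x‖ ≤ 1
  eq_one : ∀ (n : ℕ) (x : EuclideanSpace ℝ (Fin N)), ‖x‖ ≤ n + 1 → χ n x = 1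
  eq_zero : ∀ (n : ℕ) (x : EuclideanSpace ℝ (Fin N)), 2 * ((n : ℝ) + 1) ≤ ‖x‖ → χ n x = 0
  pderiv_le : ∀ (n : ℕ) i x, ‖pderiv i (χ n) x‖ ≤ C / (n + 1)

theorem exists_isCutoff (d : ℕ) :
    ∃ C : ℝ, 0 ≤ C ∧ ∃ χ : ℕ → EuclideanSpace ℝ (Fin d) → ℂ, IsCutoff C χ := by
  obtain ⟨C, hC, h⟩ := exists_cutoff d
  choose χ h1 h2 h3 h4 h5 using fun n : ℕ => h (n + 1) (by positivity)
  exact ⟨C, hC, χ, h1, h2, h3, h4, h5⟩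

variable {C : ℝ} {χ : ℕ → EuclideanSpace ℝ (Fin N) → ℂ}

theorem IsCutoff.tendsto_eLpNorm (hχ : IsCutoff C χ) {r : ℝ≥0∞} [hr1 : Fact (1 ≤ r)] (hr : r ≠ ⊤)
    {μ : Measure (EuclideanSpace ℝ (Fin N))} {w : EuclideanSpace ℝ (Fin N) → ℂ} (hw : MemLp w r μ) :
    Tendsto (fun n => eLpNorm (fun x => w x - χ n x * w x) r μ) atTop (𝓝 0) := by
  have hm : ∀ n, AEStronglyMeasurable (fun x => w x - χ n x * w x) μ := fun n =>
    hw.1.sub ((hχ.contDiff n).continuous.aestronglyMeasurable.mul hw.1)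
  have hb : MemLp (fun x => (2 : ℂ) * w x) r μ := hw.const_mul 2
  refine tendsto_eLpNorm_of_dominated (one_pos.trans_le hr1.out).ne' hr hm hb
    (fun n => ae_of_all _ fun x => ?_) (ae_of_all _ fun x => ?_)
  · refine (norm_sub_le _ _).trans ?_
    rw [norm_mul, norm_mul, Complex.norm_ofNat]
    nlinarith [hχ.norm_le n x, norm_nonneg (w x)]
  · obtain ⟨n, hn⟩ := exists_nat_ge ‖x‖
    refine tendsto_const_nhds.congr' ?_
    filter_upwards [eventually_ge_atTop n] with k hk
    rw [hχ.eq_one k x (hn.trans (by have : (n : ℝ) ≤ k := by exact_mod_cast hk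
                                    linarith)), one_mul, sub_self]

theorem IsCutoff.eLpNorm_mul_le (hχ : IsCutoff C χ) (n : ℕ) (r : ℝ≥0∞) (μ : Measure (EuclideanSpace ℝ (Fin N))) (w : EuclideanSpace ℝ (Fin N) → ℂ) :
    eLpNorm (fun x => χ n x * w x) r μ ≤ eLpNorm w r μ := by
  have h : ∀ x, ‖χ n x * w x‖ ≤ ‖w x‖ := fun x => by
    rw [norm_mul]
    nlinarith [hχ.norm_le n x, norm_nonneg (w x)]
  exact eLpNorm_mono h

/-- The cutoff vanishes outside a ball, of finite measure, where `L²` controls `L^r` for `r ≤ 2`.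
This replaces the embedding that is missing when `|Ω| = ∞`; the constant depends on `n`. -/
theorem IsCutoff.eLpNorm_mul_le_two (hχ : IsCutoff C χ) (n : ℕ) {r : ℝ≥0∞} (hr : r ≤ 2) :
    ∃ B : ℝ≥0∞, B ≠ ⊤ ∧ ∀ w : EuclideanSpace ℝ (Fin N) → ℂ, AEStronglyMeasurable w (volume.restrict Ω) →
      eLpNorm (fun x => χ n x * w x) r (volume.restrict Ω)
        ≤ B * eLpNorm w 2 (volume.restrict Ω) := by
  set D : Set (EuclideanSpace ℝ (Fin N)) := Metric.ball 0 (2 * ((n : ℝ) + 1)) with hD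
  have hDm : MeasurableSet D := measurableSet_ball
  have hfin : ((volume.restrict Ω).restrict D) univ < ⊤ := by
    rw [Measure.restrict_apply_univ]
    exact (Measure.restrict_apply_le _ _).trans_lt measure_ball_lt_top
  by_cases hr0 : r = 0
  · exact ⟨0, by simp, fun w _ => by simp [hr0]⟩
  have hrt : r ≠ ⊤ := (hr.trans_lt (by simp)).ne
  refine ⟨((volume.restrict Ω).restrict D) univ ^ (1 / r.toReal - 1 / (2 : ℝ≥0∞).toReal),
    ?_, fun w hw => ?_⟩
  · refine (ENNReal.rpow_lt_top_of_nonneg ?_ hfin.ne).ne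
    have h1 := ENNReal.toReal_mono (by simp) hr
    have h2 := ENNReal.toReal_pos hr0 hrt
    rw [sub_nonneg]
    exact one_div_le_one_div_of_le h2 h1
  · calc eLpNorm (fun x => χ n x * w x) r (volume.restrict Ω)
        ≤ eLpNorm (D.indicator w) r (volume.restrict Ω) := by
          have h : ∀ x, ‖χ n x * w x‖ ≤ ‖D.indicator w x‖ := fun x => ?_
          · exact eLpNorm_mono h
          by_cases hx : x ∈ D
          · rw [indicator_of_mem hx, norm_mul]
            nlinarith [hχ.norm_le n x, norm_nonneg (w x)]
          · rw [hχ.eq_zero n x (by simpa [hD] using hx), zero_mul, norm_zero]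
            exact norm_nonneg _
      _ = eLpNorm w r ((volume.restrict Ω).restrict D) :=
          eLpNorm_indicator_eq_eLpNorm_restrict hDm
      _ ≤ eLpNorm w 2 ((volume.restrict Ω).restrict D) * _ :=
          eLpNorm_le_eLpNorm_mul_rpow_measure_univ hr hw.restrict
      _ ≤ _ := by
          rw [mul_comm]
          refine mul_le_mul_right ?_ _
          exact eLpNorm_mono_measure w Measure.restrict_le_self

theorem toReal_eLpNorm_add_le {α : Type*} [MeasurableSpace α] {μ : Measure α} {r : ℝ≥0∞}
    [hr : Fact (1 ≤ r)] {f g : α → ℂ} (hf : MemLp f r μ) (hg : MemLp g r μ) :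
    (eLpNorm (fun x => f x + g x) r μ).toReal
      ≤ (eLpNorm f r μ).toReal + (eLpNorm g r μ).toReal := by
  rw [← ENNReal.toReal_add hf.2.ne hg.2.ne]
  exact ENNReal.toReal_mono (ENNReal.add_ne_top.2 ⟨hf.2.ne, hg.2.ne⟩) (eLpNorm_add_le hf.1 hg.1 hr.out)

/-- Test functions are dense in `H¹₀(Ω) ∩ L^p(Ω)` for `1 ≤ p ≤ 2`. -/
theorem Inter.exists_isTest_norm_sub_lt {p : ℝ≥0∞} [hp1 : Fact (1 ≤ p)] (hp : p ≤ 2)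
    (x : Inter (H10.toL2 Ω) p) {ε : ℝ} (hε : 0 < ε) :
    ∃ (φ : EuclideanSpace ℝ (Fin N) → ℂ) (hφ : IsTest Ω φ), ‖x - hφ.toInter p‖ < ε := by
  have hpt : p ≠ ⊤ := (hp.trans_lt (by simp)).ne
  obtain ⟨C, hC, χ, hχ⟩ := exists_isCutoff N
  set h := Inter.toH _ p x with hh
  set w := H10.toL2 Ω h with hw
  set G := H10.grad Ω h with hG
  set wp := Inter.toLp _ p x with hwp
  have hwwp : w =ᵐ[volume.restrict Ω] wp := Inter.toL2_ae_eq x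
  have tr : ∀ {a : ℕ → ℝ≥0∞}, Tendsto a atTop (𝓝 0) → ∀ᶠ n in atTop, (a n).toReal < ε / 4 := by
    intro a ha
    have := (ENNReal.tendsto_toReal ENNReal.zero_ne_top).comp ha
    exact this.eventually_lt_const (by simpa using by positivity)
  have t1 := tr (hχ.tendsto_eLpNorm (by simp) (Lp.memLp w))
  have t2 := tr (hχ.tendsto_eLpNorm hpt (Lp.memLp wp))
  have t3 : ∀ᶠ n in atTop, ∀ i, (eLpNorm (fun x => G i x - χ n x * G i x) 2
      (volume.restrict Ω)).toReal < ε / 4 :=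
    eventually_all.2 fun i => tr (hχ.tendsto_eLpNorm (by simp) (Lp.memLp (G i)))
  have t4 : ∀ᶠ n : ℕ in atTop, C / (n + 1) * (‖w‖ + 1) < ε / 4 := by
    have : Tendsto (fun n : ℕ => C / ((n : ℝ) + 1) * (‖w‖ + 1)) atTop (𝓝 (0 * (‖w‖ + 1))) :=
      (tendsto_const_div_atTop_nhds_zero_nat C |>.comp (tendsto_add_atTop_nat 1) |>.congr
        fun n => by simp).mul_const _
    exact this.eventually_lt_const (by simpa using by positivity)
  -- The order matters: `n` is fixed first, because the constant `B` depends on it, and `φ` is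
  -- chosen only afterwards.
  obtain ⟨n, h1, h2, h3, h4⟩ := (t1.and (t2.and (t3.and t4))).exists
  obtain ⟨B, hB, hBle⟩ := hχ.eLpNorm_mul_le_two (Ω := Ω) n hp
  -- The entry `1` serves the term with `∇χ`, `ε / 4` the errors in `L²`, and the last entry absorbs
  -- `B` in the passage from `L²` to `L^p`.
  have hδ : 0 < min (min 1 (ε / 4)) (ε / (4 * (B.toReal + 1))) := by positivity
  obtain ⟨φ, hφ, hlt⟩ := h.exists_isTest_norm_sub_lt hδ
  rw [H10.norm_eq, map_sub, map_sub, max_lt_iff, ← hw, ← hG, pi_norm_lt_iff hδ] at hlt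
  obtain ⟨hlt1, hlt2⟩ := hlt
  rw [IsTest.toL2_toH10, norm_sub_toLp] at hlt1
  have hlt3 : ∀ i, (eLpNorm (fun x => G i x - pderiv i φ x) 2 (volume.restrict Ω)).toReal
      < min (min 1 (ε / 4)) (ε / (4 * (B.toReal + 1))) := by
    intro i
    have := hlt2 i
    rwa [Pi.sub_apply, IsTest.grad_toH10, norm_sub_toLp] at this
  have hδ1 : min (min 1 (ε / 4)) (ε / (4 * (B.toReal + 1))) ≤ 1 :=
    (min_le_left _ _).trans (min_le_left _ _)
  have hδ2 : min (min 1 (ε / 4)) (ε / (4 * (B.toReal + 1))) ≤ ε / 4 :=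
    (min_le_left _ _).trans (min_le_right _ _)
  have hδ3 := min_le_right (min 1 (ε / 4)) (ε / (4 * (B.toReal + 1)))
  have hψ := IsTest.mul_left (hχ.contDiff n) hφ
  have hχm : ∀ {r : ℝ≥0∞} {g : EuclideanSpace ℝ (Fin N) → ℂ}, MemLp g r (volume.restrict Ω) →
      MemLp (fun x => χ n x * g x) r (volume.restrict Ω) := fun hg =>
    hg.of_le ((hχ.contDiff n).continuous.aestronglyMeasurable.mul hg.1) (ae_of_all _ fun x => by
      rw [norm_mul]; nlinarith [hχ.norm_le n x, norm_nonneg (‹EuclideanSpace ℝ (Fin N) → ℂ› x)])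
  have hχs : ∀ {r : ℝ≥0∞} {g : EuclideanSpace ℝ (Fin N) → ℂ}, MemLp g r (volume.restrict Ω) →
      MemLp (fun x => g x - χ n x * g x) r (volume.restrict Ω) := fun hg => hg.sub (hχm hg)
  have hadd : ∀ {f g : EuclideanSpace ℝ (Fin N) → ℂ}, MemLp f 2 (volume.restrict Ω) →
      MemLp g 2 (volume.restrict Ω) → MemLp (fun x => f x + g x) 2 (volume.restrict Ω) :=
    fun hf hg => hf.add hg
  have hwφ : MemLp (fun x => w x - φ x) 2 (volume.restrict Ω) := (Lp.memLp w).sub (hφ.memLp 2)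
  refine ⟨_, hψ, ?_⟩
  rw [Inter.norm_eq, map_sub, map_sub, IsTest.toH_toInter, IsTest.toLp_toInter, H10.norm_eq,
    map_sub, map_sub, ← hh, ← hwp, ← hw, ← hG, IsTest.toL2_toH10, norm_sub_toLp, norm_sub_toLp,
    max_lt_iff, max_lt_iff, pi_norm_lt_iff hε]
  refine ⟨⟨?_, fun i => ?_⟩, ?_⟩
  · have e : (fun x => w x - χ n x * φ x)
        = fun x => (w x - χ n x * w x) + χ n x * (w x - φ x) := by
      ext x; ring
    rw [e]
    refine (toReal_eLpNorm_add_le (hχs (Lp.memLp w)) (hχm hwφ)).trans_lt ?_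
    have := ENNReal.toReal_mono hwφ.2.ne (hχ.eLpNorm_mul_le n 2 (volume.restrict Ω)
      (fun x => w x - φ x))
    linarith
  · have hGφ : MemLp (fun x => G i x - pderiv i φ x) 2 (volume.restrict Ω) :=
      (Lp.memLp (G i)).sub ((hφ.pderiv i).memLp 2)
    have hpm : ∀ {g : EuclideanSpace ℝ (Fin N) → ℂ}, MemLp g 2 (volume.restrict Ω) →
        MemLp (fun x => pderiv i (χ n) x * g x) 2 (volume.restrict Ω) ∧
        (eLpNorm (fun x => pderiv i (χ n) x * g x) 2 (volume.restrict Ω)).toReal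
          ≤ C / (n + 1) * (eLpNorm g 2 (volume.restrict Ω)).toReal := by
      intro g hg
      have hcont : Continuous (pderiv i (χ n)) :=
        (((hχ.contDiff n).fderiv_right (m := ∞) (by simp)).clm_apply contDiff_const).continuous
      have hle : ∀ᵐ x ∂(volume.restrict Ω), ‖pderiv i (χ n) x * g x‖ ≤ C / (n + 1) * ‖g x‖ :=
        ae_of_all _ fun x => by
          rw [norm_mul]
          exact mul_le_mul_of_nonneg_right (hχ.pderiv_le n i x) (norm_nonneg _)
      have hm := hg.of_le_mul (hcont.aestronglyMeasurable.mul hg.1) hle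
      refine ⟨hm, ?_⟩
      have := ENNReal.toReal_mono (ENNReal.mul_ne_top ENNReal.ofReal_ne_top hg.2.ne)
        (eLpNorm_le_mul_eLpNorm_of_ae_le_mul hle 2)
      rwa [ENNReal.toReal_mul, ENNReal.toReal_ofReal (by positivity)] at this
    rw [Pi.sub_apply, IsTest.grad_toH10, norm_sub_toLp]
    -- In the product rule, `φ` next to `∇χ` is replaced by `w - (w - φ)`; the two resulting terms
    -- are together at most `C / (n + 1) * (‖w‖ + 1)`, the quantity made small in `t4`.
    have e : (fun x => G i x - pderiv i (fun x => χ n x * φ x) x)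
        = fun x => ((G i x - χ n x * G i x) + χ n x * (G i x - pderiv i φ x))
          + (pderiv i (χ n) x * (w x - φ x) + pderiv i (χ n) x * (- w x)) := by
      ext x; rw [pderiv_mul (hχ.contDiff n) hφ]; ring
    have m1 := hχs (Lp.memLp (G i))
    have m2 := hχm hGφ
    have m3 := hpm hwφ
    have m4 := hpm (g := fun x => - w x) (Lp.memLp w).neg
    rw [e]
    refine (toReal_eLpNorm_add_le (hadd m1 m2) (hadd m3.1 m4.1)).trans_lt ?_
    have b1 := toReal_eLpNorm_add_le m1 m2
    have b2 := toReal_eLpNorm_add_le m3.1 m4.1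
    have b3 := ENNReal.toReal_mono hGφ.2.ne (hχ.eLpNorm_mul_le n 2 (volume.restrict Ω)
      (fun x => G i x - pderiv i φ x))
    have b4 : (eLpNorm (fun x => - w x) 2 (volume.restrict Ω)).toReal = ‖w‖ := by
      rw [Lp.norm_def]
      exact congrArg _ (eLpNorm_neg w 2 _)
    have b5 := m4.2
    rw [b4] at b5
    have b6 : C / (n + 1) * (eLpNorm (fun x => w x - φ x) 2 (volume.restrict Ω)).toReal
        ≤ C / (n + 1) * 1 := by
      gcongr; linarith
    have b7 := m3.2
    have b8 := h3 i
    have b9 := hlt3 i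
    linarith
  · have hwpφ : MemLp (fun x => wp x - φ x) p (volume.restrict Ω) := (Lp.memLp wp).sub (hφ.memLp p)
    have e : (fun x => wp x - χ n x * φ x)
        = fun x => (wp x - χ n x * wp x) + χ n x * (wp x - φ x) := by
      ext x; ring
    rw [e]
    refine (toReal_eLpNorm_add_le (hχs (Lp.memLp wp))
      (hχm hwpφ)).trans_lt ?_
    have b1 : eLpNorm (fun x => χ n x * (wp x - φ x)) p (volume.restrict Ω)
        ≤ B * eLpNorm (fun x => w x - φ x) 2 (volume.restrict Ω) := by
      refine le_trans (le_of_eq (eLpNorm_congr_ae ?_)) (hBle _ hwφ.1)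
      filter_upwards [hwwp] with x hx
      rw [hx]
    have b2 := ENNReal.toReal_mono (ENNReal.mul_ne_top hB hwφ.2.ne) b1
    rw [ENNReal.toReal_mul] at b2
    have b3 : B.toReal * (eLpNorm (fun x => w x - φ x) 2 (volume.restrict Ω)).toReal
        ≤ B.toReal * (ε / (4 * (B.toReal + 1))) := by
      gcongr; linarith
    have b4 : B.toReal * (ε / (4 * (B.toReal + 1))) ≤ ε / 4 := by
      have : (0 : ℝ) ≤ B.toReal := ENNReal.toReal_nonneg
      rw [mul_div_assoc', div_le_div_iff₀ (by positivity) (by positivity)]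
      nlinarith
    linarith

end Density

end

/-! ### Integration by parts in `H¹₀`, and density in `L²` -/

section

variable {N : ℕ} {Ω : Set (EuclideanSpace ℝ (Fin N))}

theorem IsTest.inner_star_toLp {φ : EuclideanSpace ℝ (Fin N) → ℂ} (hφ : IsTest Ω φ)
    (w : LpSp Ω 2) : inner ℂ ((hφ.star.memLp 2).toLp _) w = ∫ x in Ω, w x * φ x := by
  rw [L2.inner_def]
  refine integral_congr_ae ?_
  filter_upwards [(hφ.star.memLp 2).coeFn_toLp] with x hx
  rw [hx, RCLike.inner_apply, RCLike.conj_conj]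

theorem re_inner_eq (v w : LpSp Ω 2) : (inner ℂ v w).re = inner ℝ v w := by
  rw [L2.inner_def, L2.inner_def]
  have h := integral_re (𝕜 := ℂ) (L2.integrable_inner (𝕜 := ℂ) v w)
  simp only [RCLike.re_to_complex] at h
  rw [← h]
  refine integral_congr_ae (ae_of_all _ fun x => ?_)
  simp [Complex.inner, mul_comm]

theorem H10.denseRange_toH10 :
    DenseRange (fun φ : {φ : EuclideanSpace ℝ (Fin N) → ℂ // IsTest Ω φ} => φ.2.toH10) := by
  intro h
  refine Metric.mem_closure_iff.2 fun ε hε => ?_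
  obtain ⟨φ, hφ, h1⟩ := h.exists_isTest_norm_sub_lt hε
  exact ⟨_, ⟨⟨φ, hφ⟩, rfl⟩, by rwa [dist_eq_norm]⟩

theorem Inter.denseRange_toInter {p : ℝ≥0∞} [Fact (1 ≤ p)] (hp : p ≤ 2) :
    DenseRange (fun φ : {φ : EuclideanSpace ℝ (Fin N) → ℂ // IsTest Ω φ} => φ.2.toInter p) := by
  intro h
  refine Metric.mem_closure_iff.2 fun ε hε => ?_
  obtain ⟨φ, hφ, h1⟩ := h.exists_isTest_norm_sub_lt hp hε
  exact ⟨_, ⟨⟨φ, hφ⟩, rfl⟩, by rwa [dist_eq_norm]⟩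

/-- Integration by parts against a test function in `H¹₀(Ω)`. -/
theorem H10.integral_mul_laplacian (h : H10 Ω) {φ : EuclideanSpace ℝ (Fin N) → ℂ}
    (hφ : IsTest Ω φ) :
    ∫ x in Ω, H10.toL2 Ω h x * Δ φ x = - ∑ i, ∫ x in Ω, H10.grad Ω h i x * pderiv i φ x := by
  -- As inner products, both sides are continuous in `h`, so density reduces the claim to smooth
  -- functions.
  simp_rw [← hφ.laplacian.inner_star_toLp, ← (hφ.pderiv _).inner_star_toLp]
  refine denseRange_toH10.induction_on (p := fun h => inner ℂ
    ((hφ.laplacian.star.memLp 2).toLp _) (H10.toL2 Ω h) = - ∑ i, inner ℂ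
    (((hφ.pderiv i).star.memLp 2).toLp _) (H10.grad Ω h i)) h (isClosed_eq ?_ ?_) ?_
  · exact continuous_const.inner (H10.toL2 Ω).continuous
  · refine (continuous_finsetSum _ fun i _ => continuous_const.inner ?_).neg
    exact (continuous_apply i).comp (H10.grad Ω).continuous
  · rintro ⟨ψ, hψ⟩
    simp_rw [hφ.laplacian.inner_star_toLp, (hφ.pderiv _).inner_star_toLp]
    have e := DampedNLS.integral_mul_laplacian hφ hψ
    have c1 : ∫ x in Ω, H10.toL2 Ω hψ.toH10 x * Δ φ x = ∫ x in Ω, ψ x * Δ φ x := by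
      refine integral_congr_ae ?_
      filter_upwards [(hψ.memLp 2).coeFn_toLp] with x hx
      rw [hψ.toL2_toH10, hx]
    have c2 : ∀ i, ∫ x in Ω, H10.grad Ω hψ.toH10 i x * pderiv i φ x
        = ∫ x in Ω, pderiv i ψ x * pderiv i φ x := by
      intro i
      refine integral_congr_ae ?_
      filter_upwards [((hψ.pderiv i).memLp 2).coeFn_toLp] with x hx
      rw [hψ.grad_toH10, hx]
    simp_rw [c1, c2]
    exact e

/-- A vector orthogonal to the range annihilates all test functions, hence vanishes almost
everywhere on the open set `Ω`. -/
theorem Inter.denseRange_toL2 (hΩ : IsOpen Ω) (p : ℝ≥0∞) [Fact (1 ≤ p)] :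
    DenseRange (Inter.toL2 (H10.toL2 Ω) p) := by
  have h : (LinearMap.range (Inter.toL2 (H10.toL2 Ω) p).toLinearMap)ᗮ = ⊥ := by
    rw [Submodule.eq_bot_iff]
    intro v hv
    have key : ∀ {φ : EuclideanSpace ℝ (Fin N) → ℂ}, IsTest Ω φ →
        (∫ x in Ω, v x * φ x).re = 0 := by
      intro φ hφ
      rw [← hφ.inner_star_toLp, re_inner_eq]
      exact (Submodule.mem_orthogonal _ _).1 hv _ ⟨hφ.star.toInter p, rfl⟩
    have hae : ∀ᵐ x, x ∈ Ω → v x = 0 := by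
      refine hΩ.ae_eq_zero_of_integral_contDiff_smul_eq_zero
        (locallyIntegrableOn_of_locallyIntegrable_restrict
          ((Lp.memLp v).locallyIntegrable (by norm_num))) fun g hg1 hg2 hg3 => ?_
      -- Orthogonality is real and sees only real parts; `c = 1` and `c = I` together recover the
      -- complex integral.
      have ht : ∀ c : ℂ, IsTest Ω (fun x => c * (g x : ℂ)) := fun c =>
        IsTest.mul_left contDiff_const ⟨Complex.ofRealCLM.contDiff.comp hg1,
          hg2.comp_left Complex.ofReal_zero,
          (closure_mono fun x hx => by simpa using hx : _ ⊆ tsupport g).trans hg3⟩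
      have e : ∫ x, g x • v x = ∫ x in Ω, v x * (1 * (g x : ℂ)) := by
        rw [(ht 1).setIntegral_mul_eq]
        congr 1 with x
        rw [Complex.real_smul]; ring
      rw [e]
      refine Complex.ext (key (ht 1)) ?_
      have h2 := key (ht Complex.I)
      have e2 : ∫ x in Ω, v x * (Complex.I * (g x : ℂ))
          = Complex.I * ∫ x in Ω, v x * (1 * (g x : ℂ)) := by
        rw [← integral_const_mul]
        congr 1 with x
        ring
      rw [e2, Complex.I_mul_re, neg_eq_zero] at h2
      simpa using h2
    refine Lp.ext ?_
    filter_upwards [(ae_restrict_iff' hΩ.measurableSet).2 hae, Lp.coeFn_zero ℂ 2 (volume.restrict Ω)]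
      with x h1 h2
    rw [h1, h2]; rfl
  rw [← Submodule.topologicalClosure_eq_top_iff, ← Submodule.dense_iff_topologicalClosure_eq_top]
    at h
  exact h

end

section

/-! ### The nonlinearity -/

theorem norm_nonlin {m : ℝ} (hm : 0 < m) (z : ℂ) : ‖nonlin m z‖ = ‖z‖ ^ m := by
  rw [nonlin, norm_mul, Complex.norm_real, Real.norm_of_nonneg (by positivity)]
  rcases (norm_nonneg z).eq_or_lt with h | h
  · rw [← h, mul_zero, Real.zero_rpow hm.ne']
  · rw [← Real.rpow_add_one h.ne']
    congr 1; ring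

theorem nonlin_mul_conj {m : ℝ} (hm : 0 < m) (z : ℂ) :
    nonlin m z * conj z = ((‖z‖ ^ (m + 1) : ℝ) : ℂ) := by
  rw [nonlin, mul_assoc, Complex.mul_conj, ← Complex.ofReal_mul, Complex.normSq_eq_norm_sq]
  congr 1
  rcases (norm_nonneg z).eq_or_lt with h | h
  · rw [← h, Real.zero_rpow (add_pos hm one_pos).ne']; simp
  · rw [← Real.rpow_natCast, ← Real.rpow_add h]
    congr 1; push_cast; ring

/-- With `‖w‖ ≤ ‖z‖`, freezing the weight at the larger modulus leaves two terms, each at most `‖z‖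
^ (m - 1) * ‖z - w‖`. Since `‖z - w‖ ≤ 2 * ‖z‖`, this is at most `2 * ‖z - w‖ ^ m`. -/
theorem norm_nonlin_sub_le {m : ℝ} (hm0 : 0 < m) (hm1 : m ≤ 1) (z w : ℂ) :
    ‖nonlin m z - nonlin m w‖ ≤ 4 * ‖z - w‖ ^ m := by
  wlog h : ‖w‖ ≤ ‖z‖ generalizing z w
  · rw [norm_sub_rev, norm_sub_rev z]
    exact this w z (le_of_not_ge h)
  rcases (norm_nonneg z).eq_or_lt with hz | hz
  · have h1 : z = 0 := norm_eq_zero.1 hz.symm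
    have h2 : w = 0 := norm_eq_zero.1 (le_antisymm (h.trans hz.symm.le) (norm_nonneg _))
    rw [h1, h2, sub_self, norm_zero]; positivity
  set d := ‖z - w‖ with hd
  have hd0 : 0 ≤ d := norm_nonneg _
  have hdr : d ≤ 2 * ‖z‖ := (norm_sub_le _ _).trans (by linarith)
  have hrs : ‖z‖ - ‖w‖ ≤ d := norm_sub_norm_le _ _
  set r := ‖z‖ with hr
  set s := ‖w‖ with hs
  have hs0 : 0 ≤ s := norm_nonneg _
  have e : nonlin m z - nonlin m w = ((r ^ (-(1 - m)) : ℝ) : ℂ) * (z - w)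
      + ((r ^ (-(1 - m)) - s ^ (-(1 - m)) : ℝ) : ℂ) * w := by
    simp only [nonlin]; push_cast; ring
  have h1 : |r ^ (-(1 - m)) - s ^ (-(1 - m))| * s ≤ r ^ (-(1 - m)) * d := by
    rcases hs0.eq_or_lt with h0 | h0
    · rw [← h0, mul_zero]; positivity
    · have hle : r ^ (-(1 - m)) ≤ s ^ (-(1 - m)) :=
        Real.rpow_le_rpow_of_nonpos h0 h (by linarith)
      rw [abs_of_nonpos (by linarith), neg_sub, sub_mul]
      have e1 : s ^ (-(1 - m)) * s = s ^ m := by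
        rw [← Real.rpow_add_one h0.ne']; congr 1; ring
      have e2 : r ^ (-(1 - m)) * r = r ^ m := by
        rw [← Real.rpow_add_one hz.ne']; congr 1; ring
      have e3 : s ^ m ≤ r ^ m := Real.rpow_le_rpow hs0 h hm0.le
      have e4 : r ^ (-(1 - m)) * (r - s) ≤ r ^ (-(1 - m)) * d := by gcongr
      rw [e1]
      linarith
  have h2 : r ^ (-(1 - m)) * d ≤ 2 * d ^ m := by
    rcases hd0.eq_or_lt with h0 | h0
    · rw [← h0, mul_zero]; positivity
    · have e1 : d = d ^ m * d ^ (1 - m) := by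
        rw [← Real.rpow_add h0]; simp
      have e2 : d ^ (1 - m) ≤ 2 * r ^ (1 - m) := by
        refine (Real.rpow_le_rpow hd0 hdr (by linarith)).trans ?_
        rw [Real.mul_rpow zero_le_two hz.le]
        gcongr
        calc (2 : ℝ) ^ (1 - m) ≤ 2 ^ (1 : ℝ) :=
              Real.rpow_le_rpow_of_exponent_le one_le_two (by linarith)
          _ = 2 := Real.rpow_one 2
      have e3 : r ^ (-(1 - m)) * r ^ (1 - m) = 1 := by
        rw [← Real.rpow_add hz]; simp
      calc r ^ (-(1 - m)) * d = r ^ (-(1 - m)) * (d ^ m * d ^ (1 - m)) := by rw [← e1]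
        _ ≤ r ^ (-(1 - m)) * (d ^ m * (2 * r ^ (1 - m))) := by gcongr
        _ = 2 * d ^ m * (r ^ (-(1 - m)) * r ^ (1 - m)) := by ring
        _ = 2 * d ^ m := by rw [e3, mul_one]
  rw [e]
  refine (norm_add_le _ _).trans ?_
  rw [norm_mul, norm_mul, Complex.norm_real, Complex.norm_real, Real.norm_eq_abs, Real.norm_eq_abs,
    abs_of_nonneg (by positivity : (0 : ℝ) ≤ r ^ (-(1 - m)))]
  linarith

theorem continuous_nonlin {m : ℝ} (hm0 : 0 < m) (hm1 : m ≤ 1) : Continuous (nonlin m) := by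
  refine continuous_iff_continuousAt.2 fun z => ?_
  rw [ContinuousAt, tendsto_iff_norm_sub_tendsto_zero]
  have hc : Continuous fun w : ℂ => 4 * ‖w - z‖ ^ m :=
    ((by fun_prop : Continuous fun w : ℂ => ‖w - z‖).rpow_const fun _ => Or.inr hm0.le).const_mul 4
  have h := hc.tendsto z
  rw [sub_self, norm_zero, Real.zero_rpow hm0.ne', mul_zero] at h
  exact squeeze_zero (fun _ => norm_nonneg _) (fun w => norm_nonlin_sub_le hm0 hm1 w z) h

/-- One of the two terms suffices according to whether `s ≤ d`. Against a bounded integrable test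
function the constant is integrable and the square is controlled by the `L²` norm, so the sublinear
power needs no `L^m` bound on `Ω`. -/
theorem rpow_le_interpolation {m s d : ℝ} (hm0 : 0 < m) (hm1 : m ≤ 1) (hs : 0 ≤ s) (hd : 0 < d) :
    s ^ m ≤ d ^ m + d ^ (m - 2) * s ^ 2 := by
  rcases le_total s d with h | h
  · have := Real.rpow_le_rpow hs h hm0.le
    have : 0 ≤ d ^ (m - 2) * s ^ 2 := by positivity
    linarith
  · have hs' : 0 < s := hd.trans_le h
    have e : s ^ m = s ^ (m - 2) * s ^ 2 := by
      rw [← Real.rpow_natCast, ← Real.rpow_add hs']; congr 1; push_cast; ring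
    have h1 : s ^ (m - 2) ≤ d ^ (m - 2) := Real.rpow_le_rpow_of_nonpos hd h (by linarith)
    have h2 : s ^ (m - 2) * s ^ 2 ≤ d ^ (m - 2) * s ^ 2 := by gcongr
    have : 0 ≤ d ^ m := by positivity
    linarith

section Nemytskii

variable {N : ℕ} {Ω : Set (EuclideanSpace ℝ (Fin N))}

theorem norm_sq_eq_integral (w : LpSp Ω 2) : ‖w‖ ^ 2 = ∫ x in Ω, ‖w x‖ ^ 2 := by
  rw [← real_inner_self_eq_norm_sq, L2.inner_def]
  simp only [real_inner_self_eq_norm_sq]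

theorem integrable_norm_sq (w : LpSp Ω 2) :
    Integrable (fun x => ‖w x‖ ^ 2) (volume.restrict Ω) :=
  (memLp_two_iff_integrable_sq_norm (Lp.memLp w).1).1 (Lp.memLp w)

theorem IsTest.integrable_nonlin_mul {m : ℝ} (hm0 : 0 < m) (hm1 : m ≤ 1)
    {φ : EuclideanSpace ℝ (Fin N) → ℂ} (hφ : IsTest Ω φ) (w : LpSp Ω 2) :
    Integrable (fun x => nonlin m (w x) * φ x) (volume.restrict Ω) := by
  obtain ⟨M, hM⟩ := hφ.2.1.exists_bound_of_continuous hφ.continuous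
  have hφ1 : Integrable (fun x => ‖φ x‖) (volume.restrict Ω) :=
    (memLp_one_iff_integrable.1 (hφ.memLp 1)).norm
  refine (hφ1.add ((integrable_norm_sq w).const_mul M)).mono'
    (((continuous_nonlin hm0 hm1).comp_aestronglyMeasurable (Lp.aestronglyMeasurable w)).mul
      (hφ.memLp 1).1) (ae_of_all _ fun x => ?_)
  rw [norm_mul, norm_nonlin hm0]
  have h1 := rpow_le_interpolation hm0 hm1 (norm_nonneg (w x)) one_pos
  rw [Real.one_rpow, Real.one_rpow, one_mul] at h1
  have h2 := norm_nonneg (φ x)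
  have h3 : ‖w x‖ ^ 2 * ‖φ x‖ ≤ ‖w x‖ ^ 2 * M := by gcongr; exact hM x
  have h4 := mul_le_mul_of_nonneg_right h1 h2
  simp only [Pi.add_apply]
  linarith

/-- Interpolating at the level `d = ‖w - w'‖` balances the two terms, because `d ^ (m - 2) * d ^ 2 =
d ^ m`. -/
theorem IsTest.exists_nonlin_holder {m : ℝ} (hm0 : 0 < m) (hm1 : m ≤ 1)
    {φ : EuclideanSpace ℝ (Fin N) → ℂ} (hφ : IsTest Ω φ) :
    ∃ C : ℝ, 0 ≤ C ∧ ∀ w w' : LpSp Ω 2,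
      ‖(∫ x in Ω, nonlin m (w x) * φ x) - ∫ x in Ω, nonlin m (w' x) * φ x‖ ≤ C * ‖w - w'‖ ^ m := by
  obtain ⟨M, hM⟩ := hφ.2.1.exists_bound_of_continuous hφ.continuous
  have hM0 : 0 ≤ M := (norm_nonneg _).trans (hM 0)
  have hφ1 : Integrable (fun x => ‖φ x‖) (volume.restrict Ω) :=
    (memLp_one_iff_integrable.1 (hφ.memLp 1)).norm
  have hA : 0 ≤ ∫ x in Ω, ‖φ x‖ := integral_nonneg fun _ => norm_nonneg _
  refine ⟨4 * ((∫ x in Ω, ‖φ x‖) + M), by positivity, fun w w' => ?_⟩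
  rcases (norm_nonneg (w - w')).eq_or_lt with h0 | h0
  · have : w = w' := sub_eq_zero.1 (norm_eq_zero.1 h0.symm)
    rw [this, sub_self, sub_self, norm_zero, norm_zero]; positivity
  set d := ‖w - w'‖ with hd
  rw [← integral_sub (hφ.integrable_nonlin_mul hm0 hm1 w) (hφ.integrable_nonlin_mul hm0 hm1 w')]
  have hdom : Integrable (fun x => 4 * (d ^ m * ‖φ x‖ + M * d ^ (m - 2) * ‖(w - w') x‖ ^ 2))
      (volume.restrict Ω) :=
    ((hφ1.const_mul _).add ((integrable_norm_sq (w - w')).const_mul _)).const_mul 4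
  refine (norm_integral_le_of_norm_le hdom ?_).trans (le_of_eq ?_)
  · filter_upwards [Lp.coeFn_sub w w'] with x hx
    rw [hx, Pi.sub_apply, ← sub_mul, norm_mul]
    have h1 := norm_nonlin_sub_le hm0 hm1 (w x) (w' x)
    have h2 := rpow_le_interpolation hm0 hm1 (norm_nonneg (w x - w' x)) h0
    have h3 := norm_nonneg (φ x)
    calc _ ≤ 4 * (d ^ m + d ^ (m - 2) * ‖w x - w' x‖ ^ 2) * ‖φ x‖ := by
          gcongr; linarith
      _ = 4 * (d ^ m * ‖φ x‖ + (d ^ (m - 2) * ‖w x - w' x‖ ^ 2) * ‖φ x‖) := by ring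
      _ ≤ 4 * (d ^ m * ‖φ x‖ + (d ^ (m - 2) * ‖w x - w' x‖ ^ 2) * M) := by gcongr; exact hM x
      _ = _ := by ring
  · rw [integral_const_mul, integral_add (hφ1.const_mul _)
      ((integrable_norm_sq (w - w')).const_mul _), integral_const_mul, integral_const_mul,
      ← norm_sq_eq_integral, ← hd]
    have : d ^ (m - 2) * d ^ 2 = d ^ m := by
      rw [← Real.rpow_natCast, ← Real.rpow_add h0]; congr 1; push_cast; ring
    linear_combination 4 * M * this

theorem IsTest.continuous_nonlin_integral {m : ℝ} (hm0 : 0 < m) (hm1 : m ≤ 1)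
    {φ : EuclideanSpace ℝ (Fin N) → ℂ} (hφ : IsTest Ω φ) :
    Continuous fun w : LpSp Ω 2 => ∫ x in Ω, nonlin m (w x) * φ x := by
  obtain ⟨C, -, hC⟩ := hφ.exists_nonlin_holder hm0 hm1
  refine continuous_iff_continuousAt.2 fun z => ?_
  rw [ContinuousAt, tendsto_iff_norm_sub_tendsto_zero]
  have hc : Continuous fun w : LpSp Ω 2 => C * ‖w - z‖ ^ m :=
    ((by fun_prop : Continuous fun w : LpSp Ω 2 => ‖w - z‖).rpow_const
      fun _ => Or.inr hm0.le).const_mul C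
  have h := hc.tendsto z
  rw [sub_self, norm_zero, Real.zero_rpow hm0.ne', mul_zero] at h
  exact squeeze_zero (fun _ => norm_nonneg _) (fun w => hC w z) h

end Nemytskii

end

section

/-! ### Locally integrable functions of time -/

section Time

variable {E F : Type*} [NormedAddCommGroup E] [NormedAddCommGroup F]

theorem MemLpLoc.mono_exponent {w : ℝ → E} {p q : ℝ≥0∞} (hw : MemLpLoc w q) (hpq : p ≤ q) :
    MemLpLoc w p := fun T hT => (hw T hT).mono_exponent hpq

theorem MemLpLoc.congr_ae {w w' : ℝ → E} {p : ℝ≥0∞} (hw : MemLpLoc w p)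
    (h : ∀ᵐ t ∂(volume.restrict (Ioi (0 : ℝ))), w t = w' t) : MemLpLoc w' p := fun T hT =>
  (hw T hT).ae_eq (ae_restrict_of_ae_restrict_of_subset Ioo_subset_Ioi_self h)

theorem MemLpLoc.clm [NormedSpace ℝ E] [NormedSpace ℝ F] {w : ℝ → E} {p : ℝ≥0∞}
    (hw : MemLpLoc w p) (L : E →L[ℝ] F) : MemLpLoc (fun t => L (w t)) p := fun T hT =>
  L.comp_memLp' (hw T hT)

theorem MemLpLoc.integrableOn {w : ℝ → E} (hw : MemLpLoc w 1) {T : ℝ} (hT : 0 < T) :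
    IntegrableOn w (Ioo 0 T) := memLp_one_iff_integrable.1 (hw T hT)

theorem MemLpLoc.intervalIntegrable {w : ℝ → E} (hw : MemLpLoc w 1) {s t : ℝ} (hs : 0 ≤ s)
    (hst : s ≤ t) : IntervalIntegrable w volume s t := by
  rw [intervalIntegrable_iff_integrableOn_Ioo_of_le hst]
  exact (hw.integrableOn (hs.trans_lt (hst.trans_lt (lt_add_one t)))).mono_set
    (Ioo_subset_Ioo hs (by linarith))

theorem MemLpLoc.locallyIntegrableOn {w : ℝ → E} (hw : MemLpLoc w 1) :
    LocallyIntegrableOn w (Ioi (0 : ℝ)) := by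
  rw [locallyIntegrableOn_iff isOpen_Ioi.isLocallyClosed]
  intro k hk hkc
  obtain ⟨T, hT⟩ := hkc.isBounded.subset_closedBall 0
  refine (hw.integrableOn (T := |T| + 1) (by positivity)).mono_set fun x hx => ⟨hk hx, ?_⟩
  have := hT hx
  rw [mem_closedBall_zero_iff, Real.norm_eq_abs] at this
  linarith [le_abs_self x, le_abs_self T]

theorem MemLpLoc.integrableOn_mul {w : ℝ → ℂ} (hw : MemLpLoc w 1) {θ : ℝ → ℝ}
    (hθ : Continuous θ) (hθc : HasCompactSupport θ) :
    IntegrableOn (fun t => (θ t : ℂ) * w t) (Ioi 0) := by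
  obtain ⟨T, hT⟩ := hθc.isCompact.isBounded.subset_closedBall 0
  obtain ⟨C, hC⟩ := hθc.exists_bound_of_continuous hθ
  have h : IntegrableOn (fun t => (θ t : ℂ) * w t) (Ioo 0 (|T| + 1)) :=
    (hw.integrableOn (by positivity)).bdd_mul
      (Complex.continuous_ofReal.comp hθ).aestronglyMeasurable
      (Eventually.of_forall fun t => by rw [Complex.norm_real]; exact hC t)
  refine h.of_forall_sdiff_eq_zero measurableSet_Ioi fun t ht => ?_
  rw [image_eq_zero_of_notMem_tsupport (f := θ) ?_, Complex.ofReal_zero, zero_mul]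
  intro h'
  have := hT h'
  rw [mem_closedBall_zero_iff, Real.norm_eq_abs] at this
  exact ht.2 ⟨ht.1, by linarith [le_abs_self t, le_abs_self T]⟩

end Time

/-- Here `y` is absolutely continuous with derivative `b`; integration by parts turns the hypothesis
into `∫ θ (b - R) = 0` for every test function `θ` on `(0, ∞)`. -/
theorem ae_eq_of_weak_derivative {y b R : ℝ → ℝ} (hb : MemLpLoc b 1) (hR : MemLpLoc R 1)
    (hy : ∀ s t : ℝ, 0 ≤ s → s ≤ t → y t = y s + ∫ σ in s..t, b σ)
    (h : ∀ θ : ℝ → ℝ, ContDiff ℝ ∞ θ → HasCompactSupport θ → tsupport θ ⊆ Ioi 0 →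
      ∫ t in Ioi (0 : ℝ), (deriv θ t * y t + θ t * R t) = 0) :
    ∀ᵐ t ∂(volume.restrict (Ioi (0 : ℝ))), b t = R t := by
  have hbR : MemLpLoc (fun t => b t - R t) 1 := fun T hT => (hb T hT).sub (hR T hT)
  have key := IsOpen.ae_eq_zero_of_integral_contDiff_smul_eq_zero (μ := volume) isOpen_Ioi
    hbR.locallyIntegrableOn fun θ hθ hθc hθs => by
    obtain ⟨T', hT'⟩ := hθc.isCompact.isBounded.subset_closedBall 0
    -- The `+ 1` puts `T` strictly beyond the support of `θ`, so the boundary term at `T` vanishes.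
    set T : ℝ := |T'| + 1 with hTdef
    have hT0 : 0 < T := by positivity
    have hsupp : ∀ t, t ∉ Ioc 0 T → t ∉ tsupport θ := by
      intro t ht h'
      have h1 := hT' h'
      rw [mem_closedBall_zero_iff, Real.norm_eq_abs] at h1
      exact ht ⟨hθs h', by linarith [le_abs_self t, le_abs_self T']⟩
    have hz : ∀ t, t ∉ Ioc 0 T → θ t = 0 := fun t ht =>
      image_eq_zero_of_notMem_tsupport (hsupp t ht)
    have hz' : ∀ t, t ∉ Ioc 0 T → deriv θ t = 0 := fun t ht =>
      image_eq_zero_of_notMem_tsupport fun h' => hsupp t ht (tsupport_deriv_subset h')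
    have hsub : Ioc 0 T ⊆ Ioi (0 : ℝ) := Ioc_subset_Ioi_self
    have hθT : θ T = 0 := by
      refine image_eq_zero_of_notMem_tsupport fun h' => ?_
      have h1 := hT' h'
      rw [mem_closedBall_zero_iff, Real.norm_eq_abs] at h1
      linarith [le_abs_self T, le_abs_self T']
    have hθ0 : θ 0 = 0 := hz 0 (by simp)
    have h1 := h θ hθ hθc hθs
    rw [setIntegral_eq_of_subset_of_forall_sdiff_eq_zero measurableSet_Ioi hsub
      (fun t ht => by rw [hz t ht.2, hz' t ht.2]; simp)] at h1
    rw [← setIntegral_eq_integral_of_forall_compl_eq_zero (s := Ioc 0 T)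
      (fun t ht => by rw [hz t ht, zero_smul])]
    rw [← intervalIntegral.integral_of_le hT0.le] at h1 ⊢
    have hbi := hb.intervalIntegrable le_rfl hT0.le
    have hRi := hR.intervalIntegrable le_rfl hT0.le
    have hYd : ∀ᵐ t, t ∈ uIcc 0 T →
        HasDerivAt (fun x => y 0 + ∫ σ in (0:ℝ)..x, b σ) (b t) t := by
      filter_upwards [hbi.ae_hasDerivAt_integral] with t ht htm
      exact (ht htm 0 left_mem_uIcc).const_add _
    have hY : AbsolutelyContinuousOnInterval (fun x => y 0 + ∫ σ in (0:ℝ)..x, b σ) 0 T :=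
      (contDiff_const.contDiffOn.absolutelyContinuousOnInterval).add
        (hbi.absolutelyContinuousOnInterval_intervalIntegral left_mem_uIcc)
    have hpart := AbsolutelyContinuousOnInterval.integral_mul_deriv_eq_deriv_mul
      ((hθ.of_le (by simp)).contDiffOn.absolutelyContinuousOnInterval (a := 0) (b := T)) hY
    rw [hθT, hθ0, zero_mul, zero_mul, sub_zero, zero_sub] at hpart
    have e1 : ∫ x in (0:ℝ)..T, θ x * deriv (fun x => y 0 + ∫ σ in (0:ℝ)..x, b σ) x
        = ∫ x in (0:ℝ)..T, θ x * b x := by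
      refine intervalIntegral.integral_congr_ae ?_
      filter_upwards [hYd] with t ht htm
      rw [(ht (uIoc_subset_uIcc htm)).deriv]
    have e2 : ∫ x in (0:ℝ)..T, deriv θ x * (y 0 + ∫ σ in (0:ℝ)..x, b σ)
        = ∫ x in (0:ℝ)..T, deriv θ x * y x := by
      refine intervalIntegral.integral_congr fun t ht => ?_
      rw [uIcc_of_le hT0.le] at ht
      rw [← hy 0 t le_rfl ht.1]
    rw [e1, e2] at hpart
    have hyc : ContinuousOn y (uIcc 0 T) := by
      refine (hY.continuousOn).congr fun t ht => ?_
      rw [uIcc_of_le hT0.le] at ht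
      exact hy 0 t le_rfl ht.1
    have hdy : IntervalIntegrable (fun t => deriv θ t * y t) volume 0 T :=
      ((hθ.continuous_deriv (by simp)).continuousOn.mul hyc).intervalIntegrable
    rw [intervalIntegral.integral_add hdy
      (hRi.continuousOn_mul hθ.continuous.continuousOn)] at h1
    simp only [smul_eq_mul, mul_sub]
    rw [intervalIntegral.integral_sub (hbi.continuousOn_mul hθ.continuous.continuousOn)
      (hRi.continuousOn_mul hθ.continuous.continuousOn)]
    linarith
  rw [ae_restrict_iff' measurableSet_Ioi]
  filter_upwards [key] with t ht htm
  linarith [ht htm]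

/-! ### The equation tested against functions of separated variables -/

variable {N : ℕ} {Ω : Set (EuclideanSpace ℝ (Fin N))}

theorem IsTest.memLpLoc_integral {φ : EuclideanSpace ℝ (Fin N) → ℂ} (hφ : IsTest Ω φ)
    {w : ℝ → LpSp Ω 2} {p : ℝ≥0∞} (hw : MemLpLoc w p) :
    MemLpLoc (fun t => ∫ x in Ω, w t x * φ x) p := by
  simp_rw [← hφ.inner_star_toLp]
  exact hw.clm ((innerSL ℂ ((hφ.star.memLp 2).toLp _)).restrictScalars ℝ)

/-- The Hölder bound against `0` and `m ≤ 1` give at most linear growth in `‖w‖`; continuity on `L²`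
gives measurability in time. -/
theorem IsTest.memLpLoc_nonlin {m : ℝ} (hm0 : 0 < m) (hm1 : m ≤ 1)
    {φ : EuclideanSpace ℝ (Fin N) → ℂ} (hφ : IsTest Ω φ)
    {w : ℝ → LpSp Ω 2} (hw : MemLpLoc w 1) :
    MemLpLoc (fun t => ∫ x in Ω, nonlin m (w t x) * φ x) 1 := by
  obtain ⟨C, hC0, hC⟩ := hφ.exists_nonlin_holder hm0 hm1 
  have h0 : ∫ x in Ω, nonlin m ((0 : LpSp Ω 2) x) * φ x = 0 := by
    refine integral_eq_zero_of_ae ?_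
    filter_upwards [Lp.coeFn_zero ℂ 2 (volume.restrict Ω)] with x hx
    rw [hx]; simp [nonlin]
  have hb : ∀ w : LpSp Ω 2, ‖∫ x in Ω, nonlin m (w x) * φ x‖ ≤ C * (1 + ‖w‖) := by
    intro w
    have h1 := hC w 0
    rw [h0, sub_zero, sub_zero] at h1
    refine h1.trans (mul_le_mul_of_nonneg_left ?_ hC0)
    rcases le_total ‖w‖ 1 with h | h
    · exact (Real.rpow_le_one (norm_nonneg _) h hm0.le).trans (by linarith [norm_nonneg w])
    · exact (Real.rpow_le_rpow_of_exponent_le h hm1).trans (by rw [Real.rpow_one]; linarith)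
  intro T hT
  have h1 : MemLp (fun t => C * (1 + ‖w t‖)) 1 (volume.restrict (Ioo 0 T)) :=
    ((memLp_const (1 : ℝ)).add (hw T hT).norm).const_mul C
  refine h1.of_le ?_ (Eventually.of_forall fun t => ?_)
  · exact (hφ.continuous_nonlin_integral hm0 hm1).comp_aestronglyMeasurable (hw T hT).1
  · exact (hb _).trans (le_abs_self _)

theorem IsTest.ofReal_mul {θ : ℝ → ℝ} (hθ : ContDiff ℝ ∞ θ) (hθc : HasCompactSupport θ)
    (hθs : tsupport θ ⊆ Ioi 0) {φ : EuclideanSpace ℝ (Fin N) → ℂ} (hφ : IsTest Ω φ) (c : ℂ) :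
    IsTest (Ioi (0 : ℝ) ×ˢ Ω)
      (fun z : ℝ × EuclideanSpace ℝ (Fin N) => (c * (θ z.1 : ℂ)) * φ z.2) := by
  have hsub : tsupport (fun z : ℝ × EuclideanSpace ℝ (Fin N) => (c * (θ z.1 : ℂ)) * φ z.2)
      ⊆ tsupport θ ×ˢ tsupport φ := by
    refine closure_minimal (fun z hz => ?_) ((isClosed_tsupport θ).prod (isClosed_tsupport φ))
    rw [Function.mem_support] at hz
    refine ⟨subset_tsupport _ fun h => hz ?_, subset_tsupport _ fun h => hz ?_⟩
    · simp [h]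
    · simp [h]
  refine ⟨?_, ?_, hsub.trans (prod_mono hθs hφ.2.2)⟩
  · exact (contDiff_const.mul ((Complex.ofRealCLM.contDiff.comp hθ).comp contDiff_fst)).mul
      (hφ.1.comp contDiff_snd)
  · exact (hθc.isCompact.prod hφ.2.1.isCompact).of_isClosed_subset (isClosed_tsupport _) hsub

theorem SolvesDistrib.integral_test {m : ℝ} (hm0 : 0 < m) (hm1 : m ≤ 1) {a : ℂ}
    {f u : ℝ → LpSp Ω 2} (hu : SolvesDistrib m a f u) {θ : ℝ → ℝ} (hθ : ContDiff ℝ ∞ θ)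
    (hθc : HasCompactSupport θ) (hθs : tsupport θ ⊆ Ioi 0)
    {φ : EuclideanSpace ℝ (Fin N) → ℂ} (hφ : IsTest Ω φ) :
    ∫ t in Ioi (0 : ℝ), (-((deriv θ t : ℝ) : ℂ) * (∫ x in Ω, u t x * φ x)
        - Complex.I * (θ t : ℂ) * ((∫ x in Ω, u t x * Δ φ x)
          + a * ∫ x in Ω, nonlin m (u t x) * φ x))
      = ∫ t in Ioi (0 : ℝ), -Complex.I * (θ t : ℂ) * ∫ x in Ω, f t x * φ x := by
  -- The factor `-I` turns `I ∂ₜ` into `∂ₜ`, so `deriv θ` has a real coefficient and real parts can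
  -- later be taken term by term.
  have h := hu _ (IsTest.ofReal_mul hθ hθc hθs hφ (-Complex.I))
  convert h using 3 with t t
  · have hd : ∀ x, deriv (fun τ => -Complex.I * (θ τ : ℂ) * φ x) t
        = -Complex.I * ((deriv θ t : ℝ) : ℂ) * φ x := by
      intro x
      exact ((((hθ.differentiable (by simp)) t).hasDerivAt.ofReal_comp.const_mul _).mul_const
        _).deriv
    have hl : ∀ x, Δ (fun y => -Complex.I * (θ t : ℂ) * φ y) x
        = -Complex.I * (θ t : ℂ) * Δ φ x := by
      intro x
      exact InnerProductSpace.laplacian_smul (-Complex.I * (θ t : ℂ))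
        (hφ.1.of_le (by norm_cast)).contDiffAt
    simp only [hd, hl]
    have i1 : Integrable (fun x => u t x * φ x) (volume.restrict Ω) :=
      (Lp.memLp (u t)).integrable_mul (hφ.memLp 2)
    have i2 : Integrable (fun x => u t x * Δ φ x) (volume.restrict Ω) :=
      (Lp.memLp (u t)).integrable_mul (hφ.laplacian.memLp 2)
    have i3 := hφ.integrable_nonlin_mul hm0 hm1 (u t)
    have e : ∀ x, -(Complex.I * u t x * (-Complex.I * ((deriv θ t : ℝ) : ℂ) * φ x))
        + u t x * (-Complex.I * (θ t : ℂ) * Δ φ x)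
        + a * nonlin m (u t x) * (-Complex.I * (θ t : ℂ) * φ x)
        = -((deriv θ t : ℝ) : ℂ) * (u t x * φ x) + (-Complex.I * (θ t : ℂ)) * (u t x * Δ φ x)
          + (-Complex.I * (θ t : ℂ) * a) * (nonlin m (u t x) * φ x) := by
      intro x
      linear_combination (u t x * ((deriv θ t : ℝ) : ℂ) * φ x) * Complex.I_mul_I
    simp_rw [e]
    have i12 : Integrable (fun x => -((deriv θ t : ℝ) : ℂ) * (u t x * φ x)
        + (-Complex.I * (θ t : ℂ)) * (u t x * Δ φ x)) (volume.restrict Ω) :=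
      (i1.const_mul _).add (i2.const_mul _)
    rw [integral_add i12 (i3.const_mul _), integral_add (i1.const_mul _) (i2.const_mul _), integral_const_mul, integral_const_mul,
      integral_const_mul]
    ring
  · rw [← integral_const_mul]
    refine integral_congr_ae (Eventually.of_forall fun x => ?_)
    simp only; ring

/-- The duals are real, so only the real part of the tested trajectory has a known derivative `b`.
As `θ` is real, the real part of the tested equation is a weak equation for that same quantity. -/
theorem SolvesDistrib.ae_eq {m : ℝ} (hm0 : 0 < m) (hm1 : m ≤ 1) {a : ℂ}
    {f u : ℝ → LpSp Ω 2} (hu : SolvesDistrib m a f u) (hf : MemLpLoc f 1) (hu1 : MemLpLoc u 1)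
    {φ : EuclideanSpace ℝ (Fin N) → ℂ} (hφ : IsTest Ω φ) {b : ℝ → ℝ} (hb : MemLpLoc b 1)
    (hub : ∀ s t : ℝ, 0 ≤ s → s ≤ t →
      (∫ x in Ω, u t x * φ x).re = (∫ x in Ω, u s x * φ x).re + ∫ σ in s..t, b σ) :
    ∀ᵐ t ∂(volume.restrict (Ioi (0 : ℝ))), b t = (Complex.I * ((∫ x in Ω, u t x * Δ φ x)
      + (a * ∫ x in Ω, nonlin m (u t x) * φ x) - ∫ x in Ω, f t x * φ x)).re := by
  have hA := hφ.memLpLoc_integral hu1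
  have hB := hφ.laplacian.memLpLoc_integral hu1
  have hG := hφ.memLpLoc_nonlin hm0 hm1 hu1
  have hF := hφ.memLpLoc_integral hf
  have hR : MemLpLoc (fun t => Complex.I * ((∫ x in Ω, u t x * Δ φ x)
      + (a * ∫ x in Ω, nonlin m (u t x) * φ x) - ∫ x in Ω, f t x * φ x)) 1 := fun T hT =>
    (((hB T hT).add ((hG T hT).const_mul a)).sub (hF T hT)).const_mul _
  refine ae_eq_of_weak_derivative hb (hR.clm Complex.reCLM) hub fun θ hθ hθc hθs => ?_
  have h := hu.integral_test hm0 hm1 hθ hθc hθs hφ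
  have i1 : IntegrableOn (fun t => ((deriv θ t : ℝ) : ℂ) * ∫ x in Ω, u t x * φ x) (Ioi 0) :=
    hA.integrableOn_mul (hθ.continuous_deriv (by simp)) hθc.deriv
  have i2 := hR.integrableOn_mul hθ.continuous hθc
  have i3 := (hF.integrableOn_mul hθ.continuous hθc).const_mul Complex.I
  have e := integral_re (𝕜 := ℂ) (i1.add i2)
  have e0 : ∫ t in Ioi (0:ℝ), ((fun t => ((deriv θ t : ℝ) : ℂ) * ∫ x in Ω, u t x * φ x) +
      (fun t => (θ t : ℂ) * (Complex.I * ((∫ x in Ω, u t x * Δ φ x)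
      + (a * ∫ x in Ω, nonlin m (u t x) * φ x) - ∫ x in Ω, f t x * φ x)))) t = 0 := by
    have e1 := integral_add ((i1.add i2).neg) i3.neg
    have e2 : ∀ t, (-((fun t => ((deriv θ t : ℝ) : ℂ) * ∫ x in Ω, u t x * φ x) +
      (fun t => (θ t : ℂ) * (Complex.I * ((∫ x in Ω, u t x * Δ φ x)
      + (a * ∫ x in Ω, nonlin m (u t x) * φ x) - ∫ x in Ω, f t x * φ x))))) t
      + (-(fun t => Complex.I * ((θ t : ℂ) * ∫ x in Ω, f t x * φ x))) t
      = (-((deriv θ t : ℝ) : ℂ) * (∫ x in Ω, u t x * φ x)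
        - Complex.I * (θ t : ℂ) * ((∫ x in Ω, u t x * Δ φ x)
          + a * ∫ x in Ω, nonlin m (u t x) * φ x)) := by
      intro t
      simp only [Pi.add_apply, Pi.neg_apply]; ring
    have e3 : ∫ t in Ioi (0:ℝ), (-(fun t => Complex.I * ((θ t : ℂ) * ∫ x in Ω, f t x * φ x))) t
        = ∫ t in Ioi (0 : ℝ), -Complex.I * (θ t : ℂ) * ∫ x in Ω, f t x * φ x := by
      refine integral_congr_ae (Eventually.of_forall fun t => ?_)
      simp only [Pi.neg_apply]; ring
    have e4 : ∫ t in Ioi (0:ℝ), (-((fun t => ((deriv θ t : ℝ) : ℂ) * ∫ x in Ω, u t x * φ x) +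
      (fun t => (θ t : ℂ) * (Complex.I * ((∫ x in Ω, u t x * Δ φ x)
      + (a * ∫ x in Ω, nonlin m (u t x) * φ x) - ∫ x in Ω, f t x * φ x))))) t
      = -∫ t in Ioi (0:ℝ), ((fun t => ((deriv θ t : ℝ) : ℂ) * ∫ x in Ω, u t x * φ x) +
      (fun t => (θ t : ℂ) * (Complex.I * ((∫ x in Ω, u t x * Δ φ x)
      + (a * ∫ x in Ω, nonlin m (u t x) * φ x) - ∫ x in Ω, f t x * φ x)))) t := by
      rw [← integral_neg]; rfl
    simp_rw [e2] at e1
    rw [h, e3, e4] at e1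
    linear_combination e1
  rw [e0] at e
  simp only [map_zero] at e
  refine Eq.trans ?_ e
  refine integral_congr_ae (Eventually.of_forall fun t => ?_)
  simp only [Pi.add_apply, RCLike.re_eq_complex_re, Complex.add_re, Complex.re_ofReal_mul]

end

section

variable {N : ℕ} {Ω : Set (EuclideanSpace ℝ (Fin N))}
variable {H : Type*} [NormedAddCommGroup H] [NormedSpace ℝ H]

/-! ### Separability -/

instance secondCountable_lpSp (p : ℝ≥0∞) [Fact (1 ≤ p)] [Fact (p ≠ ⊤)] :
    SecondCountableTopology (LpSp Ω p) := Lp.SecondCountableTopology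

instance fact_expo_ne_top (m : ℝ) : Fact (expo m ≠ ⊤) := ⟨by simp [expo]⟩

instance secondCountable_H10 : SecondCountableTopology (H10 Ω) :=
  haveI : Fact ((2 : ℝ≥0∞) ≠ ⊤) := ⟨by simp⟩
  inferInstanceAs (SecondCountableTopology (H10Sub Ω))

instance secondCountable_inter (j : H →L[ℝ] LpSp Ω 2) (p : ℝ≥0∞) [Fact (1 ≤ p)] [Fact (p ≠ ⊤)]
    [SecondCountableTopology H] : SecondCountableTopology (Inter j p) :=
  inferInstanceAs (SecondCountableTopology (interSub j p))

/-- Countability lets the exceptional null sets of times, one per test function, be merged into a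
single null set. -/
theorem exists_countable_denseRange_toInter {p : ℝ≥0∞} [Fact (1 ≤ p)] [Fact (p ≠ ⊤)]
    (hp : p ≤ 2) :
    ∃ S : Set {φ : EuclideanSpace ℝ (Fin N) → ℂ // IsTest Ω φ}, S.Countable ∧
      Dense ((fun φ : {φ : EuclideanSpace ℝ (Fin N) → ℂ // IsTest Ω φ} => φ.2.toInter p) '' S) := by
  obtain ⟨t, ht, htc, htd⟩ := Dense.exists_countable_dense_subset
    (Inter.denseRange_toInter (Ω := Ω) hp)
  have : Nonempty {φ : EuclideanSpace ℝ (Fin N) → ℂ // IsTest Ω φ} := ⟨⟨_, IsTest.zero⟩⟩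
  choose! g hg using ht
  refine ⟨g '' t, htc.image g, ?_⟩
  convert htd
  rw [image_image]
  exact (image_congr hg).trans (image_id t)

/-! ### The pairing of the equation with the solution -/

theorem inner_eq_integral (v w : LpSp Ω 2) : inner ℂ v w = ∫ x in Ω, w x * conj (v x) :=
  L2.inner_def v w

theorem expo_toReal {m : ℝ} (hm : 0 ≤ m) : (expo m).toReal = m + 1 := by
  rw [expo_eq hm, ENNReal.toReal_ofReal (by positivity)]

theorem expo_ne_zero (m : ℝ) : expo m ≠ 0 :=
  (zero_lt_one.trans_le (fact_one_le_expo m).out).ne'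

theorem expo_le_two {m : ℝ} (hm0 : 0 ≤ m) (hm1 : m ≤ 1) : expo m ≤ 2 := by
  rw [expo_eq hm0]
  exact (ENNReal.ofReal_le_ofReal (by linarith : m + 1 ≤ 2)).trans (by simp)

theorem holderConjugate {m : ℝ} (hm : 0 < m) : (m + 1).HolderConjugate ((m + 1) / m) := by
  refine Real.holderConjugate_iff.2 ⟨by linarith, ?_⟩
  field_simp
  ring

theorem toReal_eLpNorm_rpow {m : ℝ} (hm : 0 < m) {w : EuclideanSpace ℝ (Fin N) → ℂ}
    (hw : MemLp w (expo m) (volume.restrict Ω)) :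
    (eLpNorm w (expo m) (volume.restrict Ω)).toReal ^ (m + 1) = ∫ x in Ω, ‖w x‖ ^ (m + 1) := by
  have h0 : 0 ≤ ∫ x in Ω, ‖w x‖ ^ (m + 1) := integral_nonneg fun x => by positivity
  rw [hw.eLpNorm_eq_integral_rpow_norm (expo_ne_zero m) (Fact.out), expo_toReal hm.le,
    ENNReal.toReal_ofReal (Real.rpow_nonneg h0 _), ← Real.rpow_mul h0,
    inv_mul_cancel₀ (by positivity), Real.rpow_one]

theorem memLp_nonlin {m : ℝ} (hm0 : 0 < m) (hm1 : m ≤ 1) {w : EuclideanSpace ℝ (Fin N) → ℂ}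
    (hw : MemLp w (expo m) (volume.restrict Ω)) :
    MemLp (fun x => nonlin m (w x)) (ENNReal.ofReal ((m + 1) / m)) (volume.restrict Ω) := by
  have h := hw.norm_rpow_div (ENNReal.ofReal m)
  rw [expo_eq hm0.le, ← ENNReal.ofReal_div_of_pos hm0, ENNReal.toReal_ofReal hm0.le] at h
  refine h.of_le ((continuous_nonlin hm0 hm1).comp_aestronglyMeasurable hw.1)
    (Eventually.of_forall fun x => ?_)
  rw [norm_nonlin hm0]
  exact le_abs_self _

theorem continuous_integral_mul_conj {m : ℝ} (hm : 0 < m) {g : EuclideanSpace ℝ (Fin N) → ℂ}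
    (hg : MemLp g (ENNReal.ofReal ((m + 1) / m)) (volume.restrict Ω)) :
    Continuous fun w : LpSp Ω (expo m) => ∫ x in Ω, g x * conj (w x) := by
  have h1 : ENNReal.HolderConjugate (ENNReal.ofReal ((m + 1) / m)) (expo m) := by
    rw [expo_eq hm.le]
    exact (holderConjugate hm).symm.ennrealOfReal
  have h2 : Fact (1 ≤ ENNReal.ofReal ((m + 1) / m)) :=
    ⟨ENNReal.one_le_ofReal.2 (holderConjugate hm).symm.lt.le⟩
  let B : ℂ →L[ℝ] ℂ →L[ℝ] ℂ :=
    (ContinuousLinearMap.mul ℝ ℂ).flip.comp (Complex.conjCLE : ℂ →L[ℝ] ℂ) |>.flip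
  have e : (fun w : LpSp Ω (expo m) => ∫ x in Ω, g x * conj (w x))
      = fun w => (ContinuousLinearMap.lpPairing (volume.restrict Ω)
        (ENNReal.ofReal ((m + 1) / m)) (expo m) B) (hg.toLp g) w := by
    ext w
    rw [ContinuousLinearMap.lpPairing_eq_integral]
    refine integral_congr_ae ?_
    filter_upwards [hg.coeFn_toLp] with x hx
    simp [B, hx, mul_comm]
  rw [e]
  exact ContinuousLinearMap.continuous _

/-- Both sides of `hV` extend continuously from the dense family to the whole intersection space,
and `U` can be inserted. There the gradient term is real and the nonlinear integral is a real power
of the norm; the real part of `I * Λ` is minus the imaginary part of `Λ`. -/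
theorem pairing_eq {m : ℝ} (hm0 : 0 < m) (hm1 : m ≤ 1) {a : ℂ}
    {S : Set {φ : EuclideanSpace ℝ (Fin N) → ℂ // IsTest Ω φ}}
    (hS : Dense ((fun φ : {φ : EuclideanSpace ℝ (Fin N) → ℂ // IsTest Ω φ} =>
      φ.2.toInter (expo m)) '' S))
    (U : Inter (H10.toL2 Ω) (expo m)) (F : LpSp Ω 2)
    (V : StrongDual ℝ (Inter (H10.toL2 Ω) (expo m)))
    (hV : ∀ φ ∈ S, V (φ.2.toInter (expo m)) = (Complex.I *
      ((∫ x in Ω, Inter.toL2 _ _ U x * Δ (fun y => conj (φ.1 y)) x)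
        + (a * ∫ x in Ω, nonlin m (Inter.toL2 _ _ U x) * conj (φ.1 x))
        - ∫ x in Ω, F x * conj (φ.1 x))).re) :
    V U = -a.im * (eLpNorm (Inter.toL2 _ _ U) (expo m) (volume.restrict Ω)).toReal ^ (m + 1)
      + (inner ℂ (Inter.toL2 _ _ U) F).im := by
  have hU : MemLp (Inter.toL2 _ _ U) (expo m) (volume.restrict Ω) :=
    (memLp_congr_ae (Inter.toL2_ae_eq U)).2 (Lp.memLp _)
  -- The distributional Laplacian is replaced by the Dirichlet form, which is continuous on `H¹₀`;
  -- conjugate exponents make the nonlinear term continuous on `L^{m+1}`.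
  let Λ : Inter (H10.toL2 Ω) (expo m) → ℂ := fun x =>
    -(∑ i, inner ℂ (H10.grad Ω (Inter.toH _ _ x) i) (H10.grad Ω (Inter.toH _ _ U) i))
    + (a * ∫ y in Ω, nonlin m (Inter.toL2 _ _ U y) * conj (Inter.toLp _ _ x y))
    - inner ℂ (Inter.toL2 _ _ x) F
  have hΛ : Continuous Λ := by
    refine ((continuous_finsetSum _ fun i _ => Continuous.inner ?_ continuous_const).neg.add
      (continuous_const.mul ((continuous_integral_mul_conj hm0 (memLp_nonlin hm0 hm1 hU)).comp
        (Inter.toLp _ _).continuous))).sub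
      ((Inter.toL2 _ _).continuous.inner continuous_const)
    exact (continuous_apply i).comp ((H10.grad Ω).continuous.comp (Inter.toH _ _).continuous)
  have hVΛ : (fun x => V x) = fun x => (Complex.I * Λ x).re := by
    refine Continuous.ext_on hS V.continuous
      (Complex.continuous_re.comp (continuous_const.mul hΛ)) ?_
    rintro _ ⟨φ, hφ, rfl⟩
    refine (hV φ hφ).trans ?_
    have e1 : ∫ x in Ω, Inter.toL2 _ _ U x * Δ (fun y => conj (φ.1 y)) x
        = -(∑ i, inner ℂ (H10.grad Ω (Inter.toH _ _ (φ.2.toInter (expo m))) i)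
          (H10.grad Ω (Inter.toH _ _ U) i)) := by
      refine (H10.integral_mul_laplacian (Inter.toH _ _ U) φ.2.star).trans ?_
      congr 1
      refine Finset.sum_congr rfl fun i _ => ?_
      rw [inner_eq_integral, φ.2.toH_toInter, φ.2.grad_toH10]
      refine integral_congr_ae ?_
      filter_upwards [((φ.2.pderiv i).memLp 2).coeFn_toLp] with x hx
      rw [hx, pderiv_conj φ.2]
    have e2 : ∫ x in Ω, nonlin m (Inter.toL2 _ _ U x) * conj (φ.1 x)
        = ∫ x in Ω, nonlin m (Inter.toL2 _ _ U x)
          * conj (Inter.toLp _ _ (φ.2.toInter (expo m)) x) := by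
      refine integral_congr_ae ?_
      filter_upwards [(φ.2.memLp (expo m)).coeFn_toLp] with x hx
      rw [φ.2.toLp_toInter, hx]
    have e3 : ∫ x in Ω, F x * conj (φ.1 x)
        = inner ℂ (Inter.toL2 _ _ (φ.2.toInter (expo m))) F := by
      rw [inner_eq_integral]
      refine integral_congr_ae ?_
      filter_upwards [(φ.2.memLp 2).coeFn_toLp] with x hx
      rw [φ.2.toL2_toInter, hx]
    rw [e1, e2, e3]
  have hn : ∫ y in Ω, nonlin m (Inter.toL2 _ _ U y) * conj (Inter.toLp _ _ U y)
      = (((eLpNorm (Inter.toL2 _ _ U) (expo m) (volume.restrict Ω)).toReal ^ (m + 1) : ℝ) : ℂ) := by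
    rw [toReal_eLpNorm_rpow hm0 hU, ← integral_complex_ofReal]
    refine integral_congr_ae ?_
    filter_upwards [Inter.toL2_ae_eq U] with x hx
    rw [← hx, nonlin_mul_conj hm0]
  have hg : (∑ i, inner ℂ (H10.grad Ω (Inter.toH _ _ U) i) (H10.grad Ω (Inter.toH _ _ U) i)).im
      = 0 := by
    rw [Complex.im_sum]
    exact Finset.sum_eq_zero fun i _ => inner_self_im (𝕜 := ℂ) _
  rw [congrFun hVΛ U]
  simp only [Λ, hn]
  rw [Complex.I_mul_re, Complex.sub_im, Complex.add_im, Complex.neg_im, hg, Complex.mul_im,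
    Complex.ofReal_re, Complex.ofReal_im]
  ring

/-! ### The energy identity for strong solutions -/

theorem forcing_eq_inner (f u : ℝ → LpSp Ω 2) (σ : ℝ) : forcing f u σ = inner ℂ (u σ) (f σ) :=
  (inner_eq_integral _ _).symm

theorem memLpLoc_forcing {f u : ℝ → LpSp Ω 2} (hf : MemLpLoc f 1) (hu : ContinuousOn u (Ici 0)) :
    MemLpLoc (forcing f u) 1 := by
  intro T hT
  have hcont : ContinuousOn u (Icc 0 T) := hu.mono Icc_subset_Ici_self
  obtain ⟨C, hC⟩ := isCompact_Icc.exists_bound_of_continuousOn hcont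
  refine ((hf T hT).norm.const_mul C).of_le ?_ ?_
  · simp_rw [show forcing f u = fun σ => inner ℂ (u σ) (f σ) from funext (forcing_eq_inner f u)]
    exact ((hcont.mono Ioo_subset_Icc_self).aestronglyMeasurable measurableSet_Ioo).inner (hf T hT).1
  · refine (ae_restrict_iff' measurableSet_Ioo).2 (Eventually.of_forall fun t ht => ?_)
    rw [forcing_eq_inner]
    exact (norm_inner_le_norm _ _).trans ((mul_le_mul_of_nonneg_right
      (hC t (Ioo_subset_Icc_self ht)) (norm_nonneg _)).trans (le_abs_self _))

theorem MemLpLocLp.memLpLoc_rpow {m : ℝ} (hm : 0 < m) {u : ℝ → LpSp Ω 2}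
    (hu : MemLpLocLp u (expo m)) :
    MemLpLoc (fun σ => (eLpNorm (u σ) (expo m) (volume.restrict Ω)).toReal ^ (m + 1)) 1 := by
  obtain ⟨U, hU, hUu⟩ := hu
  have h : MemLpLoc (fun σ => ‖U σ‖ ^ (m + 1)) 1 := fun T hT => by
    have := (hU T hT).integrable_norm_rpow (expo_ne_zero m) Fact.out
    rw [expo_toReal hm.le] at this
    exact memLp_one_iff_integrable.2 this
  refine h.congr_ae ?_
  filter_upwards [hUu] with t ht
  rw [Lp.norm_def, eLpNorm_congr_ae ht]

theorem IsH10Solution.energy (hΩ : IsOpen Ω) {m : ℝ} (hm0 : 0 < m) (hm1 : m ≤ 1) {a : ℂ}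
    {f u : ℝ → LpSp Ω 2} (hf : MemLpLoc f 1) (hu : IsH10Solution m a f u) :
    ContinuousOn u (Ici 0) ∧ MemLpLocLp u (expo m) ∧ ∀ s t : ℝ, 0 ≤ s → s ≤ t →
      1 / 2 * ‖u t‖ ^ 2 + a.im * damping m u s t
        = 1 / 2 * ‖u s‖ ^ 2 + (∫ σ in s..t, forcing f u σ).im := by
  obtain ⟨U, hU, hUu⟩ := hu.memLp
  obtain ⟨-, v, hv, huv⟩ := hu.memW1
  have hv1 : MemLpLoc v 1 := hv.mono_exponent
    (ENNReal.one_le_ofReal.2 (holderConjugate hm0).symm.lt.le)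
  have hu1 : MemLpLoc u 1 :=
    ((hU.mono_exponent (fact_one_le_expo m).out).clm (Inter.toL2 _ _)).congr_ae hUu
  have hU' : MemLpLoc U (ENNReal.ofReal (m + 1)) := by rwa [← expo_eq hm0.le]
  obtain ⟨hcont, hener⟩ := continuousOn_and_norm_sq_sub_eq
    (Inter.denseRange_toL2 hΩ (expo m)) (holderConjugate hm0) hU' hv hUu huv
  have hLp : MemLpLocLp u (expo m) := by
    refine ⟨fun t => Inter.toLp _ _ (U t), hU.clm _, ?_⟩
    filter_upwards [hUu] with t ht
    rw [← ht]
    exact (Inter.toL2_ae_eq (U t)).symm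
  obtain ⟨S, hSc, hSd⟩ := exists_countable_denseRange_toInter (Ω := Ω)
    (expo_le_two hm0.le hm1)
  have hpair : ∀ᵐ t ∂(volume.restrict (Ioi (0 : ℝ))), v t (U t) =
      -a.im * (eLpNorm (u t) (expo m) (volume.restrict Ω)).toReal ^ (m + 1)
        + (forcing f u t).im := by
    have h : ∀ᵐ t ∂(volume.restrict (Ioi (0 : ℝ))), ∀ φ ∈ S, v t (φ.2.toInter (expo m)) =
        (Complex.I * ((∫ x in Ω, u t x * Δ (fun y => conj (φ.1 y)) x)
        + (a * ∫ x in Ω, nonlin m (u t x) * conj (φ.1 x))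
        - ∫ x in Ω, f t x * conj (φ.1 x))).re := by
      rw [ae_ball_iff hSc]
      intro φ hφ
      -- The equation is bilinear in its test function while `toDual` pairs through a conjugate, so
      -- `conj φ` is the function to test with.
      refine hu.eqn.ae_eq hm0 hm1 hf hu1 φ.2.star (hv1.clm
        (ContinuousLinearMap.apply ℝ ℝ (φ.2.toInter (expo m)))) fun s t hs hst => ?_
      have e : ∀ τ, (∫ x in Ω, u τ x * conj (φ.1 x)).re
          = toDual (Inter.toL2 (H10.toL2 Ω) (expo m)) (u τ) (φ.2.toInter (expo m)) := by
        intro τ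
        have e1 : ∫ x in Ω, u τ x * conj (φ.1 x) = inner ℂ ((φ.2.memLp 2).toLp _) (u τ) := by
          rw [inner_eq_integral]
          refine integral_congr_ae ?_
          filter_upwards [(φ.2.memLp 2).coeFn_toLp] with x hx
          rw [hx]
        rw [e1, re_inner_eq, real_inner_comm]
        rfl
      rw [e, e]
      refine (DFunLike.congr_fun (huv s t hs hst) (φ.2.toInter (expo m))).trans ?_
      rw [add_apply, ContinuousLinearMap.intervalIntegral_apply
        (hv1.intervalIntegrable hs hst)]
    filter_upwards [h, hUu] with t ht htu
    rw [forcing_eq_inner]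
    rw [← htu] at ht ⊢
    exact pairing_eq hm0 hm1 hSd (U t) (f t) (v t) ht
  refine ⟨hcont, hLp, fun s t hs hst => ?_⟩
  have hF := (memLpLoc_forcing hf hcont).intervalIntegrable hs hst
  have hD := (hLp.memLpLoc_rpow hm0).intervalIntegrable hs hst
  have e1 : ∫ σ in s..t, v σ (U σ) = ∫ σ in s..t,
      (-a.im * (eLpNorm (u σ) (expo m) (volume.restrict Ω)).toReal ^ (m + 1)
        + Complex.imCLM (forcing f u σ)) := by
    rw [intervalIntegral.integral_of_le hst, intervalIntegral.integral_of_le hst]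
    refine integral_congr_ae (ae_restrict_of_ae_restrict_of_subset (fun x hx => ?_) hpair)
    exact hs.trans_lt hx.1
  have hFi : IntervalIntegrable (fun σ => Complex.imCLM (forcing f u σ)) volume s t :=
    ((memLpLoc_forcing hf hcont).clm Complex.imCLM).intervalIntegrable hs hst
  rw [intervalIntegral.integral_add (hD.const_mul _) hFi, intervalIntegral.integral_const_mul,
    ContinuousLinearMap.intervalIntegral_comp_comm _ hF, Complex.imCLM_apply] at e1
  have := hener s t hs hst
  rw [e1] at this
  rw [damping]
  linarith

/-! ### `H²`-solutions are `H¹₀`-solutions -/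

/-- The inclusion `H¹₀(Ω) ∩ L^p(Ω) → L²(Ω) ∩ L^p(Ω)`. -/
def Inter.incl (Ω : Set (EuclideanSpace ℝ (Fin N))) (p : ℝ≥0∞) [Fact (1 ≤ p)] :
    Inter (H10.toL2 Ω) p →L[ℝ] Inter (ContinuousLinearMap.id ℝ (LpSp Ω 2)) p :=
  ((Inter.toL2 (H10.toL2 Ω) p).prod (Inter.toLp (H10.toL2 Ω) p)).codRestrict
    (interSub (ContinuousLinearMap.id ℝ (LpSp Ω 2)) p) fun x => Inter.toL2_ae_eq x

theorem MemW1Loc.clm {E F : Type*} [NormedAddCommGroup E] [NormedAddCommGroup F] [NormedSpace ℝ E]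
    [NormedSpace ℝ F] [CompleteSpace E] [CompleteSpace F] {w : ℝ → E} {p : ℝ≥0∞} (hp : 1 ≤ p)
    (hw : MemW1Loc w p) (L : E →L[ℝ] F) : MemW1Loc (fun t => L (w t)) p := by
  obtain ⟨h1, v, hv, hwv⟩ := hw
  refine ⟨h1.clm L, fun t => L (v t), hv.clm L, fun s t hs hst => ?_⟩
  rw [L.intervalIntegral_comp_comm ((hv.mono_exponent hp).intervalIntegrable hs hst),
    ← map_add, ← hwv s t hs hst]

/-- Restricting functionals along the inclusion of `H¹₀ ∩ L^{m+1}` in `L² ∩ L^{m+1}` carries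
`toDual` to `toDual`, so the energy identity is needed for one class only. -/
theorem IsH2Solution.isH10Solution {m : ℝ} (hm0 : 0 < m) {a : ℂ} {f u : ℝ → LpSp Ω 2}
    (hu : IsH2Solution m a f u) : IsH10Solution m a f u where
  memLp := hu.memLp
  memW1 := hu.memW1.clm (ENNReal.one_le_ofReal.2 (holderConjugate hm0).symm.lt.le)
    (ContinuousLinearMap.precomp ℝ (Inter.incl Ω (expo m)))
  laplacian := by
    filter_upwards [hu.laplacian] with t ⟨T, hT⟩
    exact ⟨T.comp (H10.toL2 Ω), fun φ hφ h hh => hT φ hφ _ hh⟩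
  eqn := hu.eqn

end

section

variable {N : ℕ} {Ω : Set (EuclideanSpace ℝ (Fin N))}

/-! ### The `L^p` norm on `L²` -/

/-- Multiplication by `χ` as a continuous linear map from `L²(Ω)` to `L^p(Ω)`. -/
theorem exists_clm_mul {p : ℝ≥0∞} [Fact (1 ≤ p)] {χ : EuclideanSpace ℝ (Fin N) → ℂ}
    (hχ : Continuous χ) {B : ℝ≥0∞} (hB : B ≠ ⊤)
    (h : ∀ w : EuclideanSpace ℝ (Fin N) → ℂ, AEStronglyMeasurable w (volume.restrict Ω) →
      eLpNorm (fun x => χ x * w x) p (volume.restrict Ω) ≤ B * eLpNorm w 2 (volume.restrict Ω)) :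
    ∃ T : LpSp Ω 2 →L[ℝ] LpSp Ω p, ∀ w, T w =ᵐ[volume.restrict Ω] fun x => χ x * w x := by
  have hmem : ∀ w : LpSp Ω 2, MemLp (fun x => χ x * w x) p (volume.restrict Ω) := fun w =>
    ⟨hχ.aestronglyMeasurable.mul (Lp.aestronglyMeasurable w),
      (h w (Lp.aestronglyMeasurable w)).trans_lt
        (ENNReal.mul_lt_top hB.lt_top (Lp.memLp w).2)⟩
  let T : LpSp Ω 2 →ₗ[ℝ] LpSp Ω p :=
    { toFun := fun w => (hmem w).toLp _
      map_add' := fun w w' => by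
        refine Lp.ext ?_
        filter_upwards [(hmem (w + w')).coeFn_toLp, (hmem w).coeFn_toLp, (hmem w').coeFn_toLp,
          Lp.coeFn_add ((hmem w).toLp _) ((hmem w').toLp _), Lp.coeFn_add w w'] with x h1 h2 h3 h4 h5
        rw [h1, h4, Pi.add_apply, h2, h3, h5, Pi.add_apply, mul_add]
      map_smul' := fun c w => by
        refine Lp.ext ?_
        filter_upwards [(hmem (c • w)).coeFn_toLp, (hmem w).coeFn_toLp,
          Lp.coeFn_smul c ((hmem w).toLp _), Lp.coeFn_smul c w] with x h1 h2 h4 h5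
        rw [h1, RingHom.id_apply, h4, Pi.smul_apply, h2, h5, Pi.smul_apply, mul_smul_comm] }
  refine ⟨T.mkContinuous B.toReal fun w => ?_, fun w => (hmem w).coeFn_toLp⟩
  change ‖(hmem w).toLp _‖ ≤ _
  rw [Lp.norm_toLp, Lp.norm_def, ← ENNReal.toReal_mul]
  exact ENNReal.toReal_mono (ENNReal.mul_ne_top hB (Lp.memLp w).2.ne)
    (h w (Lp.aestronglyMeasurable w))

/-- The embedding of `L²(Ω)` into `L^{m+1}(Ω)` when `|Ω| < ∞` or `m = 1`. -/
theorem exists_embedding {m : ℝ} (hm0 : 0 < m) (hm1 : m ≤ 1) (h : volume Ω < ⊤ ∨ m = 1) :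
    ∃ T : LpSp Ω 2 →L[ℝ] LpSp Ω (expo m), ∀ w, T w =ᵐ[volume.restrict Ω] w := by
  obtain ⟨B, hB, hle⟩ : ∃ B : ℝ≥0∞, B ≠ ⊤ ∧ ∀ w : EuclideanSpace ℝ (Fin N) → ℂ,
      AEStronglyMeasurable w (volume.restrict Ω) →
      eLpNorm (fun x => 1 * w x) (expo m) (volume.restrict Ω)
        ≤ B * eLpNorm w 2 (volume.restrict Ω) := by
    rcases h with h | h
    · refine ⟨volume.restrict Ω univ ^ (1 / (expo m).toReal - 1 / (2 : ℝ≥0∞).toReal), ?_,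
        fun w hw => ?_⟩
      · refine ENNReal.rpow_ne_top_of_nonneg ?_ (by simpa using h.ne)
        rw [expo_toReal hm0.le, ENNReal.toReal_ofNat, sub_nonneg]
        exact one_div_le_one_div_of_le (by positivity) (by linarith)
      · simp_rw [one_mul]
        rw [mul_comm]
        exact eLpNorm_le_eLpNorm_mul_rpow_measure_univ (expo_le_two hm0.le hm1) hw
    · refine ⟨1, ENNReal.one_ne_top, fun w _ => ?_⟩
      have e : expo m = 2 := by rw [h, expo, ENNReal.ofReal_one]; norm_num
      simp_rw [one_mul, e]
      exact le_rfl
  obtain ⟨T, hT⟩ := exists_clm_mul continuous_const hB hle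
  exact ⟨T, fun w => by simpa using hT w⟩

/-- Sublevel sets are sequentially closed: convergence in `L²` gives an almost everywhere convergent
subsequence, to which Fatou applies. -/
theorem lowerSemicontinuous_eLpNorm (p : ℝ≥0∞) :
    LowerSemicontinuous fun w : LpSp Ω 2 => eLpNorm w p (volume.restrict Ω) := by
  rw [lowerSemicontinuous_iff_isClosed_preimage]
  intro c
  refine IsSeqClosed.isClosed fun w w' hw hlim => ?_
  obtain ⟨ns, -, hns⟩ := (tendstoInMeasure_of_tendsto_Lp hlim).exists_seq_tendsto_ae
  refine (Lp.eLpNorm_lim_le_liminf_eLpNorm (fun n => Lp.aestronglyMeasurable (w (ns n))) w'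
    hns).trans ?_
  exact liminf_le_of_le (by isBoundedDefault) fun b hb => by
    obtain ⟨n, hn⟩ := hb.exists
    exact hn.trans (hw (ns n))

/-! ### Passing to the limit -/

/-- The delicate point is strong measurability into `L^{m+1}`, since `u` is continuous only into
`L²`. The truncations `χₙ u` are measurable because multiplication by `χₙ` is bounded from `L²` to
`L^{m+1}`, and they converge in `L^{m+1}` at almost every time. -/
theorem memLpLocLp_of_lintegral {m : ℝ} (hm0 : 0 < m) (hm1 : m ≤ 1) {u : ℝ → LpSp Ω 2}
    (hu : ContinuousOn u (Ici 0))
    (h : ∀ T : ℝ, 0 < T →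
      ∫⁻ σ in Ioo 0 T, eLpNorm (u σ) (expo m) (volume.restrict Ω) ^ (m + 1) < ⊤) :
    MemLpLocLp u (expo m) := by
  classical
  let U : ℝ → LpSp Ω (expo m) := fun t =>
    -- The default value `0` is used only on a null set of positive times, by `hmem`.
    if ht : MemLp (u t) (expo m) (volume.restrict Ω) then ht.toLp _ else 0
  have hmeas : ∀ T : ℝ, AEStronglyMeasurable u (volume.restrict (Ioo 0 T)) := fun T =>
    (hu.mono (Ioo_subset_Ioi_self.trans Ioi_subset_Ici_self)).aestronglyMeasurable measurableSet_Ioo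
  have hmem : ∀ T : ℝ, 0 < T → ∀ᵐ t ∂(volume.restrict (Ioo 0 T)),
      MemLp (u t) (expo m) (volume.restrict Ω) := by
    intro T hT
    borelize (LpSp Ω 2)
    have hN : AEMeasurable (fun σ => eLpNorm (u σ) (expo m) (volume.restrict Ω) ^ (m + 1))
        (volume.restrict (Ioo 0 T)) :=
      ((lowerSemicontinuous_eLpNorm (expo m)).measurable.comp_aemeasurable
        (hmeas T).aemeasurable).pow_const _
    filter_upwards [ae_lt_top' hN (h T hT).ne] with t ht
    exact ⟨Lp.aestronglyMeasurable _, (ENNReal.rpow_lt_top_iff_of_pos (by positivity)).1 ht⟩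
  have hUeq : ∀ t, MemLp (u t) (expo m) (volume.restrict Ω) → U t =ᵐ[volume.restrict Ω] u t := by
    intro t ht
    simp only [U, dif_pos ht]
    exact ht.coeFn_toLp
  refine ⟨U, fun T hT => ⟨?_, ?_⟩, ?_⟩
  · obtain ⟨C, -, χ, hχ⟩ := exists_isCutoff N
    have hT : ∀ n, ∃ L : LpSp Ω 2 →L[ℝ] LpSp Ω (expo m),
        ∀ w, L w =ᵐ[volume.restrict Ω] fun x => χ n x * w x := fun n => by
      obtain ⟨B, hB, hle⟩ := hχ.eLpNorm_mul_le_two (Ω := Ω) n (expo_le_two hm0.le hm1)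
      exact exists_clm_mul (hχ.contDiff n).continuous hB hle
    choose L hL using hT
    refine aestronglyMeasurable_of_tendsto_ae atTop (f := fun n t => L n (u t))
      (fun n => (L n).continuous.comp_aestronglyMeasurable (hmeas T)) ?_
    filter_upwards [hmem T ‹_›] with t ht
    rw [Lp.tendsto_Lp_iff_tendsto_eLpNorm']
    refine (hχ.tendsto_eLpNorm Fact.out ht).congr fun n => ?_
    rw [← eLpNorm_neg]
    refine eLpNorm_congr_ae ?_
    filter_upwards [hL n (u t), hUeq t ht] with x h1 h2
    simp only [Pi.neg_apply, Pi.sub_apply, h1, h2, neg_sub]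
  · rw [eLpNorm_lt_top_iff_lintegral_rpow_enorm_lt_top (expo_ne_zero m) Fact.out,
      expo_toReal hm0.le]
    refine lt_of_eq_of_lt (lintegral_congr_ae ?_) (h T hT)
    filter_upwards [hmem T hT] with t ht
    rw [Lp.enorm_def, eLpNorm_congr_ae (hUeq t ht)]
  · have : Ioi (0 : ℝ) = ⋃ n : ℕ, Ioo (0 : ℝ) (n + 1) := by
      ext x
      simp only [mem_Ioi, mem_iUnion, mem_Ioo]
      refine ⟨fun hx => ?_, fun ⟨n, hn⟩ => hn.1⟩
      obtain ⟨n, hn⟩ := exists_nat_gt x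
      exact ⟨n, hx, by linarith⟩
    rw [this, ae_restrict_iUnion_iff]
    intro n
    filter_upwards [hmem (n + 1) (by positivity)] with t ht
    exact hUeq t ht

theorem damping_nonneg (m : ℝ) (u : ℝ → LpSp Ω 2) {s t : ℝ} (hst : s ≤ t) :
    0 ≤ damping m u s t :=
  intervalIntegral.integral_nonneg hst fun σ _ => by positivity

/-- In `damping` an infinite norm is read as `0` by `toReal`; the membership excludes this at almost
every time, so the real integral is the true one. -/
theorem MemLpLocLp.ofReal_damping {m : ℝ} (hm : 0 < m) {u : ℝ → LpSp Ω 2}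
    (hu : MemLpLocLp u (expo m)) {s t : ℝ} (hs : 0 ≤ s) (hst : s ≤ t) :
    ENNReal.ofReal (damping m u s t)
      = ∫⁻ σ in Ioc s t, eLpNorm (u σ) (expo m) (volume.restrict Ω) ^ (m + 1) := by
  have hi := (hu.memLpLoc_rpow hm).intervalIntegrable hs hst
  rw [intervalIntegrable_iff_integrableOn_Ioc_of_le hst] at hi
  rw [damping, intervalIntegral.integral_of_le hst, ofReal_integral_eq_lintegral_ofReal hi
    (Eventually.of_forall fun σ => by positivity)]
  obtain ⟨U, -, hU⟩ := hu
  refine lintegral_congr_ae (ae_restrict_of_ae_restrict_of_subset (t := Ioi 0)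
    (fun x hx => hs.trans_lt hx.1) ?_)
  filter_upwards [hU] with σ hσ
  have hfin : eLpNorm (u σ) (expo m) (volume.restrict Ω) ≠ ⊤ := by
    rw [← eLpNorm_congr_ae hσ]; exact (Lp.memLp (U σ)).2.ne
  rw [← ENNReal.ofReal_rpow_of_nonneg ENNReal.toReal_nonneg (by positivity),
    ENNReal.ofReal_toReal hfin]

/-- Lower semicontinuity in space at each time, then Fatou in time. -/
theorem lintegral_eLpNorm_le_of_tendsto {m : ℝ} (hm : 0 < m) {un : ℕ → ℝ → LpSp Ω 2}
    {u : ℝ → LpSp Ω 2} (hun : ∀ n, MemLpLocLp (un n) (expo m))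
    (hlim : ∀ t, 0 ≤ t → Tendsto (fun n => un n t) atTop (𝓝 (u t))) {s t ℓ : ℝ} (hs : 0 ≤ s)
    (hst : s ≤ t) (hℓ : Tendsto (fun n => damping m (un n) s t) atTop (𝓝 ℓ)) :
    ∫⁻ σ in Ioc s t, eLpNorm (u σ) (expo m) (volume.restrict Ω) ^ (m + 1)
      ≤ ENNReal.ofReal ℓ := by
  have hpow : Continuous fun x : ℝ≥0∞ => x ^ (m + 1) := ENNReal.continuous_rpow_const
  have hmono : Monotone fun x : ℝ≥0∞ => x ^ (m + 1) :=
    ENNReal.monotone_rpow_of_nonneg (by positivity)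
  have h1 : ∀ σ ∈ Ioc s t, eLpNorm (u σ) (expo m) (volume.restrict Ω) ^ (m + 1)
      ≤ liminf (fun n => eLpNorm (un n σ) (expo m) (volume.restrict Ω) ^ (m + 1)) atTop := by
    intro σ hσ
    have hlsc := hpow.comp_lowerSemicontinuous (lowerSemicontinuous_eLpNorm (Ω := Ω) (expo m)) hmono
    have := LowerSemicontinuousAt.le_liminf (hlsc (u σ))
    exact this.trans (liminf_le_liminf_of_le (hlim σ (hs.trans hσ.1.le)))
  refine (setLIntegral_mono' measurableSet_Ioc h1).trans ((lintegral_liminf_le' fun n => ?_).trans ?_)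
  · obtain ⟨U, hU, hUu⟩ := hun n
    have hm' : AEMeasurable (fun σ => ‖U σ‖ₑ ^ (m + 1)) (volume.restrict (Ioc s t)) := by
      have := (hU (t + 1) (by linarith)).1.enorm
      have hsub : Ioc s t ⊆ Ioo 0 (t + 1) := fun x hx =>
        ⟨hs.trans_lt hx.1, by linarith [hx.2]⟩
      exact (this.mono_measure (Measure.restrict_mono hsub le_rfl)).pow_const _
    refine hm'.congr (ae_restrict_of_ae_restrict_of_subset (t := Ioi 0)
      (fun x hx => hs.trans_lt hx.1) ?_)
    filter_upwards [hUu] with σ hσ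
    rw [Lp.enorm_def, eLpNorm_congr_ae hσ]
  · refine le_of_eq (Tendsto.liminf_eq ?_)
    simp_rw [← (hun _).ofReal_damping hm hs hst]
    exact (ENNReal.continuous_ofReal.tendsto ℓ).comp hℓ

theorem memLpLocLp_of_tendsto {m : ℝ} (hm0 : 0 < m) (hm1 : m ≤ 1) {un : ℕ → ℝ → LpSp Ω 2}
    {u : ℝ → LpSp Ω 2} (hu : ContinuousOn u (Ici 0)) (hun : ∀ n, MemLpLocLp (un n) (expo m))
    (hlim : ∀ t, 0 ≤ t → Tendsto (fun n => un n t) atTop (𝓝 (u t))) {ℓ : ℝ → ℝ → ℝ}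
    (hℓ : ∀ s t : ℝ, 0 ≤ s → s ≤ t →
      Tendsto (fun n => damping m (un n) s t) atTop (𝓝 (ℓ s t))) :
    MemLpLocLp u (expo m) ∧ ∀ s t : ℝ, 0 ≤ s → s ≤ t → damping m u s t ≤ ℓ s t := by
  have key : ∀ s t : ℝ, 0 ≤ s → s ≤ t → _ := fun s t hs hst =>
    lintegral_eLpNorm_le_of_tendsto hm0 hun hlim hs hst (hℓ s t hs hst)
  have hmem : MemLpLocLp u (expo m) := memLpLocLp_of_lintegral hm0 hm1 hu fun T hT =>
    (lintegral_mono_set Ioo_subset_Ioc_self).trans_lt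
      ((key 0 T le_rfl hT.le).trans_lt ENNReal.ofReal_lt_top)
  refine ⟨hmem, fun s t hs hst => ?_⟩
  have h := key s t hs hst
  rw [← hmem.ofReal_damping hm0 hs hst] at h
  exact (ENNReal.ofReal_le_ofReal_iff (ge_of_tendsto' (hℓ s t hs hst)
    fun n => damping_nonneg m (un n) hst)).1 h

/-! ### Limits of the terms of the energy balance -/

section Limit

variable {f u : ℝ → LpSp Ω 2} {fn un : ℕ → ℝ → LpSp Ω 2}

theorem continuousOn_of_tendstoUniformlyOn (hun : ∀ n, ContinuousOn (un n) (Ici 0))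
    (hlim : ∀ T : ℝ, 0 < T → TendstoUniformlyOn un u atTop (Icc 0 T)) :
    ContinuousOn u (Ici 0) := by
  intro t ht
  have hT : 0 < t + 1 := add_pos_of_nonneg_of_pos ht one_pos
  have h : ContinuousOn u (Icc 0 (t + 1)) := (hlim _ hT).continuousOn
    (Frequently.of_forall fun n => (hun n).mono Icc_subset_Ici_self)
  refine (h t ⟨ht, by linarith⟩).mono_of_mem_nhdsWithin ?_
  rw [← Ici_inter_Iic]
  exact inter_mem_nhdsWithin _ (Iic_mem_nhds (by linarith))

theorem exists_eventually_norm_le (hu : ContinuousOn u (Ici 0)) {T : ℝ}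
    (hlim : TendstoUniformlyOn un u atTop (Icc 0 T)) :
    ∃ C : ℝ, 0 ≤ C ∧ ∀ᶠ n in atTop, ∀ t ∈ Icc 0 T, ‖un n t‖ ≤ C := by
  obtain ⟨C, hC⟩ := isCompact_Icc.exists_bound_of_continuousOn
    (hu.mono (Icc_subset_Ici_self : Icc 0 T ⊆ Ici 0))
  refine ⟨|C| + 1, by positivity, ?_⟩
  filter_upwards [Metric.tendstoUniformlyOn_iff.1 hlim 1 one_pos] with n hn t ht
  have h1 := hn t ht
  rw [dist_comm, dist_eq_norm] at h1
  have h2 := norm_le_norm_add_norm_sub (u t) (un n t)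
  rw [norm_sub_rev] at h2
  linarith [hC t ht, le_abs_self C]

/-- The difference splits into `fₙ - f`, small in `L¹`, paired with the bounded `uₙ`, and the
integrable `f` paired with the uniformly small `uₙ - u`. -/
theorem tendsto_integral_forcing (hf : MemLpLoc f 1) (hfn : ∀ n, MemLpLoc (fn n) 1)
    (hu : ContinuousOn u (Ici 0)) (hun : ∀ n, ContinuousOn (un n) (Ici 0))
    (hflim : ∀ T : ℝ, 0 < T →
      Tendsto (fun n => eLpNorm (fun t => fn n t - f t) 1 (volume.restrict (Ioo 0 T))) atTop (𝓝 0))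
    (hlim : ∀ T : ℝ, 0 < T → TendstoUniformlyOn un u atTop (Icc 0 T)) {s t : ℝ} (hs : 0 ≤ s)
    (hst : s ≤ t) :
    Tendsto (fun n => ∫ σ in s..t, forcing (fn n) (un n) σ) atTop
      (𝓝 (∫ σ in s..t, forcing f u σ)) := by
  set T := t + 1 with hTdef
  have hT : 0 < T := by linarith
  have hsub : Ioc s t ⊆ Ioo 0 T := fun x hx => ⟨hs.trans_lt hx.1, by linarith [hx.2]⟩
  have hF := memLpLoc_forcing hf hu T hT
  simp_rw [intervalIntegral.integral_of_le hst]
  obtain ⟨C, hC0, hC⟩ := exists_eventually_norm_le hu (hlim T hT)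
  have key : Tendsto (fun n => ∫⁻ σ in Ioo 0 T, ‖forcing (fn n) (un n) σ - forcing f u σ‖ₑ)
      atTop (𝓝 0) := by
    refine ENNReal.tendsto_nhds_zero.2 fun ε hε => ?_
    have hfin : eLpNorm f 1 (volume.restrict (Ioo 0 T)) ≠ ⊤ := (hf T hT).2.ne
    have t1 : Tendsto (fun n => ENNReal.ofReal C
        * eLpNorm (fun t => fn n t - f t) 1 (volume.restrict (Ioo 0 T))) atTop (𝓝 0) := by
      simpa using ENNReal.Tendsto.const_mul (hflim T hT) (Or.inr ENNReal.ofReal_ne_top)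
    have t2 : Tendsto (fun δ : ℝ => ENNReal.ofReal δ
        * eLpNorm f 1 (volume.restrict (Ioo 0 T))) (𝓝[>] 0) (𝓝 0) := by
      have h0 : Tendsto (fun δ : ℝ => ENNReal.ofReal δ) (𝓝[>] 0) (𝓝 0) := by
        simpa using (ENNReal.continuous_ofReal.tendsto 0).mono_left nhdsWithin_le_nhds
      simpa using ENNReal.Tendsto.mul_const h0 (Or.inr hfin)
    have hε2 : 0 < ε / 2 := ENNReal.half_pos hε.ne'
    obtain ⟨δ, hδε, hδ⟩ := ((ENNReal.tendsto_nhds_zero.1 t2 _ hε2).and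
      self_mem_nhdsWithin).exists
    filter_upwards [hC, Metric.tendstoUniformlyOn_iff.1 (hlim T hT) δ hδ,
      ENNReal.tendsto_nhds_zero.1 t1 _ hε2] with n hn1 hn2 hn3
    have hpt : ∀ σ ∈ Ioo 0 T, ‖forcing (fn n) (un n) σ - forcing f u σ‖ₑ
        ≤ ENNReal.ofReal C * ‖fn n σ - f σ‖ₑ + ENNReal.ofReal δ * ‖f σ‖ₑ := by
      intro σ hσ
      have hσ' := Ioo_subset_Icc_self hσ
      have e : forcing (fn n) (un n) σ - forcing f u σ
          = inner ℂ (un n σ) (fn n σ - f σ) + inner ℂ (un n σ - u σ) (f σ) := by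
        rw [forcing_eq_inner, forcing_eq_inner, inner_sub_right, inner_sub_left]; ring
      rw [e]
      refine (enorm_add_le _ _).trans (add_le_add ?_ ?_)
      · rw [← ofReal_norm, ← ofReal_norm, ← ENNReal.ofReal_mul hC0]
        exact ENNReal.ofReal_le_ofReal ((norm_inner_le_norm _ _).trans
          (mul_le_mul_of_nonneg_right (hn1 σ hσ') (norm_nonneg _)))
      · rw [← ofReal_norm, ← ofReal_norm, ← ENNReal.ofReal_mul (le_of_lt hδ)]
        have h2 := (hn2 σ hσ').le
        rw [dist_comm, dist_eq_norm] at h2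
        exact ENNReal.ofReal_le_ofReal ((norm_inner_le_norm _ _).trans
          (mul_le_mul_of_nonneg_right h2 (norm_nonneg _)))
    refine (setLIntegral_mono' measurableSet_Ioo hpt).trans ?_
    rw [lintegral_add_right' _ ((hf T hT).1.enorm.const_mul _),
      lintegral_const_mul' _ _ ENNReal.ofReal_ne_top, lintegral_const_mul' _ _ ENNReal.ofReal_ne_top,
      ← eLpNorm_one_eq_lintegral_enorm, ← eLpNorm_one_eq_lintegral_enorm]
    exact (add_le_add hn3 hδε).trans (ENNReal.add_halves ε).le
  have h := tendsto_setIntegral_of_L1 (forcing f u) hF.1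
    (Eventually.of_forall fun n => memLp_one_iff_integrable.1
      (memLpLoc_forcing (hfn n) (hun n) T hT)) key (Ioc s t)
  rwa [Measure.restrict_restrict measurableSet_Ioc, inter_eq_left.2 hsub] at h

/-- Through the embedding `L`, the damping density is continuous on `L²`, not just lower
semicontinuous, and the uniform bound on `uₙ` permits dominated convergence. -/
theorem tendsto_damping {m : ℝ} (hm : 0 < m) {L : LpSp Ω 2 →L[ℝ] LpSp Ω (expo m)}
    (hL : ∀ w, L w =ᵐ[volume.restrict Ω] w)
    (hu : ContinuousOn u (Ici 0)) (hun : ∀ n, ContinuousOn (un n) (Ici 0))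
    (hlim : ∀ T : ℝ, 0 < T → TendstoUniformlyOn un u atTop (Icc 0 T)) {s t : ℝ} (hs : 0 ≤ s)
    (hst : s ≤ t) :
    Tendsto (fun n => damping m (un n) s t) atTop (𝓝 (damping m u s t)) := by
  have e : ∀ w : LpSp Ω 2, (eLpNorm w (expo m) (volume.restrict Ω)).toReal = ‖L w‖ := fun w => by
    rw [Lp.norm_def, eLpNorm_congr_ae (hL w)]
  have hc : Continuous fun w => ‖L w‖ ^ (m + 1) :=
    L.continuous.norm.rpow_const fun _ => Or.inr (by positivity)
  simp_rw [damping, e]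
  obtain ⟨C, hC0, hC⟩ := exists_eventually_norm_le hu (hlim (t + 1) (by linarith))
  refine intervalIntegral.tendsto_integral_filter_of_dominated_convergence
    (fun _ => (‖L‖ * C) ^ (m + 1)) (Eventually.of_forall fun n => ?_) ?_
    intervalIntegrable_const (Eventually.of_forall fun σ hσ => ?_)
  · rw [uIoc_of_le hst]
    exact (hc.comp_continuousOn ((hun n).mono fun x hx =>
      hs.trans hx.1.le)).aestronglyMeasurable measurableSet_Ioc
  · filter_upwards [hC] with n hn
    refine Eventually.of_forall fun σ hσ => ?_
    rw [uIoc_of_le hst] at hσ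
    rw [Real.norm_of_nonneg (by positivity)]
    refine Real.rpow_le_rpow (norm_nonneg _) ((L.le_opNorm _).trans ?_) (by positivity)
    exact mul_le_mul_of_nonneg_left (hn σ ⟨hs.trans hσ.1.le, by linarith [hσ.2]⟩) (norm_nonneg _)
  · rw [uIoc_of_le hst] at hσ
    exact (hc.tendsto _).comp ((hlim (t + 1) (by linarith)).tendsto_at
      ⟨hs.trans hσ.1.le, by linarith [hσ.2]⟩)

theorem memLpLocLp_of_continuousOn {m : ℝ} {L : LpSp Ω 2 →L[ℝ] LpSp Ω (expo m)}
    (hL : ∀ w, L w =ᵐ[volume.restrict Ω] w) (hu : ContinuousOn u (Ici 0)) :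
    MemLpLocLp u (expo m) := by
  refine ⟨fun t => L (u t), fun T hT => ?_, Eventually.of_forall fun t => hL _⟩
  have hc : ContinuousOn (fun t => L (u t)) (Icc 0 T) :=
    L.continuous.comp_continuousOn (hu.mono Icc_subset_Ici_self)
  obtain ⟨C, hC⟩ := isCompact_Icc.exists_bound_of_continuousOn hc
  exact MemLp.of_bound ((hc.mono Ioo_subset_Icc_self).aestronglyMeasurable measurableSet_Ioo) C
    ((ae_restrict_iff' measurableSet_Ioo).2 (Eventually.of_forall fun t ht =>
      hC t (Ioo_subset_Icc_self ht)))

/-- The derivative is read off the balance. If `Im a = 0` the norms need not be integrable in time,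
but their coefficient vanishes. -/
theorem memW1Loc_norm_sq {m : ℝ} (hm : 0 < m) {a : ℂ} (hf : MemLpLoc f 1)
    (hu : ContinuousOn u (Ici 0)) (ha : a.im = 0 ∨ MemLpLocLp u (expo m))
    (h : ∀ s t : ℝ, 0 ≤ s → s ≤ t → 1 / 2 * ‖u t‖ ^ 2 + a.im * damping m u s t
        = 1 / 2 * ‖u s‖ ^ 2 + (∫ σ in s..t, forcing f u σ).im) :
    MemW1Loc (fun t => ‖u t‖ ^ 2) 1 := by
  have hF := memLpLoc_forcing hf hu
  have hD : MemLpLoc (fun σ => a.im *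
      (eLpNorm (u σ) (expo m) (volume.restrict Ω)).toReal ^ (m + 1)) 1 := by
    rcases ha with ha | ha
    · simp_rw [ha, zero_mul]
      exact fun T _ => MemLp.zero
    · exact fun T hT => (ha.memLpLoc_rpow hm T hT).const_mul _
  refine ⟨fun T hT => ?_, fun σ => 2 * (Complex.imCLM (forcing f u σ) - a.im *
    (eLpNorm (u σ) (expo m) (volume.restrict Ω)).toReal ^ (m + 1)), fun T hT =>
    ((hF.clm Complex.imCLM T hT).sub (hD T hT)).const_mul 2, fun s t hs hst => ?_⟩
  · have hc : ContinuousOn (fun t => ‖u t‖ ^ 2) (Icc 0 T) :=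
      (hu.mono Icc_subset_Ici_self).norm.pow 2
    exact memLp_one_iff_integrable.2 ((hc.integrableOn_Icc).mono_set Ioo_subset_Icc_self)
  · rw [intervalIntegral.integral_const_mul, intervalIntegral.integral_sub
      ((hF.clm Complex.imCLM).intervalIntegrable hs hst) (hD.intervalIntegrable hs hst),
      ContinuousLinearMap.intervalIntegral_comp_comm _ (hF.intervalIntegrable hs hst),
      Complex.imCLM_apply, intervalIntegral.integral_const_mul]
    have := h s t hs hst
    rw [damping] at this
    linarith

end Limit

theorem IsStrongSolution.isH10Solution {m : ℝ} (hm : 0 < m) {a : ℂ} {f u : ℝ → LpSp Ω 2}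
    {u₀ : LpSp Ω 2} (hu : IsStrongSolution m a f u₀ u) : IsH10Solution m a f u :=
  hu.1.elim (fun h => h.isH10Solution hm) id

/-- Weak solutions are limits of strong ones, whose damping terms converge after multiplication
by `Im a`. -/
theorem IsWeakSolution.energy (hΩ : IsOpen Ω) {m : ℝ} (hm0 : 0 < m) (hm1 : m ≤ 1) {a : ℂ}
    {f u : ℝ → LpSp Ω 2} {u₀ : LpSp Ω 2} (hf : MemLpLoc f 1) (hu : IsWeakSolution m a f u₀ u) :
    ContinuousOn u (Ici 0) ∧ ∃ un : ℕ → ℝ → LpSp Ω 2,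
      (∀ n, ContinuousOn (un n) (Ici 0) ∧ MemLpLocLp (un n) (expo m)) ∧
      (∀ T : ℝ, 0 < T → TendstoUniformlyOn un u atTop (Icc 0 T)) ∧
      ∀ s t : ℝ, 0 ≤ s → s ≤ t → Tendsto (fun n => a.im * damping m (un n) s t) atTop
        (𝓝 (1 / 2 * ‖u s‖ ^ 2 + (∫ σ in s..t, forcing f u σ).im - 1 / 2 * ‖u t‖ ^ 2)) := by
  obtain ⟨⟨fn, un, hn, hlim⟩, -⟩ := hu
  have hu := continuousOn_of_tendstoUniformlyOn (fun n => (hn n).2.1) fun T hT => (hlim T hT).2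
  have hen := fun n => IsH10Solution.energy hΩ hm0 hm1 (hn n).1 ((hn n).2.2.isH10Solution hm0)
  refine ⟨hu, un, fun n => ⟨(hen n).1, (hen n).2.1⟩, fun T hT => (hlim T hT).2,
    fun s t hs hst => ?_⟩
  have hpt : ∀ τ, 0 ≤ τ → Tendsto (fun n => un n τ) atTop (𝓝 (u τ)) := fun τ hτ =>
    (hlim (τ + 1) (by linarith)).2.tendsto_at ⟨hτ, by linarith⟩
  have hsq : ∀ τ, 0 ≤ τ → Tendsto (fun n => 1 / 2 * ‖un n τ‖ ^ 2) atTop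
      (𝓝 (1 / 2 * ‖u τ‖ ^ 2)) := fun τ hτ => ((hpt τ hτ).norm.pow 2).const_mul _
  have hF := tendsto_integral_forcing hf (fun n => (hn n).1) hu (fun n => (hn n).2.1)
    (fun T hT => (hlim T hT).1) (fun T hT => (hlim T hT).2) hs hst
  refine (((hsq s hs).add ((Complex.continuous_im.tendsto _).comp hF)).sub
    (hsq t (hs.trans hst))).congr fun n => ?_
  have := (hen n).2.2 s t hs hst
  simp only [Function.comp_apply]
  linarith

end

end DampedNLS

end

/-! ### The mass inequality and equality -/

theorem proposition2p2 {N : ℕ} (Ω : Set (EuclideanSpace ℝ (Fin N))) (hΩ : IsOpen Ω)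
    (m : ℝ) (hm0 : 0 < m) (hm1 : m ≤ 1) (a : ℂ)
    (f : ℝ → DampedNLS.LpSp Ω 2) (hf : DampedNLS.MemLpLoc f 1)
    (u₀ : DampedNLS.LpSp Ω 2) (u : ℝ → DampedNLS.LpSp Ω 2)
    (hu : DampedNLS.IsWeakSolution m a f u₀ u ∨ DampedNLS.IsStrongSolution m a f u₀ u) :
    -- the integrability of `u`
    ((a.im ≠ 0 ∨ DampedNLS.IsStrongSolution m a f u₀ u ∨ volume Ω < ⊤ ∨ m = 1) →
      DampedNLS.MemLpLocLp u (DampedNLS.expo m)) ∧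
    -- the right-hand side of the mass inequality is well defined
    (∀ s t : ℝ, 0 ≤ s → s ≤ t → IntervalIntegrable (DampedNLS.forcing f u) volume s t) ∧
    -- the mass inequality
    (a.im ≤ 0 → ∀ s t : ℝ, 0 ≤ s → s ≤ t →
      1 / 2 * ‖u s‖ ^ 2 + (∫ σ in s..t, DampedNLS.forcing f u σ).im
        ≤ 1 / 2 * ‖u t‖ ^ 2 + a.im * DampedNLS.damping m u s t) ∧
    (0 ≤ a.im → ∀ s t : ℝ, 0 ≤ s → s ≤ t →
      1 / 2 * ‖u t‖ ^ 2 + a.im * DampedNLS.damping m u s t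
        ≤ 1 / 2 * ‖u s‖ ^ 2 + (∫ σ in s..t, DampedNLS.forcing f u σ).im) ∧
    -- the mass equality
    ((DampedNLS.IsStrongSolution m a f u₀ u ∨ volume Ω < ⊤ ∨ m = 1 ∨ a.im = 0) →
      DampedNLS.MemW1Loc (fun t => ‖u t‖ ^ 2) 1 ∧
      ∀ s t : ℝ, 0 ≤ s → s ≤ t →
        1 / 2 * ‖u t‖ ^ 2 + a.im * DampedNLS.damping m u s t
          = 1 / 2 * ‖u s‖ ^ 2 + (∫ σ in s..t, DampedNLS.forcing f u σ).im) := by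
  open DampedNLS in
  -- A weak solution may also be strong; splitting on strength makes the strong alternative vacuous
  -- in all that follows.
  by_cases hstrong : IsStrongSolution m a f u₀ u
  · obtain ⟨hc, hLp, hen⟩ := (hstrong.isH10Solution hm0).energy hΩ hm0 hm1 hf
    exact ⟨fun _ => hLp, fun s t hs hst => (memLpLoc_forcing hf hc).intervalIntegrable hs hst,
      fun _ s t hs hst => (hen s t hs hst).ge, fun _ s t hs hst => (hen s t hs hst).le,
      fun _ => ⟨memW1Loc_norm_sq hm0 hf hc (Or.inr hLp) hen, hen⟩⟩
  obtain ⟨hc, un, hun, hunif, hlim⟩ := (hu.resolve_right hstrong).energy hΩ hm0 hm1 hf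
  have hpt : ∀ t, 0 ≤ t → Tendsto (fun n => un n t) atTop (𝓝 (u t)) := fun t ht =>
    (hunif (t + 1) (by linarith)).tendsto_at ⟨ht, by linarith⟩
  -- Since `Im a ≠ 0`, the convergence can be divided by it: the damping terms themselves converge,
  -- and Fatou applies.
  have hfatou : a.im ≠ 0 → MemLpLocLp u (expo m) ∧ ∀ s t : ℝ, 0 ≤ s → s ≤ t →
      damping m u s t ≤ (1 / 2 * ‖u s‖ ^ 2 + (∫ σ in s..t, forcing f u σ).im
        - 1 / 2 * ‖u t‖ ^ 2) / a.im := fun ha =>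
    memLpLocLp_of_tendsto hm0 hm1 hc (fun n => (hun n).2) hpt fun s t hs hst =>
      ((hlim s t hs hst).div_const a.im).congr fun n => mul_div_cancel_left₀ _ ha
  have hemb : volume Ω < ⊤ ∨ m = 1 → MemLpLocLp u (expo m) ∧ ∀ s t : ℝ, 0 ≤ s → s ≤ t →
      1 / 2 * ‖u t‖ ^ 2 + a.im * damping m u s t
        = 1 / 2 * ‖u s‖ ^ 2 + (∫ σ in s..t, forcing f u σ).im := by
    intro h
    obtain ⟨L, hL⟩ := exists_embedding hm0 hm1 h
    refine ⟨memLpLocLp_of_continuousOn hL hc, fun s t hs hst => ?_⟩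
    have := tendsto_nhds_unique (hlim s t hs hst) ((tendsto_damping hm0 hL hc
      (fun n => (hun n).1) hunif hs hst).const_mul a.im)
    linarith
  have hreal : a.im = 0 → ∀ s t : ℝ, 0 ≤ s → s ≤ t →
      1 / 2 * ‖u t‖ ^ 2 + a.im * damping m u s t
        = 1 / 2 * ‖u s‖ ^ 2 + (∫ σ in s..t, forcing f u σ).im := by
    intro ha s t hs hst
    have h := hlim s t hs hst
    simp_rw [ha, zero_mul] at h ⊢
    linarith [tendsto_nhds_unique h tendsto_const_nhds]
  refine ⟨?_, fun s t hs hst => (memLpLoc_forcing hf hc).intervalIntegrable hs hst, ?_, ?_, ?_⟩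
  · rintro (h | h | h)
    · exact (hfatou h).1
    · exact absurd h hstrong
    · exact (hemb h).1
  · intro ha s t hs hst
    rcases ha.eq_or_lt with ha | ha
    · exact (hreal ha s t hs hst).ge
    · have := (hfatou ha.ne).2 s t hs hst
      -- Fatou always bounds the damping from above; multiplying back by a negative `Im a` reverses
      -- the inequality.
      rw [le_div_iff_of_neg ha] at this
      linarith
  · intro ha s t hs hst
    rcases ha.eq_or_lt with ha | ha
    · exact (hreal ha.symm s t hs hst).le
    · have := (hfatou ha.ne').2 s t hs hst
      rw [le_div_iff₀ ha] at this
      linarith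
  · rintro (h | h | h | h)
    · exact absurd h hstrong
    · exact ⟨memW1Loc_norm_sq hm0 hf hc (Or.inr (hemb (Or.inl h)).1) (hemb (Or.inl h)).2,
        (hemb (Or.inl h)).2⟩
    · exact ⟨memW1Loc_norm_sq hm0 hf hc (Or.inr (hemb (Or.inr h)).1) (hemb (Or.inr h)).2,
        (hemb (Or.inr h)).2⟩
    · exact ⟨memW1Loc_norm_sq hm0 hf hc (Or.inl h) (hreal h), hreal h⟩
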